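/- Let $n\ge 1$ and let $J\subset\mathbf R$ be an interval (for instance $J=\mathbf R_+$). For an open set $U\subset\mathbf R^n$ put $d_U(x)=\operatorname{dist}(x,\partial U)$ for $x\in U$ and $d_U(x)=0$ for $x\notin U$, and let $d^s_U(x)=\operatorname{dist}(x,\partial U)$ for $x\in U$ and $d^s_U(x)=-\operatorname{dist}(x,\partial U)$ for $x\notin U$. A distance ray of $U$ is a maximal nondegenerate segment $[y,z]\subset\overline U$ along which $d_U$ is linear with slope $1$, increasing from $y$ to $z$; $\gamma_U(x)\in[0,\infty]$ denotes, for $x\in\overline U$, the supremum of the lengths of the segments through $x$ in $\overline U$ along which $d_U$ is linear with slope $1$ ($0$ if there are none). An open set $\Omega$ satisfies Condition 1 with radius $r>0$ if $\gamma_{\mathbf R^n\setminus\overline\Omega}(x)\ge 2r$ for every $x\in\mathbf R^n\setminus\overline\Omega$. Let $\{\Omega_t\}_{t\in J}$ be bounded open sets in $\mathbf R^n$ with $\Omega_t=\operatorname{int}\overline{\Omega_t}$. Assume that the family is locally Lipschitz: every $t_0\in J$ has a neighbourhood on which there is a constant $M>0$ such that, for all $t_1,t_2\in J$ in it, $(\Omega_{t_1}\setminus\Omega_{t_2})\cup(\Omega_{t_2}\setminus\Omega_{t_1})$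 is contained in the $M|t_1-t_2|$-neighbourhoods of $\partial\Omega_{t_1}$ and of $\partial\Omega_{t_2}$. Assume that every $\Omega_t$ satisfies Condition 1 with the same radius $r_0>0$. Put $$E=\bigcup_{t\in J}\Omega_t\times\{t\},\qquad \mathbf\Gamma=\bigcup_{t\in J}\partial\Omega_t\times\{t\},\qquad E_{r_0}=\bigcup_{t\in J}(\Omega_t)_{r_0}\times\{t\},\qquad D(x,t)=d^s_{\Omega_t}(x),$$ where $(\Omega_t)_{r_0}=\{x:\operatorname{dist}(x,\Omega_t)<r_0\}$ is the open $r_0$-neighbourhood of $\Omega_t$. For $(y,t_0)\in\mathbf\Gamma$, $\mathbf\Gamma$ is called (2,1) differentiable at $(y,t_0)$ if there are an orthonormal coordinate system $(x',x_n)$, $x'=(x_1,\dots,x_{n-1})$, of $\mathbf R^n$ with origin $y$, a $\delta>0$, a function $\Psi$ and numbers $v,\kappa_1,\dots,\kappa_{n-1}$ such that $E=\{x_n>\Psi(x',t)\}$ inside the ball of radius $\delta$ of $\mathbf R^{n+1}$ about $(y,t_0)$, and $$\Psi(x',t)=v(t-t_0)+\sum_{i=1}^{n-1}\kappa_i x_i^2+o(|x'|^2+|t-t_0|)\quad\text{as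 }(x',t)\to(0,t_0).$$ Then: (a) $\mathcal L^{n+1}$-a.e. $(x_0,t_0)\in E$ lies in the relative interior of a distance ray of $\Omega_{t_0}$ (that is, $x_0$ does) whose lower end $y$ belongs to $\partial\Omega_{t_0}$ and is such that $\mathbf\Gamma$ is (2,1) differentiable at $(y,t_0)$. (b) There is a constant $C$ depending only on $r_0$ such that for every $t\in J$ the function $x\mapsto D(x,t)-C|x|^2$ is concave on the slice $(\Omega_t)_{r_0}$ of $E_{r_0}$, in the sense that the concavity inequality holds for any two points of the slice and any convex combination of them that lies in the slice. -/

import Mathlib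

open Set Filter Topology MeasureTheory Asymptotics
open scoped ENNReal

noncomputable section

/-- The interior distance function `d_U`: the distance to `∂U` on `U`, and `0` off `U`. -/
def interiorDist {X : Type*} [PseudoMetricSpace X] (U : Set X) (x : X) : ℝ :=
  open Classical in if x ∈ U then Metric.infDist x (frontier U) else 0

/-- The signed distance function `d^s_U`: positive in `U`, nonpositive off `U`. -/
def signedBoundaryDist {X : Type*} [PseudoMetricSpace X] (U : Set X) (x : X) : ℝ :=
  open Classical in
  if x ∈ U then Metric.infDist x (frontier U) else -Metric.infDist x (frontier U)

section Rays

variable {X : Type*} [NormedAddCommGroup X] [NormedSpace ℝ X]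

/-- The segment `[p, q]` lies in the closure of `U` and `d_U` is linear with slope `1` along it,
increasing from `p` to `q`. -/
def IsSlopeOneSegment (U : Set X) (p q : X) : Prop :=
  segment ℝ p q ⊆ closure U ∧
    ∀ z ∈ segment ℝ p q, interiorDist U z = interiorDist U p + dist p z

/-- `[p, q]` is a distance ray of `U` with lower end `p` and upper end `q`: a nondegenerate
segment of slope one which is not contained in a larger one. -/
def IsDistanceRay (U : Set X) (p q : X) : Prop :=
  p ≠ q ∧ IsSlopeOneSegment U p q ∧
    ∀ p' q', IsSlopeOneSegment U p' q' →
      segment ℝ p q ⊆ segment ℝ p' q' → segment ℝ p' q' ⊆ segment ℝ p q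

/-- The ridge function `γ_U`: the (possibly infinite) supremum of the lengths of the segments of
slope one through `x`, for `x` in the closure of `U`. No such segment passes through a point
outside the closure of `U`, and the supremum over the empty family is `0`. -/
def ridgeFunction (U : Set X) (x : X) : ℝ≥0∞ :=
  ⨆ (p : X) (q : X) (_ : IsSlopeOneSegment U p q) (_ : x ∈ segment ℝ p q),
    ENNReal.ofReal (dist p q)

/-- The lower curvature bound condition with radius `r`: `γ ≥ 2r` for the exterior of `Ω`, at
every point of the exterior. -/
def LowerCurvatureBound (Ω : Set X) (r : ℝ) : Prop :=
  ∀ x ∈ (closure Ω)ᶜ, ENNReal.ofReal (2 * r) ≤ ridgeFunction (closure Ω)ᶜ x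

end Rays

/-- The family `Ω t`, `t ∈ J`, is locally Lipschitz in `t`: near each parameter in `J` there is a
constant `M > 0` such that the symmetric difference of any two of the sets lies in the
`M |t₁ - t₂|`-neighbourhoods of both boundaries. -/
def IsLocallyLipschitzFamily {X : Type*} [PseudoMetricSpace X] (J : Set ℝ) (Ω : ℝ → Set X) :
    Prop :=
  ∀ t₀ ∈ J, ∃ ε > 0, ∃ M > 0, ∀ t₁ ∈ J ∩ Metric.ball t₀ ε, ∀ t₂ ∈ J ∩ Metric.ball t₀ ε,
    (Ω t₁ \ Ω t₂) ∪ (Ω t₂ \ Ω t₁) ⊆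
      Metric.thickening (M * |t₁ - t₂|) (frontier (Ω t₁)) ∩
        Metric.thickening (M * |t₁ - t₂|) (frontier (Ω t₂))

/-- The space-time set `E`, the union over `t ∈ J` of `Ω t × {t}`. -/
def spaceTime {X : Type*} (J : Set ℝ) (Ω : ℝ → Set X) : Set (X × ℝ) :=
  {p | p.2 ∈ J ∧ p.1 ∈ Ω p.2}

/-- The space-time set `E_r`, the union over `t ∈ J` of `(Ω t)_r × {t}`, where `(Ω t)_r` is the
`r`-neighbourhood of `Ω t`. -/
def spaceTimeNhd {X : Type*} [PseudoMetricSpace X] (J : Set ℝ) (Ω : ℝ → Set X) (r : ℝ) :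
    Set (X × ℝ) :=
  spaceTime J fun t => Metric.thickening r (Ω t)

/-- (2,1) differentiability, at a point `(y, t₀)` of it, of the space-time boundary of a set
`E ⊆ ℝⁿ × ℝ`, with `n = m + 1`. In the orthonormal coordinates of `ℝⁿ` centred at `y` which are
given by a basis `b`, with `x' ∈ ℝᵐ` the first `m` coordinates and `xₙ` the last one, the set `E`
is `{xₙ > Ψ(x', t)}` in a Euclidean ball of `ℝⁿ⁺¹` about `(y, t₀)`, where
`Ψ(x', t) = v (t - t₀) + ∑ κᵢ xᵢ² + o(|x'|² + |t - t₀|)`. -/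
def IsTwoOneDifferentiableAt {m : ℕ} (E : Set (EuclideanSpace ℝ (Fin (m + 1)) × ℝ))
    (y : EuclideanSpace ℝ (Fin (m + 1))) (t₀ : ℝ) : Prop :=
  ∃ (b : OrthonormalBasis (Fin (m + 1)) ℝ (EuclideanSpace ℝ (Fin (m + 1))))
    (Ψ : EuclideanSpace ℝ (Fin m) → ℝ → ℝ) (δ : ℝ) (v : ℝ) (κ : Fin m → ℝ),
    0 < δ ∧
    (∀ (x : EuclideanSpace ℝ (Fin (m + 1))) (t : ℝ), dist x y ^ 2 + (t - t₀) ^ 2 < δ ^ 2 →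
      ((x, t) ∈ E ↔
        Ψ (WithLp.toLp 2 fun i : Fin m => b.repr (x - y) i.castSucc) t
          < b.repr (x - y) (Fin.last m))) ∧
    (fun p : EuclideanSpace ℝ (Fin m) × ℝ =>
        Ψ p.1 p.2 - (v * (p.2 - t₀) + ∑ i, κ i * p.1 i ^ 2))
      =o[𝓝 ((0 : EuclideanSpace ℝ (Fin m)), t₀)]
        fun p : EuclideanSpace ℝ (Fin m) × ℝ => ‖p.1‖ ^ 2 + |p.2 - t₀|

/-- Concavity of `f` on a set `S` which need not be convex: the concavity inequality holds
whenever the two points and their convex combination all lie in `S`. In particular `f` is concave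
along each segment contained in `S`. -/
def ConcaveOnNonconvex {X : Type*} [AddCommGroup X] [Module ℝ X] (S : Set X) (f : X → ℝ) : Prop :=
  ∀ x ∈ S, ∀ y ∈ S, ∀ a b : ℝ, 0 ≤ a → 0 ≤ b → a + b = 1 → a • x + b • y ∈ S →
    a * f x + b * f y ≤ f (a • x + b • y)

end

/-!
Write `K t` for the closure of `Ω t` and `R = 2 r₀`. The lower curvature bound says that the ball of
radius `R` which touches `K t` at a nearest point, on the side of an exterior point, does not meet
`K t`. So `K t` has reach at least `R` (`LowerCurvatureBound.hasReach`), and every boundary point is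
touched from outside by a ball of radius `R` (`LowerCurvatureBound.exists_exterior_normal`).

*Semiconcavity.* If `q` is the centre of a ball of radius `R` outside `K t`, then the signed
distance is at most `|x - q| - R`, with equality at a prescribed point of the `r₀`-neighbourhood
for a suitable `q` at distance at least `r₀` from that point. So the signed distance is touched
from above, at each point of the `r₀`-neighbourhood, by a function whose second derivatives are at
most `1 / r₀` there, which gives the constant `C = 1 / (2 r₀)`
(`LowerCurvatureBound.concaveOnNonconvex`).

*Differentiability of the boundary.* The boundary is not accessible to theorems which hold almost
everywhere, but the exterior collar `{0 < dist (x, K t) < R / 2}` is. There the nearest point map is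
Lipschitz and is the spatial gradient of the potential `(|x|² - dist (x, K t)²) / 2`. By
Rademacher's theorem this potential is twice differentiable in space at almost every point.
In time it is Lipschitz, and at a Lebesgue point of its time derivative with respect to the
parabolic cylinders, of radius `r` in space and `r²` in time, the bound on the second spatial
differences upgrades convergence in the mean to a pointwise expansion with remainder
`o(|x - x₀|² + |t - t₀|)` (`ae_isLittleO_time`,
`IsLipschitzReachFamily.ae_hasParabolicExpansionAt`).

This is carried to the interior along the lines through the nearest points: the map which
prolongs the segment from `x` to its nearest point by the factor `l` is Lipschitz in each time
slice, so it preserves null sets there, and every interior point is the image of a point of the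
collar for large `l`, because the interior and the exterior ball at a boundary point have their
centres on a common line. For all but countably many `l`, almost no distance ray ends at the
image of the map for the factor `l`; this puts the point in the relative interior of its ray
(`IsLipschitzExteriorBallFamily.ae_exists_longRay`).

At the lower end `y` of such a ray the boundary is touched by balls from both sides. Near `y` it is
a graph, since the exterior normals are close to the one at `y` (`IsTouched.exists_graph`), and the
expansion of the potential behind `y` gives bounds for this graph from both sides
(`IsTouched.lower_expansion`, `IsTouched.upper_expansion`). They are a Legendre transform of the
quadratic form of the expansion, which is positive on the tangent space because of the interior
ball. Diagonalizing it yields the coordinates and the numbers `κᵢ`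
(`IsTouched.isTwoOneDifferentiableAt`).
-/

noncomputable section

open Metric
open scoped RealInnerProductSpace NNReal

/-! ### Sets of positive reach and the nearest point map -/

section Reach

variable {X : Type*} [NormedAddCommGroup X] [InnerProductSpace ℝ X]

/-- Federer's inequality for a set of reach at least `R`: if `a` is a point of `K` nearest to `x`,
then `K` does not meet the open ball of radius `R` which touches `K` at `a` and whose centre lies
on the ray from `a` through `x`. Expanding the square of the distance to that centre gives the
form used here, which is void when `x = a`. -/
def HasReach (K : Set X) (R : ℝ) : Prop :=
  ∀ x, ∀ a ∈ K, dist x a = infDist x K → ∀ b ∈ K,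
    2 * R * ⟪x - a, b - a⟫ ≤ ‖x - a‖ * ‖b - a‖ ^ 2

/-- A point of `K` nearest to `x` (a choice of one, if there are several), and `x` itself if there
is none. -/
def metricProj (K : Set X) (x : X) : X :=
  open Classical in if h : ∃ a ∈ K, dist x a = infDist x K then h.choose else x

/-- The potential `(|x|² - dist (x, K)²) / 2`. It is the supremum of the affine functions
`x ↦ ⟪x, k⟫ - |k|² / 2` with `k ∈ K`, hence convex, and the nearest point map is a selection of
its subdifferential. -/
def distPotential (K : Set X) (x : X) : ℝ := (‖x‖ ^ 2 - infDist x K ^ 2) / 2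

section Proj

variable [FiniteDimensional ℝ X] {K : Set X}

theorem metricProj_spec (hc : IsClosed K) (hne : K.Nonempty) (x : X) :
    metricProj K x ∈ K ∧ dist x (metricProj K x) = infDist x K := by
  have : ProperSpace X := FiniteDimensional.proper ℝ X
  have h : ∃ a ∈ K, dist x a = infDist x K := by
    obtain ⟨a, ha, h⟩ := hc.exists_infDist_eq_dist hne x
    exact ⟨a, ha, h.symm⟩
  rw [metricProj, dif_pos h]
  exact h.choose_spec

end Proj

variable {K : Set X} {R : ℝ}

theorem HasReach.norm_sub_sq_le (h : HasReach K R) (hR : 0 < R) {x a b : X} (ha : a ∈ K)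
    (hxa : dist x a = infDist x K) (hb : b ∈ K) (hx : infDist x K ≤ R / 2) :
    ‖b - a‖ ^ 2 ≤ 2 * (‖x - b‖ ^ 2 - infDist x K ^ 2) := by
  have h1 := h x a ha hxa b hb
  have h2 : ‖x - b‖ ^ 2 = ‖x - a‖ ^ 2 - 2 * ⟪x - a, b - a⟫ + ‖b - a‖ ^ 2 := by
    rw [← norm_sub_sq_real]; congr 2; abel
  rw [← hxa, dist_eq_norm] at hx ⊢
  have h3 : ‖x - a‖ * ‖b - a‖ ^ 2 ≤ R / 2 * ‖b - a‖ ^ 2 := by gcongr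
  have h4 : R * (2 * ⟪x - a, b - a⟫) ≤ R * (‖b - a‖ ^ 2 / 2) := by linarith
  have h5 := le_of_mul_le_mul_left h4 hR
  linarith

theorem HasReach.eq_metricProj [FiniteDimensional ℝ X] (h : HasReach K R) (hR : 0 < R)
    (hc : IsClosed K) {x b : X} (hb : b ∈ K) (hxb : dist x b = infDist x K)
    (hx : infDist x K ≤ R / 2) : metricProj K x = b := by
  obtain ⟨h1, h2⟩ := metricProj_spec hc ⟨b, hb⟩ x
  have h3 := h.norm_sub_sq_le hR h1 h2 hb hx
  rw [← hxb, dist_eq_norm, sub_self, mul_zero] at h3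
  have : ‖b - metricProj K x‖ = 0 := by nlinarith [norm_nonneg (b - metricProj K x)]
  exact (sub_eq_zero.1 (norm_eq_zero.1 this)).symm

theorem HasReach.lipschitzOnWith_metricProj [FiniteDimensional ℝ X] (h : HasReach K R)
    (hR : 0 < R) (hc : IsClosed K) (hne : K.Nonempty) :
    LipschitzOnWith 2 (metricProj K) {x | infDist x K ≤ R / 2} := by
  refine LipschitzOnWith.of_dist_le_mul fun x hx x' hx' => ?_
  obtain ⟨ha, hxa⟩ := metricProj_spec hc hne x
  obtain ⟨hb, hxb⟩ := metricProj_spec hc hne x'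
  set a := metricProj K x
  set b := metricProj K x'
  have h1 := h x a ha hxa b hb
  have h2 := h x' b hb hxb a ha
  simp only [mem_ofPred_eq] at hx hx'
  rw [← hxa, dist_eq_norm] at hx
  rw [← hxb, dist_eq_norm] at hx'
  have e1 : ‖x - a‖ * ‖b - a‖ ^ 2 ≤ R / 2 * ‖b - a‖ ^ 2 := by gcongr
  have e2 : ‖x' - b‖ * ‖a - b‖ ^ 2 ≤ R / 2 * ‖b - a‖ ^ 2 := by
    rw [norm_sub_rev a b]; gcongr
  have e3 : ⟪x - a, b - a⟫ + ⟪x' - b, a - b⟫ = ⟪x - x', b - a⟫ + ‖b - a‖ ^ 2 := by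
    rw [← real_inner_self_eq_norm_sq, ← neg_sub b a, inner_neg_right, ← sub_eq_add_neg,
      ← inner_sub_left, ← inner_add_left]
    congr 1; abel
  have e4 : -(‖x - x'‖ * ‖b - a‖) ≤ ⟪x - x', b - a⟫ := by
    linarith [abs_real_inner_le_norm (x - x') (b - a), neg_abs_le ⟪x - x', b - a⟫]
  have e5 : R * (2 * ‖b - a‖ ^ 2) ≤ R * (2 * (‖x - x'‖ * ‖b - a‖) + ‖b - a‖ ^ 2) := by
    have : 2 * R * (‖b - a‖ ^ 2 - ‖x - x'‖ * ‖b - a‖) ≤ R * ‖b - a‖ ^ 2 := by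
      have : 2 * R * (‖b - a‖ ^ 2 - ‖x - x'‖ * ‖b - a‖)
          ≤ 2 * R * (⟪x - x', b - a⟫ + ‖b - a‖ ^ 2) := by gcongr; linarith
      rw [← e3] at this
      linarith
    linarith
  have e6 := le_of_mul_le_mul_left e5 hR
  rw [dist_eq_norm, dist_eq_norm, norm_sub_rev a b]
  rcases (norm_nonneg (b - a)).eq_or_lt with h0 | h0
  · rw [← h0]; positivity
  · have : ‖b - a‖ * ‖b - a‖ ≤ ‖b - a‖ * (2 * ‖x - x'‖) := by nlinarith
    simpa using le_of_mul_le_mul_left this h0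

/-- The potential is the supremum of affine functions indexed by `K`, and `distPotential_eq` says
that the nearest points realize it. -/
theorem le_distPotential {k : X} (hk : k ∈ K) (x : X) :
    ⟪x, k⟫ - ‖k‖ ^ 2 / 2 ≤ distPotential K x := by
  have h1 : infDist x K ≤ ‖x - k‖ := by
    simpa [dist_eq_norm] using infDist_le_dist_of_mem (x := x) hk
  have h2 : infDist x K ^ 2 ≤ ‖x - k‖ ^ 2 := by gcongr; exact infDist_nonneg
  rw [norm_sub_sq_real] at h2
  rw [distPotential]; linarith

theorem distPotential_eq {k x : X} (h : dist x k = infDist x K) :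
    distPotential K x = ⟪x, k⟫ - ‖k‖ ^ 2 / 2 := by
  rw [distPotential, ← h, dist_eq_norm, norm_sub_sq_real]; ring

theorem distPotential_add_inner_le {k x : X} (hk : k ∈ K) (h : dist x k = infDist x K) (z : X) :
    distPotential K x + ⟪z - x, k⟫ ≤ distPotential K z := by
  have := le_distPotential hk z
  rw [distPotential_eq h, inner_sub_left]; linarith

end Reach

/-! ### Exterior balls from the lower curvature bound -/

section Exterior

variable {X : Type*} [NormedAddCommGroup X] [InnerProductSpace ℝ X]

theorem infDist_frontier_eq_infDist_compl [FiniteDimensional ℝ X] {U : Set X} {x : X}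
    (hx : x ∈ U) (hU : U ≠ univ) : infDist x (frontier U) = infDist x Uᶜ := by
  obtain ⟨y, hy, h⟩ := exists_mem_frontier_infDist_compl_eq_dist hx hU
  refine le_antisymm (h ▸ infDist_le_dist_of_mem hy) ?_
  rw [← infDist_closure (s := Uᶜ)]
  refine infDist_le_infDist_of_subset ?_ ⟨y, hy⟩
  rw [← frontier_compl]
  exact frontier_subset_closure

/-- Equality in the triangle inequality: `z` is on the ray from `a` in the direction `u`. -/
theorem eq_add_smul_of_dist_le {a x z u : X} {s τ : ℝ} (hu : ‖u‖ = 1) (hs : 0 < s)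
    (hx : x = a + s • u) (hz : dist x z = τ - s) (h : τ ≤ dist a z) :
    z = a + τ • u := by
  have h1 : z - x = (z - a) - s • u := by rw [hx]; abel
  have h2 : ‖z - x‖ = τ - s := by rw [← dist_eq_norm, dist_comm]; exact hz
  have h3 : ‖z - a‖ ≤ τ := by
    calc ‖z - a‖ = ‖(z - x) + s • u‖ := by rw [h1]; congr 1; abel
      _ ≤ ‖z - x‖ + ‖s • u‖ := norm_add_le _ _
      _ = τ := by rw [h2, norm_smul, hu, Real.norm_of_nonneg hs.le]; ring
  have h4 : ‖z - a‖ = τ := le_antisymm h3 (by rwa [dist_comm, dist_eq_norm] at h)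
  have h5 : ‖z - x‖ ^ 2 = ‖z - a‖ ^ 2 - 2 * (s * ⟪z - a, u⟫) + s ^ 2 := by
    rw [h1, norm_sub_sq_real, real_inner_smul_right, norm_smul, hu, Real.norm_of_nonneg hs.le]; ring
  have h6 : ⟪z - a, u⟫ = τ := by
    rw [h2, h4] at h5
    have : s * ⟪z - a, u⟫ = s * τ := by linarith
    exact mul_left_cancel₀ hs.ne' this
  have h7 : ‖z - a - τ • u‖ ^ 2 = 0 := by
    rw [norm_sub_sq_real, real_inner_smul_right, h6, h4, norm_smul, hu, Real.norm_eq_abs, mul_one,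
      sq_abs]; ring
  have h8 : z - a - τ • u = 0 := by simpa using h7
  rw [← sub_eq_zero, ← h8]; abel

/-- Under the lower curvature bound the ball of radius `2 r` that touches `closure Ω` at the point
`a` nearest to an exterior point `x`, on the side of `x`, does not meet `closure Ω`. -/
theorem LowerCurvatureBound.two_mul_le_dist [FiniteDimensional ℝ X] {Ω : Set X} {r : ℝ} (hr : 0 < r)
    (h : LowerCurvatureBound Ω r) {x a u : X} {s : ℝ} (ha : a ∈ closure Ω) (hs : 0 < s)
    (hu : ‖u‖ = 1) (hx : x = a + s • u) (hxa : infDist x (closure Ω) = s) {b : X}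
    (hb : b ∈ closure Ω) : 2 * r ≤ dist (a + (2 * r) • u) b := by
  have hxK : x ∉ closure Ω := fun hx => by rw [infDist_zero_of_mem hx] at hxa; linarith
  -- it suffices to treat radii `τ < 2 r`
  suffices H : ∀ τ, 0 < τ → τ < 2 * r → τ ≤ dist (a + τ • u) b by
    have hcl : IsClosed {τ : ℝ | τ ≤ dist (a + τ • u) b} :=
      isClosed_le continuous_id (by fun_prop)
    have hsub : Ioo 0 (2 * r) ⊆ {τ : ℝ | τ ≤ dist (a + τ • u) b} := fun τ hτ => H τ hτ.1 hτ.2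
    have := closure_minimal hsub hcl
    rw [closure_Ioo (by positivity)] at this
    exact this (right_mem_Icc.2 (by positivity))
  intro τ hτ hτr
  have h1 : ENNReal.ofReal τ < ridgeFunction (closure Ω)ᶜ x :=
    lt_of_lt_of_le ((ENNReal.ofReal_lt_ofReal_iff (by positivity)).2 hτr) (h x hxK)
  simp only [ridgeFunction, lt_iSup_iff] at h1
  obtain ⟨p, q, hpq, hxpq, hlt⟩ := h1
  have hlt : τ < dist p q := (ENNReal.ofReal_lt_ofReal_iff_of_nonneg hτ.le).1 hlt
  have hne : (closure Ω)ᶜ ≠ univ := by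
    rw [Ne, compl_univ_iff]; exact (nonempty_of_mem ha).ne_empty
  have hd : ∀ z, z ∉ closure Ω → interiorDist (closure Ω)ᶜ z = infDist z (closure Ω) := by
    intro z hz
    rw [interiorDist, if_pos (mem_compl hz), infDist_frontier_eq_infDist_compl hz hne, compl_compl]
  have hp0 : 0 ≤ interiorDist (closure Ω)ᶜ p := by
    rw [interiorDist]; split_ifs <;> [exact infDist_nonneg; exact le_rfl]
  have hq := hpq.2 q (right_mem_segment ℝ p q)
  have hx' := hpq.2 x hxpq
  have hqK : q ∉ closure Ω := by
    intro hqK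
    rw [interiorDist, if_neg (by simpa using hqK)] at hq
    linarith
  rw [hd q hqK] at hq
  rw [hd x hxK, hxa] at hx'
  have hadd : dist p x + dist x q = dist p q := dist_add_dist_of_mem_segment hxpq
  set ρ := infDist q (closure Ω) with hρ
  have hqe : q = a + ρ • u := by
    refine eq_add_smul_of_dist_le hu hs hx ?_ ?_
    · linarith
    · rw [hρ, dist_comm]; exact infDist_le_dist_of_mem ha
  have hρb : ρ ≤ dist q b := infDist_le_dist_of_mem hb
  have hτρ : τ ≤ ρ := by linarith
  have : dist q (a + τ • u) = ρ - τ := by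
    rw [hqe, dist_add_left, dist_eq_norm, ← sub_smul, norm_smul, hu, mul_one,
      Real.norm_of_nonneg (by linarith)]
  linarith [dist_triangle q (a + τ • u) b]

/-- The empty set is excluded: its exterior is the whole space, where `d` vanishes, so that there
are no nondegenerate segments of slope one. -/
theorem LowerCurvatureBound.nonempty {Ω : Set X} {r : ℝ} (hr : 0 < r)
    (h : LowerCurvatureBound Ω r) : Ω.Nonempty := by
  by_contra hne
  rw [not_nonempty_iff_eq_empty] at hne
  subst hne
  have h1 := h 0 (by simp)
  have h2 : ridgeFunction (closure (∅ : Set X))ᶜ 0 = 0 := by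
    simp only [ridgeFunction, ENNReal.iSup_eq_zero]
    intro p q hpq _
    have hq := hpq.2 q (right_mem_segment ℝ p q)
    simp only [interiorDist, closure_empty, compl_empty, mem_univ, if_true, frontier_univ,
      infDist_empty, zero_add] at hq
    simp [← hq]
  rw [h2] at h1
  simp at h1
  linarith

theorem LowerCurvatureBound.hasReach [FiniteDimensional ℝ X] {Ω : Set X} {r : ℝ} (hr : 0 < r)
    (h : LowerCurvatureBound Ω r) : HasReach (closure Ω) (2 * r) := by
  intro x a ha hxa b hb
  rcases eq_or_ne x a with rfl | hne
  · simp
  have hs : 0 < ‖x - a‖ := norm_pos_iff.2 (sub_ne_zero.2 hne)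
  have h1 := h.two_mul_le_dist hr (u := ‖x - a‖⁻¹ • (x - a)) (x := x) ha hs
    (by rw [norm_smul, norm_inv, norm_norm, inv_mul_cancel₀ hs.ne'])
    (by rw [smul_smul, mul_inv_cancel₀ hs.ne', one_smul]; abel)
    (by rw [← hxa, dist_eq_norm]) hb
  rw [dist_eq_norm] at h1
  have h2 : (2 * r) ^ 2 ≤ ‖a + (2 * r) • ‖x - a‖⁻¹ • (x - a) - b‖ ^ 2 := by gcongr
  have h3 : a + (2 * r) • ‖x - a‖⁻¹ • (x - a) - b
      = (2 * r * ‖x - a‖⁻¹) • (x - a) - (b - a) := by rw [smul_smul]; abel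
  rw [h3, norm_sub_sq_real, real_inner_smul_left, norm_smul, Real.norm_of_nonneg (by positivity),
    mul_assoc (2 * r), inv_mul_cancel₀ hs.ne'] at h2
  have h4 : 2 * (2 * r * ‖x - a‖⁻¹ * ⟪x - a, b - a⟫) ≤ ‖b - a‖ ^ 2 := by linarith
  have h5 := mul_le_mul_of_nonneg_left h4 hs.le
  calc 2 * (2 * r) * ⟪x - a, b - a⟫
      = ‖x - a‖ * (2 * (2 * r * ‖x - a‖⁻¹ * ⟪x - a, b - a⟫)) := by field_simp
    _ ≤ _ := h5

/-- Every boundary point of `Ω` is touched from outside by a ball of radius `2 r`, as a limit of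
points nearest to exterior points. -/
theorem LowerCurvatureBound.exists_exterior_normal [FiniteDimensional ℝ X] {Ω : Set X} {r : ℝ}
    (hr : 0 < r) (h : LowerCurvatureBound Ω r) (hreg : interior (closure Ω) = Ω) {w : X}
    (hw : w ∈ frontier Ω) :
    ∃ ν : X, ‖ν‖ = 1 ∧ ∀ b ∈ closure Ω, 2 * r ≤ dist (w + (2 * r) • ν) b := by
  have : ProperSpace X := FiniteDimensional.proper ℝ X
  have hne : (closure Ω).Nonempty := (h.nonempty hr).closure
  have hwK : w ∈ closure Ω := frontier_subset_closure hw
  have hwc : w ∈ closure (closure Ω)ᶜ := by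
    rw [closure_compl, hreg]
    have hopen : IsOpen Ω := hreg ▸ isOpen_interior
    exact fun h' => hw.2 (hopen.interior_eq.symm ▸ h')
  -- normals at the points nearest to exterior points which tend to `w`
  obtain ⟨x, hxK, hxw⟩ := mem_closure_iff_seq_limit.1 hwc
  have key : ∀ n, ∃ ν : X, ‖ν‖ = 1 ∧
      ∀ b ∈ closure Ω, 2 * r ≤ dist (metricProj (closure Ω) (x n) + (2 * r) • ν) b := by
    intro n
    obtain ⟨ha, hxa⟩ := metricProj_spec isClosed_closure hne (x n)
    have hs : 0 < infDist (x n) (closure Ω) :=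
      (isClosed_closure.notMem_iff_infDist_pos hne).1 (hxK n)
    set a := metricProj (closure Ω) (x n)
    have hna : ‖x n - a‖ = infDist (x n) (closure Ω) := by rw [← dist_eq_norm, hxa]
    refine ⟨(infDist (x n) (closure Ω))⁻¹ • (x n - a), ?_, fun b hb => ?_⟩
    · rw [norm_smul, hna, norm_inv, Real.norm_of_nonneg hs.le, inv_mul_cancel₀ hs.ne']
    · refine h.two_mul_le_dist hr ha hs ?_ ?_ rfl hb
      · rw [norm_smul, hna, norm_inv, Real.norm_of_nonneg hs.le, inv_mul_cancel₀ hs.ne']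
      · rw [smul_smul, mul_inv_cancel₀ hs.ne', one_smul]; abel
  choose ν hν hνb using key
  obtain ⟨ν₀, hν₀, φ, hφ, hlim⟩ := (isCompact_sphere (0 : X) 1).tendsto_subseq
    (x := ν) (fun n => by simp [hν n])
  refine ⟨ν₀, by simpa using hν₀, fun b hb => ?_⟩
  have hproj : Tendsto (fun n => metricProj (closure Ω) (x n)) atTop (𝓝 w) := by
    have h1 : Tendsto (fun n => dist (x n) (metricProj (closure Ω) (x n))) atTop (𝓝 0) := by
      have h2 : Tendsto (fun n => infDist (x n) (closure Ω)) atTop (𝓝 (infDist w (closure Ω))) :=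
        ((continuous_infDist_pt _).tendsto w).comp hxw
      rw [infDist_zero_of_mem hwK] at h2
      exact h2.congr fun n => (metricProj_spec isClosed_closure hne (x n)).2.symm
    exact tendsto_of_tendsto_of_dist hxw h1
  have h3 : Tendsto (fun n => dist (metricProj (closure Ω) (x (φ n)) + (2 * r) • ν (φ n)) b) atTop
      (𝓝 (dist (w + (2 * r) • ν₀) b)) :=
    ((hproj.comp hφ.tendsto_atTop).add (hlim.const_smul (2 * r))).dist tendsto_const_nhds
  exact ge_of_tendsto' h3 fun n => hνb _ b hb

end Exterior

/-! ### Semiconcavity of the signed distance -/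

section Semiconcave

variable {X : Type*} [NormedAddCommGroup X] [InnerProductSpace ℝ X]

/-- The distance to a point `q`, touched from above at `z` by a parabola of opening
`1 / (2 |z - q|)`. -/
theorem convexCombo_dist_le {x y q : X} {a b r : ℝ} (ha : 0 ≤ a) (hb : 0 ≤ b) (hab : a + b = 1)
    (hr : 0 < r) (h : r ≤ dist (a • x + b • y) q) :
    a * dist x q + b * dist y q ≤ dist (a • x + b • y) q
      + (2 * r)⁻¹ * (a * ‖x‖ ^ 2 + b * ‖y‖ ^ 2 - ‖a • x + b • y‖ ^ 2) := by
  set z := a • x + b • y with hz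
  set d := dist z q with hd
  have hd0 : 0 < d := hr.trans_le h
  have hV : a * ‖x‖ ^ 2 + b * ‖y‖ ^ 2 - ‖z‖ ^ 2 = a * b * ‖x - y‖ ^ 2 := by
    rw [hz, norm_add_sq_real, norm_sub_sq_real, norm_smul, norm_smul, real_inner_smul_left,
      real_inner_smul_right, Real.norm_of_nonneg ha, Real.norm_of_nonneg hb]
    obtain rfl : b = 1 - a := by linarith
    ring
  have hW : a * dist x q ^ 2 + b * dist y q ^ 2 = d ^ 2 + a * b * ‖x - y‖ ^ 2 := by
    have e1 : z - q = a • (x - q) + b • (y - q) := by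
      rw [hz, smul_sub, smul_sub]
      nth_rw 1 [← one_smul ℝ q]
      rw [← hab, add_smul]; abel
    have e2 : x - y = (x - q) - (y - q) := by abel
    have e3 := norm_sub_sq_real (x - q) (y - q)
    rw [← e2] at e3
    rw [hd, dist_eq_norm, dist_eq_norm, dist_eq_norm, e1, e3, norm_add_sq_real, norm_smul,
      norm_smul, real_inner_smul_left, real_inner_smul_right, Real.norm_of_nonneg ha,
      Real.norm_of_nonneg hb]
    obtain rfl : b = 1 - a := by linarith
    ring
  have h1 : ∀ c, 2 * d * c ≤ d ^ 2 + c ^ 2 := fun c => by nlinarith [sq_nonneg (d - c)]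
  have h2 : 2 * d * (a * dist x q + b * dist y q) ≤ 2 * d ^ 2 + a * b * ‖x - y‖ ^ 2 := by
    have e1 := mul_le_mul_of_nonneg_left (h1 (dist x q)) ha
    have e2 := mul_le_mul_of_nonneg_left (h1 (dist y q)) hb
    have e3 : a * d ^ 2 + b * d ^ 2 = d ^ 2 := by rw [← add_mul, hab, one_mul]
    linarith
  rw [hV]
  have hV0 : 0 ≤ a * b * ‖x - y‖ ^ 2 := by positivity
  have h3 : (2 * d)⁻¹ ≤ (2 * r)⁻¹ := by gcongr
  calc a * dist x q + b * dist y q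
      = (2 * d)⁻¹ * (2 * d * (a * dist x q + b * dist y q)) := by field_simp
    _ ≤ (2 * d)⁻¹ * (2 * d ^ 2 + a * b * ‖x - y‖ ^ 2) := by gcongr
    _ = d + (2 * d)⁻¹ * (a * b * ‖x - y‖ ^ 2) := by field_simp
    _ ≤ _ := by gcongr

/-- The signed distance is at most the distance to a ball which does not meet `closure Ω`. -/
theorem signedBoundaryDist_le {Ω : Set X} {R : ℝ} (hR : 0 < R) (hΩ : IsOpen Ω)
    [FiniteDimensional ℝ X] (hne : Ω.Nonempty) {q : X} (hq : ∀ b ∈ closure Ω, R ≤ dist q b)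
    (w : X) : signedBoundaryDist Ω w ≤ dist w q - R := by
  have hqΩ : q ∉ Ω := fun h => by have := hq q (subset_closure h); simp at this; linarith
  have huniv : Ω ≠ univ := fun h => hqΩ (h ▸ mem_univ q)
  rw [signedBoundaryDist]
  split_ifs with hw
  · rw [infDist_frontier_eq_infDist_compl hw huniv]
    have hball : closedBall q R ⊆ Ωᶜ := by
      rw [← closure_ball q hR.ne']
      refine closure_minimal (fun b hb hbΩ => ?_) hΩ.isClosed_compl
      have := hq b (subset_closure hbΩ)
      rw [mem_ball, dist_comm] at hb
      linarith
    have hd : R ≤ dist w q := by rw [dist_comm]; exact hq w (subset_closure hw)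
    have hd0 : 0 < ‖w - q‖ := by rw [← dist_eq_norm]; linarith
    rw [dist_eq_norm] at hd
    have hz : q + (R / ‖w - q‖) • (w - q) ∈ Ωᶜ := by
      apply hball
      rw [mem_closedBall, dist_self_add_left, norm_smul, Real.norm_of_nonneg (by positivity),
        div_mul_cancel₀ _ hd0.ne']
    refine (infDist_le_dist_of_mem hz).trans (le_of_eq ?_)
    have : w - (q + (R / ‖w - q‖) • (w - q)) = (1 - R / ‖w - q‖) • (w - q) := by
      rw [sub_smul, one_smul]; abel
    rw [dist_eq_norm, dist_eq_norm, this, norm_smul,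
      Real.norm_of_nonneg (by rw [sub_nonneg, div_le_one hd0]; exact hd)]
    field_simp
  · have : (frontier Ω).Nonempty := nonempty_frontier_iff.2 ⟨hne, huniv⟩
    have h1 : R - dist w q ≤ infDist w (frontier Ω) := by
      rw [le_infDist this]
      intro b hb
      have := hq b (frontier_subset_closure hb)
      linarith [dist_triangle q w b, dist_comm q w]
    linarith

/-- In the `r`-neighbourhood of `Ω` the upper bound `signedBoundaryDist_le` is attained by an
exterior ball whose centre is at distance at least `r`. -/
theorem LowerCurvatureBound.exists_dist_sub_le [FiniteDimensional ℝ X] {Ω : Set X} {r : ℝ}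
    (hr : 0 < r) (h : LowerCurvatureBound Ω r) (hreg : interior (closure Ω) = Ω) {z : X}
    (hz : infDist z (closure Ω) < r) (huniv : Ω ≠ univ) :
    ∃ q, (∀ b ∈ closure Ω, 2 * r ≤ dist q b) ∧ dist z q - 2 * r ≤ signedBoundaryDist Ω z ∧
      r ≤ dist z q := by
  have hopen : IsOpen Ω := hreg ▸ isOpen_interior
  have hne := h.nonempty hr
  by_cases hzΩ : z ∈ Ω
  · obtain ⟨y, hy, hzy⟩ := exists_mem_frontier_infDist_compl_eq_dist hzΩ huniv
    obtain ⟨ν, hν, hb⟩ := h.exists_exterior_normal hr hreg hy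
    refine ⟨_, hb, ?_, ?_⟩
    · rw [signedBoundaryDist, if_pos hzΩ, infDist_frontier_eq_infDist_compl hzΩ huniv, hzy]
      have := dist_triangle z y (y + (2 * r) • ν)
      rw [dist_self_add_right, norm_smul, hν, Real.norm_of_nonneg (by positivity)] at this
      linarith
    · have := hb z (subset_closure hzΩ)
      rw [dist_comm]; linarith
  · rw [signedBoundaryDist, if_neg hzΩ]
    by_cases hzK : z ∈ closure Ω
    · have hzf : z ∈ frontier Ω := by rw [frontier, hopen.interior_eq]; exact ⟨hzK, hzΩ⟩
      obtain ⟨ν, hν, hb⟩ := h.exists_exterior_normal hr hreg hzf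
      refine ⟨_, hb, ?_, ?_⟩ <;>
        rw [dist_self_add_right, norm_smul, hν, Real.norm_of_nonneg (by positivity)]
      · rw [infDist_zero_of_mem hzf]; simp
      · linarith
    · obtain ⟨ha, hza⟩ := metricProj_spec isClosed_closure hne.closure z
      have hs : 0 < infDist z (closure Ω) :=
        (isClosed_closure.notMem_iff_infDist_pos hne.closure).1 hzK
      set a := metricProj (closure Ω) z
      have hna : ‖z - a‖ = infDist z (closure Ω) := by rw [← dist_eq_norm, hza]
      set s := infDist z (closure Ω) with hsdef
      have hu : ‖s⁻¹ • (z - a)‖ = 1 := by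
        rw [norm_smul, hna, norm_inv, Real.norm_of_nonneg hs.le, inv_mul_cancel₀ hs.ne']
      have hza' : z = a + s • s⁻¹ • (z - a) := by
        rw [smul_smul, mul_inv_cancel₀ hs.ne', one_smul]; abel
      have hd : dist z (a + (2 * r) • s⁻¹ • (z - a)) = 2 * r - s := by
        nth_rw 1 [hza']
        rw [dist_add_left, dist_comm, dist_eq_norm, ← sub_smul, norm_smul, hu, mul_one,
          Real.norm_of_nonneg (by linarith)]
      refine ⟨a + (2 * r) • s⁻¹ • (z - a), fun b hb =>
        h.two_mul_le_dist hr ha hs hu hza' rfl hb, ?_, by linarith⟩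
      have hfr : frontier Ω = frontier (closure Ω)ᶜ := by
        rw [frontier_compl, frontier, frontier, hopen.interior_eq, closure_closure, hreg]
      rw [hd, hfr, infDist_frontier_eq_infDist_compl (by exact hzK)
        (by rw [Ne, compl_univ_iff]; exact hne.closure.ne_empty), compl_compl]
      linarith

/-- Under the lower curvature bound the signed distance is semiconcave on the `r`-neighbourhood of
`Ω`, with a constant that depends on `r` only. -/
theorem LowerCurvatureBound.concaveOnNonconvex [FiniteDimensional ℝ X] {Ω : Set X} {r : ℝ}
    (hr : 0 < r) (h : LowerCurvatureBound Ω r) (hreg : interior (closure Ω) = Ω)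
    (huniv : Ω ≠ univ) :
    ConcaveOnNonconvex (thickening r Ω)
      fun x => signedBoundaryDist Ω x - (2 * r)⁻¹ * ‖x‖ ^ 2 := by
  have hopen : IsOpen Ω := hreg ▸ isOpen_interior
  have hne := h.nonempty hr
  intro x hx y hy a b ha hb hab hz
  rw [mem_thickening_iff_infDist_lt hne] at hz
  obtain ⟨q, hq, hzq, hrq⟩ := h.exists_dist_sub_le hr hreg (by rwa [infDist_closure]) huniv
  have h1 := convexCombo_dist_le ha hb hab hr hrq
  have hx' := mul_le_mul_of_nonneg_left
    (signedBoundaryDist_le (by positivity) hopen hne hq x) ha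
  have hy' := mul_le_mul_of_nonneg_left
    (signedBoundaryDist_le (by positivity) hopen hne hq y) hb
  have e : a * (2 * r) + b * (2 * r) = 2 * r := by rw [← add_mul, hab, one_mul]
  dsimp only
  linarith

end Semiconcave

/-! ### Distance rays -/

section DistanceRay

variable {X : Type*} [NormedAddCommGroup X] [InnerProductSpace ℝ X]

theorem interiorDist_eq_infDist_compl [FiniteDimensional ℝ X] {Ω : Set X} (huniv : Ω ≠ univ)
    (x : X) : interiorDist Ω x = infDist x Ωᶜ := by
  rw [interiorDist]
  split_ifs with hx
  · exact infDist_frontier_eq_infDist_compl hx huniv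
  · rw [infDist_zero_of_mem (by exact hx)]

theorem infDist_compl_ray {Ω : Set X} {y e : X} (hy : y ∉ Ω) (he : ‖e‖ = 1) {ℓ τ : ℝ}
    (hℓ : ℓ ≤ infDist (y + ℓ • e) Ωᶜ) (h0 : 0 ≤ τ) (hτ : τ ≤ ℓ) :
    infDist (y + τ • e) Ωᶜ = τ := by
  refine le_antisymm ?_ ?_
  · refine (infDist_le_dist_of_mem (show y ∈ Ωᶜ from hy)).trans ?_
    rw [dist_self_add_left, norm_smul, he, Real.norm_of_nonneg h0, mul_one]
  · have h1 := infDist_le_infDist_add_dist (s := Ωᶜ) (x := y + ℓ • e) (y := y + τ • e)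
    rw [dist_add_left, dist_eq_norm, ← sub_smul, norm_smul, he,
      Real.norm_of_nonneg (by linarith)] at h1
    linarith

/-- A ball in `Ω` whose boundary sphere contains the boundary point `y` of `Ω` extends the segment
from `y` to its centre to a distance ray with lower end `y`. -/
theorem exists_isDistanceRay [FiniteDimensional ℝ X] {Ω : Set X} (hbdd : Bornology.IsBounded Ω)
    {y e : X} (hy : y ∈ frontier Ω) (hyΩ : y ∉ Ω) (he : ‖e‖ = 1) {ℓ τ : ℝ}
    (hℓ : ℓ ≤ infDist (y + ℓ • e) Ωᶜ) (h0 : 0 < τ) (hτ : τ < ℓ) :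
    ∃ z, IsDistanceRay Ω y z ∧ y + τ • e ∈ openSegment ℝ y z := by
  have huniv : Ω ≠ univ := fun h => hyΩ (h ▸ mem_univ y)
  have hcompl : (Ωᶜ).Nonempty := ⟨y, hyΩ⟩
  -- the longest admissible length
  set L : Set ℝ := {ρ | 0 ≤ ρ ∧ ρ ≤ infDist (y + ρ • e) Ωᶜ} with hL
  have hLclosed : IsClosed L := by
    refine (isClosed_le continuous_const continuous_id).inter (isClosed_le continuous_id ?_)
    exact (continuous_infDist_pt _).comp (by fun_prop)
  have hmem : ∀ ρ, 0 < ρ → ρ ≤ infDist (y + ρ • e) Ωᶜ → y + ρ • e ∈ Ω := by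
    intro ρ hρ h
    by_contra hn
    rw [infDist_zero_of_mem (by exact hn)] at h
    linarith
  obtain ⟨B, hB⟩ := hbdd.subset_closedBall y
  have hLbdd : BddAbove L := by
    refine ⟨max B 0, fun ρ hρ => ?_⟩
    rcases hρ.1.eq_or_lt with h | h
    · rw [← h]; exact le_max_right _ _
    · have := hB (hmem ρ h hρ.2)
      rw [mem_closedBall, dist_self_add_left, norm_smul, he, Real.norm_of_nonneg hρ.1,
        mul_one] at this
      exact this.trans (le_max_left _ _)
  have hℓL : ℓ ∈ L := ⟨by linarith, hℓ⟩
  set S := sSup L with hS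
  have hSL : S ∈ L := hLclosed.csSup_mem ⟨ℓ, hℓL⟩ hLbdd
  have hℓS : ℓ ≤ S := le_csSup hLbdd hℓL
  have hS0 : 0 < S := by linarith
  set z := y + S • e with hz
  have hseg : ∀ w, w ∈ segment ℝ y z ↔ ∃ ρ, 0 ≤ ρ ∧ ρ ≤ S ∧ w = y + ρ • e := by
    intro w
    rw [segment_eq_image', hz]
    constructor
    · rintro ⟨θ, ⟨h1, h2⟩, rfl⟩
      exact ⟨θ * S, by positivity, by nlinarith, by simp [smul_smul]⟩
    · rintro ⟨ρ, h1, h2, rfl⟩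
      exact ⟨ρ / S, ⟨by positivity, (div_le_one hS0).2 h2⟩, by
        simp [smul_smul, div_mul_cancel₀ _ hS0.ne']⟩
  have hdy : interiorDist Ω y = 0 := by
    rw [interiorDist, if_neg hyΩ]
  have hslope : IsSlopeOneSegment Ω y z := by
    constructor
    · intro w hw
      obtain ⟨ρ, h1, h2, rfl⟩ := (hseg w).1 hw
      rcases h1.eq_or_lt with h | h
      · rw [← h, zero_smul, add_zero]; exact frontier_subset_closure hy
      · exact subset_closure (hmem ρ h (infDist_compl_ray hyΩ he hSL.2 h1 h2).ge)
    · intro w hw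
      obtain ⟨ρ, h1, h2, rfl⟩ := (hseg w).1 hw
      rw [hdy, interiorDist_eq_infDist_compl huniv, infDist_compl_ray hyΩ he hSL.2 h1 h2,
        dist_self_add_right, norm_smul, he, Real.norm_of_nonneg h1]
      ring
  refine ⟨z, ⟨?_, hslope, ?_⟩, ?_⟩
  · intro h
    have : S • e = 0 := by rw [hz] at h; simpa using h
    rcases smul_eq_zero.1 this with h | h
    · linarith
    · rw [h, norm_zero] at he; exact zero_ne_one he
  · intro p q hpq hsub
    have hyp := hpq.2 y (hsub (left_mem_segment ℝ y z))
    have hp0 : 0 ≤ interiorDist Ω p := by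
      rw [interiorDist_eq_infDist_compl huniv]; exact infDist_nonneg
    have hpy : p = y := by
      rw [hdy] at hyp
      exact dist_le_zero.1 (by linarith)
    subst hpy
    have hq := hpq.2 q (right_mem_segment ℝ p q)
    have hzs := hsub (right_mem_segment ℝ p z)
    -- `q` lies on the ray from `p` in the direction `e`
    have hqe : q = p + dist p q • e := by
      refine eq_add_smul_of_dist_le he hS0 hz ?_ le_rfl
      have := dist_add_dist_of_mem_segment hzs
      have e1 : dist p z = S := by
        rw [hz, dist_self_add_right, norm_smul, he, Real.norm_of_nonneg hS0.le, mul_one]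
      linarith
    have hqL : dist p q ∈ L := by
      refine ⟨dist_nonneg, ?_⟩
      rw [← hqe, ← interiorDist_eq_infDist_compl huniv, hq, hdy, zero_add]
    have hqS : dist p q ≤ S := le_csSup hLbdd hqL
    refine (convex_segment p z).segment_subset (left_mem_segment ℝ p z) ?_
    exact (hseg q).2 ⟨_, dist_nonneg, hqS, hqe⟩
  · rw [openSegment_eq_image']
    refine ⟨τ / S, ⟨by positivity, (div_lt_one hS0).2 (by linarith)⟩, ?_⟩
    simp [hz, smul_smul, div_mul_cancel₀ _ hS0.ne']

end DistanceRay

/-! ### Lebesgue points with respect to parabolic cylinders -/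

section Parabolic

/-- The real line with the metric `√|s - t|`. Closed balls of radius `r` in its product with a
normed space are the parabolic cylinders, of radius `r` in space and `r²` in time. -/
abbrev SqrtLine : Type := Snowflaking ℝ (1 / 2) (by norm_num) (by norm_num)

instance : MeasurableSpace SqrtLine := borel _

instance : BorelSpace SqrtLine := ⟨rfl⟩

theorem preimage_closedBall_sqrtLine (t : ℝ) {r : ℝ} (hr : 0 ≤ r) :
    (Snowflaking.toSnowflaking : ℝ → SqrtLine) ⁻¹' closedBall (Snowflaking.toSnowflaking t) r
      = closedBall t (r ^ 2) := by
  rw [Snowflaking.preimage_toSnowflaking_closedBall _ hr]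
  norm_num

variable {X : Type*} [NormedAddCommGroup X] [NormedSpace ℝ X] [FiniteDimensional ℝ X]
  [MeasurableSpace X] [BorelSpace X]

/-- Almost every point is a Lebesgue point with respect to the parabolic cylinders, which are the
balls of a metric for which the measure is doubling. -/
theorem ae_tendsto_average_parabolicCylinder (μ : Measure X) [μ.IsAddHaarMeasure]
    {g : X × ℝ → ℝ} (hg : LocallyIntegrable g (μ.prod volume)) :
    ∀ᵐ p ∂(μ.prod volume), Tendsto
      (fun r : ℝ => ⨍ q in closedBall p.1 r ×ˢ closedBall p.2 (r ^ 2), ‖g q - g p‖ ∂(μ.prod volume))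
      (𝓝[>] 0) (𝓝 0) := by
  have : ProperSpace X := FiniteDimensional.proper ℝ X
  set Φ : X × ℝ ≃ₜ X × SqrtLine := (Homeomorph.refl X).prodCongr Snowflaking.homeomorph.symm with hΦ
  set N : Measure (X × SqrtLine) := (μ.prod volume).map Φ with hN
  have hpre : ∀ (p : X × ℝ) {r : ℝ}, 0 ≤ r →
      Φ ⁻¹' closedBall (Φ p) r = closedBall p.1 r ×ˢ closedBall p.2 (r ^ 2) := by
    intro p r hr
    rw [← preimage_closedBall_sqrtLine p.2 hr]
    ext q
    simp only [mem_preimage, mem_closedBall, Prod.dist_eq, max_le_iff, mem_prod]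
    rfl
  have hmeas : ∀ (p : X × ℝ) {r : ℝ}, 0 ≤ r →
      N (closedBall (Φ p) r) = μ (closedBall p.1 r) * ENNReal.ofReal (2 * r ^ 2) := by
    intro p r hr
    rw [hN, Measure.map_apply Φ.continuous.measurable measurableSet_closedBall, hpre p hr,
      Measure.prod_prod, Real.volume_closedBall]
  have hdoub : IsUnifLocDoublingMeasure N := by
    refine ⟨(2 : ℝ≥0) ^ (Module.finrank ℝ X) * 4, ?_⟩
    filter_upwards [self_mem_nhdsWithin] with r (hr : 0 < r) x
    obtain ⟨p, rfl⟩ := Φ.surjective x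
    rw [hmeas p (by positivity), hmeas p hr.le,
      Measure.addHaar_closedBall_mul μ _ zero_le_two hr.le,
      Measure.addHaar_closedBall_center μ p.1]
    have e1 : ENNReal.ofReal (2 * (2 * r) ^ 2) = 4 * ENNReal.ofReal (2 * r ^ 2) := by
      rw [show 2 * (2 * r) ^ 2 = 4 * (2 * r ^ 2) by ring, ENNReal.ofReal_mul (by norm_num)]
      norm_num
    have e2 : ENNReal.ofReal (2 ^ Module.finrank ℝ X) = 2 ^ Module.finrank ℝ X := by
      rw [ENNReal.ofReal_pow zero_le_two]; norm_num
    rw [e1, e2]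
    push_cast
    exact le_of_eq (by ring)
  have hfin : IsLocallyFiniteMeasure N := by
    refine ⟨fun x => ?_⟩
    obtain ⟨p, rfl⟩ := Φ.surjective x
    refine ⟨closedBall (Φ p) 1, closedBall_mem_nhds _ one_pos, ?_⟩
    rw [hmeas p zero_le_one]
    exact ENNReal.mul_lt_top measure_closedBall_lt_top ENNReal.ofReal_lt_top
  have hg' : LocallyIntegrable (g ∘ Φ.symm) N := by
    rw [hN, locallyIntegrable_map_homeomorph]
    simpa [Function.comp_assoc] using hg
  have h := IsUnifLocDoublingMeasure.ae_tendsto_average_norm_sub N hg' 1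
  rw [hN] at h
  filter_upwards [ae_of_ae_map Φ.continuous.aemeasurable h] with p hp
  have h1 := hp (l := 𝓝[>] (0 : ℝ)) (fun _ => Φ p) id tendsto_id (by
    filter_upwards [self_mem_nhdsWithin] with r (hr : 0 < r)
    exact mem_closedBall_self (by simpa using hr.le))
  refine h1.congr' ?_
  filter_upwards [self_mem_nhdsWithin] with r (hr : 0 < r)
  rw [setAverage_eq, setAverage_eq, ← hpre p hr.le, Φ.isClosedEmbedding.setIntegral_map]
  simp only [measureReal_def]
  rw [id, Measure.map_apply Φ.continuous.measurable measurableSet_closedBall]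
  simp

/-- A function which is Lipschitz in time, and whose second differences in space are `O(|h|²)`,
varies in time linearly up to an error which is small in the parabolic sense, near almost every
point. The coefficient is the time derivative at a parabolic Lebesgue point: there the error
`z` is small in the mean over balls of radius `η r`, and the bound on the second differences
compares its value at the centre with that mean, up to `O(η² r²)`. -/
theorem ae_isLittleO_time (μ : Measure X) [μ.IsAddHaarMeasure] {f : X × ℝ → ℝ}
    (hf : Continuous f)
    (hlip : ∀ ρ : ℝ, ∃ L : ℝ, ∀ x s t, ‖x‖ ≤ ρ → |s| ≤ ρ → |t| ≤ ρ →
      |f (x, s) - f (x, t)| ≤ L * |s - t|) :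
    ∀ᵐ p ∂(μ.prod volume), ∀ ε > 0, ∀ C : ℝ,
      (∀ q ∈ closedBall p ε, ∀ h : X, ‖h‖ ≤ ε →
        |f (q.1 + h, q.2) + f (q.1 - h, q.2) - 2 * f q| ≤ C * ‖h‖ ^ 2) →
      ∃ v : ℝ, (fun q : X × ℝ => f q - f (q.1, p.2) - v * (q.2 - p.2)) =o[𝓝 p]
        fun q => ‖q.1 - p.1‖ ^ 2 + |q.2 - p.2| := by
  have : ProperSpace X := FiniteDimensional.proper ℝ X
  set g : X × ℝ → ℝ := fun p => deriv (fun t => f (p.1, t)) p.2 with hg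
  have hgm : Measurable g :=
    measurable_deriv_with_param (f := fun x t => f (x, t))
      (by simpa [Function.uncurry_def] using hf)
  have hlip' : ∀ ρ : ℝ, ∃ L : ℝ≥0, ∀ x, ‖x‖ ≤ ρ →
      LipschitzOnWith L (fun t => f (x, t)) (closedBall 0 ρ) := by
    intro ρ
    obtain ⟨L, hL⟩ := hlip ρ
    refine ⟨L.toNNReal, fun x hx => LipschitzOnWith.of_dist_le_mul fun s hs t ht => ?_⟩
    rw [Real.dist_eq, Real.dist_eq]
    refine (hL x s t hx (by simpa using hs) (by simpa using ht)).trans ?_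
    gcongr
    exact Real.le_coe_toNNReal L
  have hgint : ∀ ρ : ℝ, IntegrableOn g (closedBall 0 ρ) (μ.prod volume) := by
    intro ρ
    obtain ⟨L, hL⟩ := hlip' (ρ + 1)
    refine Measure.integrableOn_of_bounded (M := L) ?_ hgm.aestronglyMeasurable ?_
    · exact measure_closedBall_lt_top.ne
    · refine (ae_restrict_iff' measurableSet_closedBall).2 (Eventually.of_forall fun p hp => ?_)
      rw [mem_closedBall_zero_iff, Prod.norm_def, max_le_iff] at hp
      refine norm_deriv_le_of_lipschitzOn (s := closedBall 0 (ρ + 1)) ?_ (hL p.1 (by linarith))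
      exact mem_of_superset (isOpen_ball.mem_nhds (show p.2 ∈ ball 0 (ρ + 1) by
        rw [mem_ball_zero_iff]; linarith)) ball_subset_closedBall
  have hgloc : LocallyIntegrable g (μ.prod volume) := by
    intro p
    exact ⟨closedBall 0 (‖p‖ + 1), mem_of_superset (isOpen_ball.mem_nhds
      (show p ∈ ball 0 (‖p‖ + 1) by rw [mem_ball_zero_iff]; linarith)) ball_subset_closedBall,
      hgint _⟩
  filter_upwards [ae_tendsto_average_parabolicCylinder μ hgloc] with p hp ε hε C hC
  set v := g p with hv
  set n := Module.finrank ℝ X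
  set V := μ.real (closedBall (0 : X) 1) with hVdef
  have hV : 0 < V := by
    rw [hVdef, measureReal_def]
    exact ENNReal.toReal_pos (measure_closedBall_pos μ 0 one_pos).ne' measure_closedBall_lt_top.ne
  have hVr : ∀ (x : X) {r : ℝ}, 0 ≤ r → μ.real (closedBall x r) = r ^ n * V := fun x r hr =>
    Measure.addHaar_real_closedBall' μ x hr
  set A : ℝ → ℝ := fun r =>
    ⨍ q in closedBall p.1 r ×ˢ closedBall p.2 (r ^ 2), ‖g q - v‖ ∂(μ.prod volume) with hA
  -- the quantitative estimate at scale `r`, with averages over balls of radius `η r`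
  have key : ∀ r η : ℝ, 0 < r → 0 < η → η ≤ 1 / 2 → r ≤ ε → r ^ 2 ≤ ε → ∀ q : X × ℝ,
      ‖q.1 - p.1‖ ≤ r / 2 → |q.2 - p.2| ≤ r ^ 2 →
      |f q - f (q.1, p.2) - v * (q.2 - p.2)| ≤ (2 * A r / η ^ n + |C| * η ^ 2) * r ^ 2 := by
    intro r η hr hη hη2 hrε hr2 q hq1 hq2
    set z : X → ℝ := fun x => f (x, q.2) - f (x, p.2) - v * (q.2 - p.2) with hz
    set F : X → ℝ := fun x => ∫ s in closedBall p.2 (r ^ 2), ‖g (x, s) - v‖ with hF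
    set Q := closedBall p.1 r ×ˢ closedBall p.2 (r ^ 2) with hQ
    have hQint : IntegrableOn (fun q => ‖g q - v‖) Q (μ.prod volume) := by
      have h1 : Q ⊆ closedBall 0 (‖p‖ + r + r ^ 2) := by
        intro q hq
        have h1 : ‖p.1‖ ≤ ‖p‖ := norm_fst_le p
        have h2 : ‖p.2‖ ≤ ‖p‖ := norm_snd_le p
        have h3 : ‖q.1 - p.1‖ ≤ r := by simpa [dist_eq_norm] using hq.1
        have h4 : ‖q.2 - p.2‖ ≤ r ^ 2 := by simpa [dist_eq_norm] using hq.2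
        have h5 := norm_add_le (q.1 - p.1) p.1
        have h6 := norm_add_le (q.2 - p.2) p.2
        rw [sub_add_cancel] at h5 h6
        rw [mem_closedBall_zero_iff, Prod.norm_def, max_le_iff]
        constructor
        · nlinarith
        · linarith
      refine (((hgint _).mono_set h1).sub (integrableOn_const ?_)).norm
      exact ((isCompact_closedBall _ _).prod (isCompact_closedBall _ _)).measure_lt_top.ne
    have hFint : IntegrableOn F (closedBall p.1 r) μ := by
      rw [IntegrableOn, ← Measure.prod_restrict] at hQint
      exact hQint.integral_prod_left
    have hFtot : ∫ x in closedBall p.1 r, F x ∂μ = A r * (r ^ n * V * (2 * r ^ 2)) := by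
      have h1 : ∫ x in closedBall p.1 r, F x ∂μ = ∫ q in Q, ‖g q - v‖ ∂(μ.prod volume) :=
        (setIntegral_prod _ hQint).symm
      have h2 : (μ.prod volume).real Q = r ^ n * V * (2 * r ^ 2) := by
        rw [hQ, measureReal_prod_prod, hVr _ hr.le, measureReal_def, Real.volume_closedBall,
          ENNReal.toReal_ofReal (by positivity)]
      have h3 : 0 < r ^ n * V * (2 * r ^ 2) := by positivity
      rw [h1, hA]
      dsimp only
      rw [setAverage_eq, h2, smul_eq_mul]
      field_simp
      rw [hQ]
    have hF0 : ∀ x, 0 ≤ F x := fun x => integral_nonneg fun s => norm_nonneg _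
    -- the fundamental theorem of calculus in time
    have hzF : ∀ x, |z x| ≤ F x := by
      intro x
      obtain ⟨L, hL⟩ := hlip' (‖x‖ + |p.2| + |q.2| + r ^ 2 + 1)
      have hsub : closedBall p.2 (r ^ 2) ⊆ ball (0 : ℝ) (‖x‖ + |p.2| + |q.2| + r ^ 2 + 1) := by
        intro s hs
        rw [mem_closedBall, Real.dist_eq] at hs
        rw [mem_ball_zero_iff, Real.norm_eq_abs]
        have := abs_add_le (s - p.2) p.2
        rw [sub_add_cancel] at this
        linarith [norm_nonneg x, abs_nonneg q.2]
      have hLx := hL x (by linarith [abs_nonneg p.2, abs_nonneg q.2, sq_nonneg r])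
      have huIcc : uIcc p.2 q.2 ⊆ closedBall p.2 (r ^ 2) := by
        rw [Real.closedBall_eq_Icc]
        rw [abs_le] at hq2
        exact uIcc_subset_Icc ⟨by nlinarith, by nlinarith⟩ ⟨by linarith, by linarith⟩
      have hac : AbsolutelyContinuousOnInterval (fun t => f (x, t)) p.2 q.2 :=
        (hLx.mono (huIcc.trans (hsub.trans ball_subset_closedBall))).absolutelyContinuousOnInterval
      have hint : IntegrableOn (fun s => g (x, s) - v) (closedBall p.2 (r ^ 2)) := by
        refine Measure.integrableOn_of_bounded (M := L + |v|) measure_closedBall_lt_top.ne ?_ ?_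
        · exact ((hgm.comp measurable_prodMk_left).sub_const v).aestronglyMeasurable
        · refine (ae_restrict_iff' measurableSet_closedBall).2 (Eventually.of_forall fun s hs => ?_)
          refine (norm_sub_le _ _).trans ?_
          gcongr
          · exact norm_deriv_le_of_lipschitzOn (mem_of_superset (isOpen_ball.mem_nhds (hsub hs))
              ball_subset_closedBall) hLx
          · exact le_rfl
      have hint' : IntervalIntegrable (fun s => g (x, s)) volume p.2 q.2 :=
        hac.intervalIntegrable_deriv
      have h1 : z x = ∫ s in p.2..q.2, (g (x, s) - v) := by
        rw [intervalIntegral.integral_sub hint' intervalIntegrable_const,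
          intervalIntegral.integral_const, smul_eq_mul,
          show ∫ s in p.2..q.2, g (x, s) = f (x, q.2) - f (x, p.2) from hac.integral_deriv_eq_sub]
        simp only [hz]
        ring
      rw [h1, ← Real.norm_eq_abs]
      refine (intervalIntegral.norm_integral_le_integral_norm_uIoc).trans ?_
      exact setIntegral_mono_set hint.norm (Eventually.of_forall fun s => norm_nonneg _)
        (uIoc_subset_uIcc.trans huIcc).eventuallyLE
    set ρ := η * r with hρ
    have hρ0 : 0 < ρ := by positivity
    have hρr : ρ ≤ r / 2 := by nlinarith
    have hball : closedBall q.1 ρ ⊆ closedBall p.1 r := by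
      refine closedBall_subset_closedBall' ?_
      rw [dist_eq_norm]; linarith
    have hsecond : ∀ h ∈ closedBall (0 : X) ρ,
        2 * |z q.1| - 2 * |C| * ρ ^ 2 ≤ F (q.1 + h) + F (q.1 - h) := by
      intro h hh
      rw [mem_closedBall_zero_iff] at hh
      have h1 := hC q (by
        rw [mem_closedBall, Prod.dist_eq, max_le_iff, dist_eq_norm, Real.dist_eq]
        exact ⟨by linarith, by linarith⟩) h (by linarith)
      have h2 := hC (q.1, p.2) (by
        rw [mem_closedBall, Prod.dist_eq, max_le_iff, dist_eq_norm, dist_self]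
        exact ⟨by linarith, hε.le⟩) h (by linarith)
      have h3 : C * ‖h‖ ^ 2 ≤ |C| * ρ ^ 2 := by
        gcongr
        exact le_abs_self C
      have h4 : 2 * z q.1 = z (q.1 + h) + z (q.1 - h)
          - (f (q.1 + h, q.2) + f (q.1 - h, q.2) - 2 * f q)
          + (f (q.1 + h, p.2) + f (q.1 - h, p.2) - 2 * f (q.1, p.2)) := by
        simp only [hz]; ring
      have h5 : |2 * z q.1| ≤ |z (q.1 + h)| + |z (q.1 - h)| + |C| * ρ ^ 2 + |C| * ρ ^ 2 := by
        rw [h4]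
        refine (abs_add_le _ _).trans (add_le_add ((abs_sub _ _).trans (add_le_add
          (abs_add_le _ _) (h1.trans h3))) (h2.trans h3))
      rw [abs_mul, abs_two] at h5
      linarith [hzF (q.1 + h), hzF (q.1 - h)]
    have hFρ : IntegrableOn F (closedBall q.1 ρ) μ := hFint.mono_set hball
    have hpre1 : (fun h => q.1 + h) ⁻¹' closedBall q.1 ρ = closedBall (0 : X) ρ := by
      ext h; simp
    have hpre2 : (fun h => q.1 - h) ⁻¹' closedBall q.1 ρ = closedBall (0 : X) ρ := by
      ext h; simp
    have hmp1 := measurePreserving_add_left μ q.1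
    have hmp2 := Measure.measurePreserving_sub_left μ q.1
    have he1 : MeasurableEmbedding (fun h => q.1 + h) := measurableEmbedding_addLeft q.1
    have he2 : MeasurableEmbedding (fun h => q.1 - h) :=
      (MeasurableEquiv.subLeft q.1).measurableEmbedding
    have hI1 : IntegrableOn (fun h => F (q.1 + h)) (closedBall (0 : X) ρ) μ := by
      rw [← hpre1]
      exact (hmp1.integrableOn_comp_preimage he1).2 hFρ
    have hI2 : IntegrableOn (fun h => F (q.1 - h)) (closedBall (0 : X) ρ) μ := by
      rw [← hpre2]
      exact (hmp2.integrableOn_comp_preimage he2).2 hFρ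
    have hE1 : ∫ h in closedBall (0 : X) ρ, F (q.1 + h) ∂μ = ∫ x in closedBall q.1 ρ, F x ∂μ := by
      rw [← hpre1]; exact hmp1.setIntegral_preimage_emb he1 _ _
    have hE2 : ∫ h in closedBall (0 : X) ρ, F (q.1 - h) ∂μ = ∫ x in closedBall q.1 ρ, F x ∂μ := by
      rw [← hpre2]; exact hmp2.setIntegral_preimage_emb he2 _ _
    have hle : ∫ x in closedBall q.1 ρ, F x ∂μ ≤ A r * (r ^ n * V * (2 * r ^ 2)) := by
      rw [← hFtot]
      exact setIntegral_mono_set hFint (Eventually.of_forall hF0) hball.eventuallyLE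
    have hmain : (2 * |z q.1| - 2 * |C| * ρ ^ 2) * (ρ ^ n * V)
        ≤ 2 * (A r * (r ^ n * V * (2 * r ^ 2))) := by
      have h1 := setIntegral_mono_on (μ := μ)
        (integrableOn_const (C := 2 * |z q.1| - 2 * |C| * ρ ^ 2)
          (measure_closedBall_lt_top (x := (0 : X)) (r := ρ)).ne) (hI1.add hI2)
        measurableSet_closedBall hsecond
      simp only [Pi.add_apply] at h1
      rw [integral_add hI1 hI2, hE1, hE2, setIntegral_const, hVr _ hρ0.le, smul_eq_mul] at h1
      linarith
    have h6 : |z q.1| - |C| * ρ ^ 2 ≤ A r * (2 * r ^ 2) / η ^ n := by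
      rw [le_div_iff₀ (by positivity)]
      have h7 : (|z q.1| - |C| * ρ ^ 2) * η ^ n * (r ^ n * V)
          ≤ A r * (2 * r ^ 2) * (r ^ n * V) := by
        rw [hρ, mul_pow η r n] at hmain
        rw [hρ]
        linarith
      exact le_of_mul_le_mul_right h7 (by positivity)
    have h8 : |z q.1| ≤ A r * (2 * r ^ 2) / η ^ n + |C| * ρ ^ 2 := by linarith
    calc |f q - f (q.1, p.2) - v * (q.2 - p.2)| = |z q.1| := rfl
      _ ≤ _ := h8
      _ = _ := by rw [hρ]; ring
  refine ⟨v, ?_⟩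
  rw [isLittleO_iff]
  intro κ hκ
  obtain ⟨η, hη0, hη2, hηC⟩ : ∃ η : ℝ, 0 < η ∧ η ≤ 1 / 2 ∧ |C| * η ^ 2 ≤ κ / 8 := by
    have ht : Tendsto (fun η : ℝ => |C| * η ^ 2) (𝓝[>] 0) (𝓝 0) := by
      have : Continuous fun η : ℝ => |C| * η ^ 2 := by fun_prop
      simpa using (this.tendsto 0).mono_left nhdsWithin_le_nhds
    have h1 := ht.eventually (ge_mem_nhds (show 0 < κ / 8 by positivity))
    have h2 : ∀ᶠ η : ℝ in 𝓝[>] 0, η ≤ 1 / 2 :=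
      nhdsWithin_le_nhds (ge_mem_nhds (by norm_num))
    obtain ⟨η, ha, hb, hc⟩ := (h1.and (h2.and self_mem_nhdsWithin)).exists
    exact ⟨η, hc, hb, ha⟩
  have hA1 : ∀ᶠ r in 𝓝[>] 0, A r < κ * η ^ n / 16 :=
    hp.eventually (gt_mem_nhds (by positivity))
  have hA2 : ∀ᶠ r in 𝓝[>] 0, r ≤ ε := nhdsWithin_le_nhds (ge_mem_nhds hε)
  have hA3 : ∀ᶠ r in 𝓝[>] 0, r ^ 2 ≤ ε := by
    have : Continuous fun r : ℝ => r ^ 2 := by fun_prop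
    have ht : Tendsto (fun r : ℝ => r ^ 2) (𝓝[>] 0) (𝓝 0) := by
      simpa using (this.tendsto 0).mono_left nhdsWithin_le_nhds
    exact ht.eventually (ge_mem_nhds hε)
  obtain ⟨r₀, hr₀, hr₀'⟩ := mem_nhdsGT_iff_exists_Ioo_subset.1 (hA1.and (hA2.and hA3))
  have hr₀ : 0 < r₀ := hr₀
  have hθ : ∀ᶠ q : X × ℝ in 𝓝 p, 4 * (‖q.1 - p.1‖ ^ 2 + |q.2 - p.2|) < r₀ ^ 2 := by
    have : Continuous fun q : X × ℝ => 4 * (‖q.1 - p.1‖ ^ 2 + |q.2 - p.2|) := by fun_prop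
    have := this.tendsto p
    simp only [sub_self, norm_zero, abs_zero] at this
    exact this.eventually (gt_mem_nhds (by simpa using pow_pos hr₀ 2))
  filter_upwards [hθ] with q hq
  set θ := ‖q.1 - p.1‖ ^ 2 + |q.2 - p.2| with hθdef
  have hθ0 : 0 ≤ θ := by positivity
  rw [Real.norm_of_nonneg hθ0, Real.norm_eq_abs]
  rcases hθ0.eq_or_lt with h0 | h0
  · have h1 : |q.2 - p.2| = 0 := by
      have := sq_nonneg ‖q.1 - p.1‖
      linarith [abs_nonneg (q.2 - p.2)]
    have h2 : q.2 = p.2 := sub_eq_zero.1 (abs_eq_zero.1 h1)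
    have h3 : f q = f (q.1, p.2) := by rw [← h2]
    rw [← h0, h3, h2]; simp
  · set r := Real.sqrt (4 * θ) with hr
    have hr2 : r ^ 2 = 4 * θ := Real.sq_sqrt (by positivity)
    have hr0 : 0 < r := Real.sqrt_pos.2 (by positivity)
    have hrr : r < r₀ := by
      rw [hr, Real.sqrt_lt' hr₀]; exact hq
    obtain ⟨hB1, hB2, hB3⟩ := hr₀' ⟨hr0, hrr⟩
    have h1 := key r η hr0 hη0 hη2 hB2 hB3 q (by
      refine (pow_le_pow_iff_left₀ (norm_nonneg _)
        (show 0 ≤ r / 2 by positivity) two_ne_zero).1 ?_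
      have := abs_nonneg (q.2 - p.2)
      rw [div_pow, hr2]; linarith) (by
      rw [hr2]; nlinarith [sq_nonneg ‖q.1 - p.1‖])
    refine h1.trans ?_
    rw [hr2]
    have h2 : 2 * A r / η ^ n ≤ κ / 8 := by
      rw [div_le_iff₀ (by positivity)]; linarith
    nlinarith

end Parabolic

/-! ### Almost everywhere second order expansion of the potential -/

section Slices

variable {X : Type*} [MeasurableSpace X] {μ : Measure X} [SFinite μ]

theorem prod_null_of_time_slices {s : Set (X × ℝ)} (hs : MeasurableSet s)
    (h : ∀ᵐ t : ℝ, μ {x | (x, t) ∈ s} = 0) : (μ.prod volume) s = 0 := by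
  rw [← (Measure.measurePreserving_swap (μ := volume) (ν := μ)).measure_preimage
    hs.nullMeasurableSet, Measure.measure_prod_null (measurable_swap hs)]
  exact h

theorem time_slices_null {s : Set (X × ℝ)} (h : (μ.prod volume) s = 0) :
    ∀ᵐ t : ℝ, μ {x | (x, t) ∈ s} = 0 := by
  have h1 : ((volume : Measure ℝ).prod μ) (Prod.swap ⁻¹' s) = 0 :=
    (Measure.measurePreserving_swap (μ := volume) (ν := μ)).quasiMeasurePreserving.preimage_null h
  exact Measure.measure_ae_null_of_prod_null h1

end Slices

section MovingSet

variable {X : Type*} [PseudoMetricSpace X] {C : ℝ → Set X} {M : ℝ}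

theorem abs_infDist_sub_infDist_le
    (h : ∀ x s t, infDist x (C s) ≤ infDist x (C t) + M * |s - t|) (x x' : X) (t t' : ℝ) :
    |infDist x (C t) - infDist x' (C t')| ≤ dist x x' + M * |t - t'| := by
  have h1 := h x t t'
  have h2 := h x t' t
  have h3 := infDist_le_infDist_add_dist (s := C t') (x := x) (y := x')
  have h4 := infDist_le_infDist_add_dist (s := C t') (x := x') (y := x)
  rw [abs_sub_comm] at h2
  rw [dist_comm] at h4
  rw [abs_le]
  constructor <;> linarith

theorem continuous_infDist_of_infDist_le
    (h : ∀ x s t, infDist x (C s) ≤ infDist x (C t) + M * |s - t|) :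
    Continuous fun p : X × ℝ => infDist p.1 (C p.2) := by
  rw [continuous_iff_continuousAt]
  intro p
  rw [ContinuousAt, tendsto_iff_dist_tendsto_zero]
  have hc : Continuous fun q : X × ℝ => dist q.1 p.1 + M * |q.2 - p.2| := by fun_prop
  have h0 := hc.tendsto p
  simp only [dist_self, sub_self, abs_zero, mul_zero, add_zero] at h0
  refine squeeze_zero (fun _ => dist_nonneg) (fun q => ?_) h0
  rw [Real.dist_eq]
  exact abs_infDist_sub_infDist_le h _ _ _ _

end MovingSet

section Family

variable {X : Type*} [NormedAddCommGroup X] [InnerProductSpace ℝ X]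

/-- A family of nonempty closed sets of reach at least `R` which moves with speed at most `M`, in
terms of the distance functions. -/
structure IsLipschitzReachFamily (K : ℝ → Set X) (R M : ℝ) : Prop where
  pos : 0 < R
  nonneg : 0 ≤ M
  isClosed : ∀ t, IsClosed (K t)
  nonempty : ∀ t, (K t).Nonempty
  hasReach : ∀ t, HasReach (K t) R
  infDist_le : ∀ x s t, infDist x (K s) ≤ infDist x (K t) + M * |s - t|

/-- The second order expansion of `f` at `p`, with remainder `o(|x - x₀|² + |t - t₀|)` and with
spatial gradient `y`. The quadratic form is `h ↦ ⟪h, A h⟫ / 2`; the operator `A` is not required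
to be symmetric. -/
def HasParabolicExpansionAt (f : X × ℝ → ℝ) (y : X) (p : X × ℝ) (v : ℝ) (A : X →L[ℝ] X) : Prop :=
  (fun q : X × ℝ => f q - f p - v * (q.2 - p.2) - ⟪q.1 - p.1, y⟫
      - ⟪q.1 - p.1, A (q.1 - p.1)⟫ / 2)
    =o[𝓝 p] fun q => ‖q.1 - p.1‖ ^ 2 + |q.2 - p.2|

variable {K : ℝ → Set X} {R M : ℝ}

namespace IsLipschitzReachFamily

theorem abs_infDist_sub_le (hK : IsLipschitzReachFamily K R M) (x x' : X) (t t' : ℝ) :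
    |infDist x (K t) - infDist x' (K t')| ≤ dist x x' + M * |t - t'| :=
  abs_infDist_sub_infDist_le hK.infDist_le x x' t t'

theorem continuous_infDist (hK : IsLipschitzReachFamily K R M) :
    Continuous fun p : X × ℝ => infDist p.1 (K p.2) :=
  continuous_infDist_of_infDist_le hK.infDist_le

theorem continuous_distPotential (hK : IsLipschitzReachFamily K R M) :
    Continuous fun p : X × ℝ => distPotential (K p.2) p.1 := by
  have := hK.continuous_infDist
  unfold distPotential
  fun_prop

theorem distPotential_lipschitz_time (hK : IsLipschitzReachFamily K R M) (ρ : ℝ) :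
    ∃ L : ℝ, ∀ x s t, ‖x‖ ≤ ρ → |s| ≤ ρ → |t| ≤ ρ →
      |distPotential (K s) x - distPotential (K t) x| ≤ L * |s - t| := by
  set B := infDist 0 (K 0) + ρ + M * ρ with hB
  refine ⟨B * M, fun x s t hx hs ht => ?_⟩
  have hb : ∀ u, |u| ≤ ρ → infDist x (K u) ≤ B := by
    intro u hu
    have h1 := (abs_le.1 (hK.abs_infDist_sub_le x 0 u 0)).2
    rw [dist_zero_right, sub_zero] at h1
    have := mul_le_mul_of_nonneg_left hu hK.nonneg
    linarith
  have h1 := hK.abs_infDist_sub_le x x s t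
  rw [dist_self, zero_add] at h1
  have h2 : |infDist x (K s) + infDist x (K t)| ≤ 2 * B := by
    rw [abs_of_nonneg (add_nonneg infDist_nonneg infDist_nonneg)]
    linarith [hb s hs, hb t ht]
  have h3 : distPotential (K s) x - distPotential (K t) x
      = -((infDist x (K s) + infDist x (K t)) * (infDist x (K s) - infDist x (K t))) / 2 := by
    rw [distPotential, distPotential]; ring
  rw [h3, abs_div, abs_neg, abs_mul, abs_two]
  have h4 := mul_le_mul h2 h1 (abs_nonneg _)
    (by linarith [abs_nonneg (infDist x (K s) + infDist x (K t))])
  linarith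

variable [FiniteDimensional ℝ X]

theorem continuousOn_metricProj (hK : IsLipschitzReachFamily K R M) :
    ContinuousOn (fun p : X × ℝ => metricProj (K p.2) p.1) {p | infDist p.1 (K p.2) < R / 2} := by
  intro p hp
  refine ContinuousAt.continuousWithinAt ?_
  have hδ := hK.continuous_infDist
  obtain ⟨ha, hpa⟩ := metricProj_spec (hK.isClosed p.2) (hK.nonempty p.2) p.1
  set a := metricProj (K p.2) p.1 with hadef
  -- the point of `K p.2` nearest to a point of `K q.2` nearest to `q.1`
  have key : ∀ q : X × ℝ, dist (metricProj (K q.2) q.1) a ≤ M * |q.2 - p.2| +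
      Real.sqrt (2 * ((dist q.1 p.1 + infDist q.1 (K q.2) + M * |q.2 - p.2|) ^ 2
        - infDist p.1 (K p.2) ^ 2)) := by
    intro q
    obtain ⟨hb, hqb⟩ := metricProj_spec (hK.isClosed q.2) (hK.nonempty q.2) q.1
    set b := metricProj (K q.2) q.1
    obtain ⟨hc, hbc⟩ := metricProj_spec (hK.isClosed p.2) (hK.nonempty p.2) b
    set c := metricProj (K p.2) b
    have h1 : dist b c ≤ M * |q.2 - p.2| := by
      have := hK.infDist_le b p.2 q.2
      rw [infDist_zero_of_mem hb, zero_add, abs_sub_comm] at this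
      rwa [hbc]
    have h2 := (hK.hasReach p.2).norm_sub_sq_le hK.pos ha hpa hc (le_of_lt hp)
    have h3 : ‖p.1 - c‖ ≤ dist q.1 p.1 + infDist q.1 (K q.2) + M * |q.2 - p.2| := by
      rw [← dist_eq_norm, ← hqb]
      linarith [dist_triangle4 p.1 q.1 b c, dist_comm p.1 q.1]
    have h4 : ‖c - a‖ ≤ Real.sqrt (2 * ((dist q.1 p.1 + infDist q.1 (K q.2)
        + M * |q.2 - p.2|) ^ 2 - infDist p.1 (K p.2) ^ 2)) := by
      refine Real.le_sqrt_of_sq_le (h2.trans ?_)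
      gcongr
    rw [← dist_eq_norm] at h4
    linarith [dist_triangle b c a]
  rw [ContinuousAt, tendsto_iff_dist_tendsto_zero]
  refine squeeze_zero (fun _ => dist_nonneg) key ?_
  have hc : Continuous fun q : X × ℝ => M * |q.2 - p.2| +
      Real.sqrt (2 * ((dist q.1 p.1 + infDist q.1 (K q.2) + M * |q.2 - p.2|) ^ 2
        - infDist p.1 (K p.2) ^ 2)) := by fun_prop
  have h0 := hc.tendsto p
  simpa using h0

theorem distPotential_le (hK : IsLipschitzReachFamily K R M) {x x' : X} {t : ℝ}
    (hx : infDist x (K t) ≤ R / 2) (hx' : infDist x' (K t) ≤ R / 2) :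
    distPotential (K t) x' ≤
      distPotential (K t) x + ⟪x' - x, metricProj (K t) x⟫ + 2 * ‖x' - x‖ ^ 2 := by
  obtain ⟨hb, hxb⟩ := metricProj_spec (hK.isClosed t) (hK.nonempty t) x'
  have h1 := distPotential_add_inner_le hb hxb x
  have h2 := ((hK.hasReach t).lipschitzOnWith_metricProj hK.pos (hK.isClosed t)
    (hK.nonempty t)).dist_le_mul x' hx' x hx
  rw [dist_eq_norm, dist_eq_norm] at h2
  have h3 := real_inner_le_norm (x' - x) (metricProj (K t) x' - metricProj (K t) x)
  rw [inner_sub_right] at h3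
  have h4 : ⟪x - x', metricProj (K t) x'⟫ = -⟪x' - x, metricProj (K t) x'⟫ := by
    rw [← inner_neg_left, neg_sub]
  have h5 : ‖x' - x‖ * ‖metricProj (K t) x' - metricProj (K t) x‖ ≤ ‖x' - x‖ * (2 * ‖x' - x‖) := by
    gcongr; exact_mod_cast h2
  linarith

theorem exists_second_difference_bound (hK : IsLipschitzReachFamily K R M) {p : X × ℝ}
    (hp : infDist p.1 (K p.2) < R / 2) :
    ∃ ε > 0, ∀ q ∈ closedBall p ε, ∀ h : X, ‖h‖ ≤ ε →
      |distPotential (K q.2) (q.1 + h) + distPotential (K q.2) (q.1 - h)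
        - 2 * distPotential (K q.2) q.1| ≤ 4 * ‖h‖ ^ 2 := by
  obtain ⟨r, hr, hball⟩ := Metric.isOpen_iff.1
    (isOpen_lt hK.continuous_infDist continuous_const) p hp
  refine ⟨r / 4, by positivity, fun q hq h hh => ?_⟩
  have hmem : ∀ k : X, ‖k‖ ≤ r / 4 → infDist (q.1 + k) (K q.2) < R / 2 := by
    intro k hk
    suffices H : (q.1 + k, q.2) ∈ ball p r from hball H
    rw [mem_closedBall, Prod.dist_eq, max_le_iff] at hq
    rw [mem_ball, Prod.dist_eq, max_lt_iff]
    constructor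
    · have h1 := dist_triangle (q.1 + k) q.1 p.1
      rw [dist_self_add_left] at h1
      dsimp only
      linarith [hq.1]
    · dsimp only
      linarith [hq.2]
  have h0 := hmem 0 (by rw [norm_zero]; positivity)
  rw [add_zero] at h0
  have h1 := hmem h hh
  have h2 := hmem (-h) (by rwa [norm_neg])
  rw [← sub_eq_add_neg] at h2
  obtain ⟨ha, hqa⟩ := metricProj_spec (hK.isClosed q.2) (hK.nonempty q.2) q.1
  have u1 := hK.distPotential_le h0.le h1.le
  have u2 := hK.distPotential_le h0.le h2.le
  have l1 := distPotential_add_inner_le ha hqa (q.1 + h)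
  have l2 := distPotential_add_inner_le ha hqa (q.1 - h)
  rw [add_sub_cancel_left] at u1 l1
  rw [sub_sub_cancel_left, inner_neg_left] at u2 l2
  rw [norm_neg] at u2
  rw [abs_le]
  constructor <;> linarith [sq_nonneg ‖h‖]

theorem hasFDerivAt_distPotential (hK : IsLipschitzReachFamily K R M) {x : X} {t : ℝ}
    (hx : infDist x (K t) < R / 2) :
    HasFDerivAt (distPotential (K t)) (innerSL ℝ (metricProj (K t) x)) x := by
  obtain ⟨ha, hxa⟩ := metricProj_spec (hK.isClosed t) (hK.nonempty t) x
  have hev : ∀ᶠ x' in 𝓝 x, infDist x' (K t) < R / 2 :=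
    (continuous_infDist_pt (K t)).continuousAt.eventually (gt_mem_nhds hx)
  have hO : (fun x' => distPotential (K t) x' - distPotential (K t) x
      - innerSL ℝ (metricProj (K t) x) (x' - x)) =O[𝓝 x] fun x' => ‖x' - x‖ ^ 2 := by
    refine IsBigO.of_bound 2 ?_
    filter_upwards [hev] with x' hx'
    have h1 := distPotential_add_inner_le ha hxa x'
    have h2 := hK.distPotential_le hx.le hx'.le
    rw [innerSL_apply_apply, real_inner_comm, Real.norm_eq_abs, norm_pow, norm_norm, abs_le]
    constructor <;> linarith [sq_nonneg ‖x' - x‖]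
  refine HasFDerivAt.of_isLittleO (hO.trans_isLittleO ?_)
  have := (isLittleO_norm_pow_id one_lt_two).comp_tendsto
    (show Tendsto (fun x' => x' - x) (𝓝 x) (𝓝 0) by
      rw [← sub_self x]; exact (continuous_id.sub continuous_const).tendsto x)
  simpa [Function.comp_def] using this

/-- Differentiability of the nearest point map, which is the gradient of the potential, gives a
second order Taylor expansion of the potential. -/
theorem isLittleO_distPotential (hK : IsLipschitzReachFamily K R M) {x : X} {t : ℝ}
    (hx : infDist x (K t) < R / 2) {A : X →L[ℝ] X}
    (hA : HasFDerivAt (metricProj (K t)) A x) :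
    (fun x' => distPotential (K t) x' - distPotential (K t) x - ⟪x' - x, metricProj (K t) x⟫
      - ⟪x' - x, A (x' - x)⟫ / 2) =o[𝓝 x] fun x' => ‖x' - x‖ ^ 2 := by
  rw [isLittleO_iff]
  intro c hc
  have hev : ∀ᶠ x' in 𝓝 x, infDist x' (K t) < R / 2 :=
    (continuous_infDist_pt (K t)).continuousAt.eventually (gt_mem_nhds hx)
  have hev2 := (hasFDerivAt_iff_isLittleO.1 hA).def hc
  obtain ⟨ε, hε, hball⟩ := Metric.eventually_nhds_iff.1 (hev.and hev2)
  filter_upwards [Metric.ball_mem_nhds x hε] with x' hx'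
  set h := x' - x with hh
  clear_value h
  have hmem : ∀ s ∈ Icc (0 : ℝ) 1, dist (x + s • h) x < ε := by
    intro s hs
    rw [dist_self_add_left, norm_smul, Real.norm_of_nonneg hs.1]
    rw [mem_ball, dist_eq_norm, ← hh] at hx'
    nlinarith [norm_nonneg h, hs.2]
  set E : ℝ → ℝ := fun s => distPotential (K t) (x + s • h) - s * ⟪h, metricProj (K t) x⟫
    - s ^ 2 * ⟪h, A h⟫ / 2 with hE
  have hder : ∀ s ∈ Icc (0 : ℝ) 1, HasDerivWithinAt E
      (⟪metricProj (K t) (x + s • h), h⟫ - ⟪h, metricProj (K t) x⟫ - s * ⟪h, A h⟫)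
      (Icc 0 1) s := by
    intro s hs
    have h1 := hK.hasFDerivAt_distPotential (hball (hmem s hs)).1
    have h2 : HasDerivAt (fun s : ℝ => x + s • h) h s := by
      simpa using ((hasDerivAt_id s).smul_const h).const_add x
    have h3 := h1.comp_hasDerivAt s h2
    have h4 : HasDerivAt (fun s : ℝ => s * ⟪h, metricProj (K t) x⟫) ⟪h, metricProj (K t) x⟫ s := by
      simpa using (hasDerivAt_id s).mul_const ⟪h, metricProj (K t) x⟫
    have h5 : HasDerivAt (fun s : ℝ => s ^ 2 * ⟪h, A h⟫ / 2) (s * ⟪h, A h⟫) s := by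
      have := ((hasDerivAt_pow 2 s).mul_const ⟪h, A h⟫).div_const 2
      refine this.congr_deriv ?_
      push_cast
      ring
    exact ((h3.sub h4).sub h5).hasDerivWithinAt
  have hbound : ∀ s ∈ Icc (0 : ℝ) 1,
      ‖⟪metricProj (K t) (x + s • h), h⟫ - ⟪h, metricProj (K t) x⟫ - s * ⟪h, A h⟫‖
        ≤ c * ‖h‖ ^ 2 := by
    intro s hs
    have h1 := (hball (hmem s hs)).2
    rw [add_sub_cancel_left] at h1
    have h2 : ⟪metricProj (K t) (x + s • h), h⟫ - ⟪h, metricProj (K t) x⟫ - s * ⟪h, A h⟫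
        = ⟪h, metricProj (K t) (x + s • h) - metricProj (K t) x - A (s • h)⟫ := by
      rw [inner_sub_right, inner_sub_right, map_smul, real_inner_smul_right,
        real_inner_comm h (metricProj (K t) (x + s • h))]
    rw [h2]
    refine (norm_inner_le_norm _ _).trans ?_
    have h3 : ‖s • h‖ ≤ ‖h‖ := by
      rw [norm_smul, Real.norm_of_nonneg hs.1]
      exact mul_le_of_le_one_left (norm_nonneg _) hs.2
    calc ‖h‖ * ‖metricProj (K t) (x + s • h) - metricProj (K t) x - A (s • h)‖
        ≤ ‖h‖ * (c * ‖h‖) := by gcongr; exact h1.trans (by gcongr)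
      _ = c * ‖h‖ ^ 2 := by ring
  have := (convex_Icc (0 : ℝ) 1).norm_image_sub_le_of_norm_hasDerivWithin_le hder hbound
    (left_mem_Icc.2 zero_le_one) (right_mem_Icc.2 zero_le_one)
  simp only [hE, one_smul, zero_smul, add_zero] at this
  have e : x + h = x' := by rw [hh]; abel
  rw [e, sub_zero, norm_one, mul_one] at this
  rw [norm_pow, norm_norm]
  refine le_trans (le_of_eq (congrArg _ ?_)) this
  ring

variable [MeasurableSpace X] [BorelSpace X]

/-- The nearest point map is differentiable in space at almost every point of the tube. -/
theorem ae_differentiableAt_metricProj (hK : IsLipschitzReachFamily K R M) (μ : Measure X)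
    [μ.IsAddHaarMeasure] :
    ∀ᵐ p ∂(μ.prod volume), infDist p.1 (K p.2) < R / 2 →
      DifferentiableAt ℝ (metricProj (K p.2)) p.1 := by
  have hδ := hK.continuous_infDist
  have hU : IsOpen {p : X × ℝ | infDist p.1 (K p.2) < R / 2} := isOpen_lt hδ continuous_const
  -- a cut-off makes the nearest point map continuous on the whole space-time
  set χ : X × ℝ → ℝ := fun p => max 0 (R / 2 - infDist p.1 (K p.2)) with hχ
  have hχc : Continuous χ := by fun_prop
  set P : X × ℝ → X := fun p => χ p • metricProj (K p.2) p.1 with hP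
  have hPc : Continuous P := by
    rw [continuous_iff_continuousAt]
    intro p
    rcases lt_or_ge (infDist p.1 (K p.2)) (R / 2) with hp | hp
    · exact hχc.continuousAt.smul (hK.continuousOn_metricProj.continuousAt (hU.mem_nhds hp))
    · have hχp : χ p = 0 := max_eq_left (by linarith)
      have hPp : P p = 0 := by simp only [hP, hχp, zero_smul]
      rw [ContinuousAt, hPp]
      have hc : Continuous fun q : X × ℝ => χ q * (‖q.1‖ + infDist q.1 (K q.2)) := by fun_prop
      have h0 := hc.tendsto p
      rw [hχp, zero_mul] at h0
      refine squeeze_zero_norm (fun q => ?_) h0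
      have hχ0 : 0 ≤ χ q := le_max_left _ _
      simp only [hP]
      rw [norm_smul, Real.norm_of_nonneg hχ0]
      gcongr
      have h1 := (metricProj_spec (hK.isClosed q.2) (hK.nonempty q.2) q.1).2
      rw [← h1, dist_eq_norm]
      have := norm_sub_norm_le (metricProj (K q.2) q.1) q.1
      rw [norm_sub_rev] at this
      linarith
  set F : ℝ → X → ℝ × X := fun t x => (infDist x (K t), P (x, t)) with hF
  have hFc : Continuous F.uncurry := by
    have : F.uncurry = (fun p : X × ℝ => (infDist p.1 (K p.2), P p)) ∘ Prod.swap := rfl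
    rw [this]
    exact (hδ.prodMk hPc).comp continuous_swap
  have hmeas : MeasurableSet {p : X × ℝ | infDist p.1 (K p.2) < R / 2 ∧
      ¬ DifferentiableAt ℝ (F p.2) p.1} := by
    refine hU.measurableSet.inter (MeasurableSet.compl ?_)
    exact measurable_swap (measurableSet_of_differentiableAt_with_param ℝ hFc)
  have hcut : ∀ {x : X} {t : ℝ}, infDist x (K t) < R / 2 →
      ∀ᶠ x' in 𝓝 x, χ (x', t) = R / 2 - infDist x' (K t) := by
    intro x t hx
    filter_upwards [(continuous_infDist_pt (K t)).continuousAt.eventually (gt_mem_nhds hx)]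
      with x' hx'
    exact max_eq_right (by linarith)
  have hnull : (μ.prod volume) {p : X × ℝ | infDist p.1 (K p.2) < R / 2 ∧
      ¬ DifferentiableAt ℝ (F p.2) p.1} = 0 := by
    refine prod_null_of_time_slices hmeas (Eventually.of_forall fun t => ?_)
    have h1 : ∀ᵐ x ∂μ, DifferentiableAt ℝ (fun x => infDist x (K t)) x :=
      (lipschitz_infDist_pt (K t)).ae_differentiableAt
    have h2 := ((hK.hasReach t).lipschitzOnWith_metricProj hK.pos (hK.isClosed t)
      (hK.nonempty t)).ae_differentiableWithinAt_of_mem (μ := μ)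
    have h3 : ∀ᵐ x ∂μ, ¬ (infDist x (K t) < R / 2 ∧ ¬ DifferentiableAt ℝ (F t) x) := by
      filter_upwards [h1, h2] with x hx1 hx2 ⟨hx, hnd⟩
      have hev := (continuous_infDist_pt (K t)).continuousAt.eventually (gt_mem_nhds hx)
      have hd := (hx2 hx.le).differentiableAt (hev.mono fun x' hx' => hx'.le)
      refine hnd (hx1.prodMk ?_)
      refine (((hx1.const_sub (R / 2)).smul hd).congr_of_eventuallyEq ?_)
      filter_upwards [hcut hx] with x' hx'
      simp only [hP, hx', Pi.smul_apply']
    exact ae_iff.1 h3 ▸ by simp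
  filter_upwards [compl_mem_ae_iff.2 hnull] with p hp hlt
  have hdF : DifferentiableAt ℝ (F p.2) p.1 := by
    by_contra hcon
    exact hp ⟨hlt, hcon⟩
  have hd1 : DifferentiableAt ℝ (fun x => infDist x (K p.2)) p.1 := hdF.fst
  have hd2 : DifferentiableAt ℝ (fun x => P (x, p.2)) p.1 := hdF.snd
  refine (((hd1.const_sub (R / 2)).inv
    (by simpa using by linarith)).smul hd2).congr_of_eventuallyEq ?_
  filter_upwards [hcut hlt, (continuous_infDist_pt (K p.2)).continuousAt.eventually
    (gt_mem_nhds hlt)] with x' hx' hx''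
  simp only [hP, hx', Pi.smul_apply', Pi.inv_apply]
  rw [smul_smul, inv_mul_cancel₀ (by linarith), one_smul]

/-- A parabolic version of Alexandrov's theorem for the potential of a moving set of positive
reach. -/
theorem ae_hasParabolicExpansionAt (hK : IsLipschitzReachFamily K R M) (μ : Measure X)
    [μ.IsAddHaarMeasure] :
    ∀ᵐ p ∂(μ.prod volume), infDist p.1 (K p.2) < R / 2 → ∃ v A,
      HasParabolicExpansionAt (fun q => distPotential (K q.2) q.1) (metricProj (K p.2) p.1) p
        v A := by
  filter_upwards [hK.ae_differentiableAt_metricProj μ,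
    ae_isLittleO_time μ hK.continuous_distPotential hK.distPotential_lipschitz_time]
    with p hp1 hp2 hp
  obtain ⟨A, hA⟩ := hp1 hp
  obtain ⟨ε, hε, hC⟩ := hK.exists_second_difference_bound hp
  obtain ⟨v, hv⟩ := hp2 ε hε 4 hC
  refine ⟨v, A, ?_⟩
  have h1 := (hK.isLittleO_distPotential hp hA).comp_tendsto
    (show Tendsto (fun q : X × ℝ => q.1) (𝓝 p) (𝓝 p.1) from continuous_fst.tendsto p)
  have h2 : (fun q : X × ℝ => ‖q.1 - p.1‖ ^ 2) =O[𝓝 p]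
      fun q => ‖q.1 - p.1‖ ^ 2 + |q.2 - p.2| := by
    refine IsBigO.of_bound 1 (Eventually.of_forall fun q => ?_)
    rw [Real.norm_of_nonneg (by positivity), Real.norm_of_nonneg (by positivity)]
    linarith [abs_nonneg (q.2 - p.2)]
  refine (hv.add (h1.trans_isBigO h2)).congr_left fun q => ?_
  simp only [Function.comp_apply]
  ring

end IsLipschitzReachFamily

end Family

/-! ### From the exterior collar to the interior along rays -/

section NullSets

theorem LipschitzOnWith.addHaar_image_null {X : Type*} [NormedAddCommGroup X] [NormedSpace ℝ X]
    [FiniteDimensional ℝ X] [MeasurableSpace X] [BorelSpace X] (μ : Measure X) [μ.IsAddHaarMeasure]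
    {f : X → X} {s : Set X} {L : ℝ≥0} (hf : LipschitzOnWith L f s) (hs : μ s = 0) :
    μ (f '' s) = 0 := by
  have : ProperSpace X := FiniteDimensional.proper ℝ X
  have h1 : Measure.hausdorffMeasure (Module.finrank ℝ X) s = 0 :=
    Measure.absolutelyContinuous_isAddHaarMeasure _ μ hs
  have h2 := hf.hausdorffMeasure_image_le (d := Module.finrank ℝ X) (by positivity)
  rw [h1, mul_zero] at h2
  exact Measure.absolutelyContinuous_isAddHaarMeasure μ
    (Measure.hausdorffMeasure (Module.finrank ℝ X)) (nonpos_iff_eq_zero.1 h2)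

/-- A measurable set contains a countable union of compact sets of full measure in it. -/
theorem exists_compact_seq_measure_diff_eq_zero {Y : Type*} [TopologicalSpace Y] [T2Space Y]
    [SigmaCompactSpace Y] [MeasurableSpace Y] [BorelSpace Y] (μ : Measure Y)
    [IsFiniteMeasureOnCompacts μ] [μ.InnerRegularCompactLTTop] {A : Set Y} (hA : MeasurableSet A) :
    ∃ C : ℕ × ℕ → Set Y, (∀ i, IsCompact (C i)) ∧ (∀ i, C i ⊆ A) ∧ μ (A \ ⋃ i, C i) = 0 := by
  have key : ∀ i : ℕ × ℕ, ∃ C ⊆ A ∩ compactCovering Y i.1, IsCompact C ∧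
      μ ((A ∩ compactCovering Y i.1) \ C) < ((i.2 : ℝ≥0∞) + 1)⁻¹ := by
    intro i
    refine (hA.inter (isCompact_compactCovering Y i.1).measurableSet).exists_isCompact_sdiff_lt
      ?_ ?_
    · exact ((measure_mono inter_subset_right).trans_lt
        (isCompact_compactCovering Y i.1).measure_lt_top).ne
    · exact ENNReal.inv_ne_zero.2 (by finiteness)
  choose C hC1 hC2 hC3 using key
  refine ⟨C, hC2, fun i => (hC1 i).trans inter_subset_left, ?_⟩
  have hsub : A \ ⋃ i, C i ⊆ ⋃ j, (A ∩ compactCovering Y j) \ ⋃ i, C i := by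
    intro y hy
    have : y ∈ ⋃ j, compactCovering Y j := by rw [iUnion_compactCovering]; trivial
    obtain ⟨j, hj⟩ := mem_iUnion.1 this
    exact mem_iUnion.2 ⟨j, ⟨hy.1, hj⟩, hy.2⟩
  refine measure_mono_null hsub (measure_iUnion_null fun j => ?_)
  have hlim : Tendsto (fun k : ℕ => ((k : ℝ≥0∞) + 1)⁻¹) atTop (𝓝 0) := by
    have := ENNReal.tendsto_inv_nat_nhds_zero.comp (tendsto_add_atTop_nat 1)
    simpa [Function.comp_def] using this
  refine le_antisymm (ge_of_tendsto' hlim fun k => ?_) zero_le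
  exact (measure_mono (sdiff_subset_sdiff_right (subset_iUnion C (j, k)))).trans (hC3 (j, k)).le

end NullSets

section Transfer

variable {X : Type*} [NormedAddCommGroup X] [InnerProductSpace ℝ X]

/-- A family of bounded open sets whose boundary moves with speed at most `M` and can be touched
everywhere from outside by balls of radius `R`, where the closures have reach at least `R`. -/
structure IsLipschitzExteriorBallFamily (Ω : ℝ → Set X) (R M : ℝ) : Prop where
  closure_family : IsLipschitzReachFamily (fun t => closure (Ω t)) R M
  isOpen : ∀ t, IsOpen (Ω t)
  isBounded : ∀ t, Bornology.IsBounded (Ω t)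
  ne_univ : ∀ t, Ω t ≠ univ
  infDist_compl_le : ∀ x s t, infDist x (Ω s)ᶜ ≤ infDist x (Ω t)ᶜ + M * |s - t|
  exists_normal : ∀ t, ∀ w ∈ frontier (Ω t), ∃ ν : X, ‖ν‖ = 1 ∧
    ∀ b ∈ closure (Ω t), R ≤ dist (w + R • ν) b

/-- The point obtained from `x` by following the segment from `x` through the nearest point of
`K` for `l` times its length. -/
def rayMap (K : Set X) (l : ℝ) (x : X) : X := x + l • (metricProj K x - x)

/-- The exterior collar of width `r` of a moving set. -/
def collar (K : ℝ → Set X) (r : ℝ) : Set (X × ℝ) :=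
  {p | 0 < infDist p.1 (K p.2) ∧ infDist p.1 (K p.2) < r}

/-- The points of the exterior collar for which the ray through the nearest point still
realizes the distance to the complement at the point `rayMap _ l x`. -/
def longRay (Ω : ℝ → Set X) (R l : ℝ) : Set (X × ℝ) :=
  {p | p ∈ collar (fun t => closure (Ω t)) (R / 2) ∧ (l - 1) * infDist p.1 (closure (Ω p.2))
    ≤ infDist (rayMap (closure (Ω p.2)) l p.1) (Ω p.2)ᶜ}

namespace IsLipschitzExteriorBallFamily

variable {Ω : ℝ → Set X} {R M : ℝ}

theorem isOpen_collar (hΩ : IsLipschitzExteriorBallFamily Ω R M) (r : ℝ) :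
    IsOpen (collar (fun t => closure (Ω t)) r) :=
  (isOpen_lt continuous_const hΩ.closure_family.continuous_infDist).inter
    (isOpen_lt hΩ.closure_family.continuous_infDist continuous_const)

theorem mem_iff (hΩ : IsLipschitzExteriorBallFamily Ω R M) {x : X} {t : ℝ} :
    x ∈ Ω t ↔ 0 < infDist x (Ω t)ᶜ := by
  have := (hΩ.isOpen t).isClosed_compl.notMem_iff_infDist_pos
    (nonempty_compl.2 (hΩ.ne_univ t)) (x := x)
  rw [← this, notMem_compl_iff]

theorem isOpen_depth_lt (hΩ : IsLipschitzExteriorBallFamily Ω R M) (c : ℝ) :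
    IsOpen {p : X × ℝ | p.1 ∈ Ω p.2 ∧ infDist p.1 (Ω p.2)ᶜ < c} := by
  have hd := continuous_infDist_of_infDist_le hΩ.infDist_compl_le
  have : {p : X × ℝ | p.1 ∈ Ω p.2 ∧ infDist p.1 (Ω p.2)ᶜ < c}
      = {p : X × ℝ | 0 < infDist p.1 (Ω p.2)ᶜ ∧ infDist p.1 (Ω p.2)ᶜ < c} := by
    ext p
    simp only [mem_ofPred_eq, hΩ.mem_iff]
  rw [this]
  exact (isOpen_lt continuous_const hd).inter (isOpen_lt hd continuous_const)

variable [FiniteDimensional ℝ X]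

/-- The ball about an interior point `x` which touches the boundary at `y` and an exterior ball
at `y` have their centres on a common line through `y`. -/
theorem exterior_ray (hΩ : IsLipschitzExteriorBallFamily Ω R M) {x y : X} {t : ℝ} (hx : x ∈ Ω t)
    (hy : y ∈ frontier (Ω t)) (hxy : infDist x (Ω t)ᶜ = dist x y) {u : X} (hu : ‖u‖ = 1)
    (hyx : y = x + dist x y • u) {s : ℝ} (hs : 0 ≤ s) (hsR : s ≤ R / 2) :
    infDist (y + s • u) (closure (Ω t)) = s ∧ metricProj (closure (Ω t)) (y + s • u) = y := by
  have hR := hΩ.closure_family.pos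
  obtain ⟨ν, hν, hb⟩ := hΩ.exists_normal t y hy
  have hd : 0 < dist x y := by rw [← hxy]; exact hΩ.mem_iff.1 hx
  have h1 := signedBoundaryDist_le hR (hΩ.isOpen t) ⟨x, hx⟩ hb x
  rw [signedBoundaryDist, if_pos hx, infDist_frontier_eq_infDist_compl hx (hΩ.ne_univ t), hxy] at h1
  have h2 : y + R • ν = x + (dist x y + R) • u := by
    refine eq_add_smul_of_dist_le hu hd hyx ?_ (by linarith)
    rw [dist_self_add_right, norm_smul, hν, Real.norm_of_nonneg hR.le]; ring
  have h3 : y + R • ν = y + R • u := by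
    rw [h2, add_smul, ← add_assoc, ← hyx]
  have hyK : y ∈ closure (Ω t) := frontier_subset_closure hy
  have hys : dist (y + s • u) y = s := by
    rw [dist_self_add_left, norm_smul, hu, Real.norm_of_nonneg hs, mul_one]
  have h4 : infDist (y + s • u) (closure (Ω t)) = s := by
    refine le_antisymm ((infDist_le_dist_of_mem hyK).trans_eq hys) ?_
    rw [le_infDist ⟨y, hyK⟩]
    intro b hb'
    have e1 := hb b hb'
    rw [h3] at e1
    have e2 : dist (y + R • u) (y + s • u) = R - s := by
      rw [dist_add_left, dist_eq_norm, ← sub_smul, norm_smul, hu, mul_one,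
        Real.norm_of_nonneg (by linarith)]
    linarith [dist_triangle (y + R • u) (y + s • u) b]
  refine ⟨h4, ?_⟩
  exact (hΩ.closure_family.hasReach t).eq_metricProj hR isClosed_closure hyK
    (by rw [h4, hys]) (by rw [h4]; exact hsR)

theorem continuousOn_rayMap (hΩ : IsLipschitzExteriorBallFamily Ω R M) (l : ℝ) :
    ContinuousOn (fun p : X × ℝ => rayMap (closure (Ω p.2)) l p.1)
      (collar (fun t => closure (Ω t)) (R / 2)) := by
  have h : ContinuousOn (fun p : X × ℝ => metricProj (closure (Ω p.2)) p.1)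
      (collar (fun t => closure (Ω t)) (R / 2)) :=
    hΩ.closure_family.continuousOn_metricProj.mono fun p hp => hp.2
  unfold rayMap
  fun_prop

theorem lipschitzOnWith_rayMap (hΩ : IsLipschitzExteriorBallFamily Ω R M) (l : ℝ) (t : ℝ) :
    ∃ L : ℝ≥0, LipschitzOnWith L (rayMap (closure (Ω t)) l)
      {x | infDist x (closure (Ω t)) ≤ R / 2} := by
  have h := (hΩ.closure_family.hasReach t).lipschitzOnWith_metricProj hΩ.closure_family.pos
    isClosed_closure (hΩ.closure_family.nonempty t)
  have hid : LipschitzOnWith 1 (fun x : X => x) {x | infDist x (closure (Ω t)) ≤ R / 2} :=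
    LipschitzWith.id.lipschitzOnWith
  exact ⟨_, hid.add ((lipschitzWith_smul l).comp_lipschitzOnWith (h.sub hid))⟩

/-- Each interior point of depth less than `(l - 1) R / 2` is the image under `rayMap` of a point
of the exterior collar. -/
theorem exists_rayMap_eq (hΩ : IsLipschitzExteriorBallFamily Ω R M) {l : ℝ} (hl : 1 < l) {x : X}
    {t : ℝ} (hx : x ∈ Ω t) (hd : infDist x (Ω t)ᶜ < (l - 1) * (R / 2)) :
    ∃ z, (z, t) ∈ longRay Ω R l ∧ rayMap (closure (Ω t)) l z = x := by
  obtain ⟨y, hy, hxy⟩ := exists_mem_frontier_infDist_compl_eq_dist hx (hΩ.ne_univ t)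
  have hd0 : 0 < dist x y := by rw [← hxy]; exact hΩ.mem_iff.1 hx
  have hl0 : 0 < l - 1 := by linarith
  set u : X := (dist x y)⁻¹ • (y - x) with hu
  set s := dist x y / (l - 1) with hs
  have hls : (l - 1) * s = dist x y := mul_div_cancel₀ _ hl0.ne'
  have hu1 : ‖u‖ = 1 := by
    rw [hu, norm_smul, norm_inv, Real.norm_of_nonneg hd0.le, ← dist_eq_norm, dist_comm y x,
      inv_mul_cancel₀ hd0.ne']
  have hyx : y = x + dist x y • u := by
    rw [hu, smul_smul, mul_inv_cancel₀ hd0.ne', one_smul]; abel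
  have hs0 : 0 < s := by positivity
  have hsR : s < R / 2 := by rw [hs, div_lt_iff₀ hl0]; linarith
  obtain ⟨h1, h2⟩ := hΩ.exterior_ray hx hy hxy hu1 hyx hs0.le hsR.le
  have hray : rayMap (closure (Ω t)) l (y + s • u) = x := by
    have hx' : x = y - ((l - 1) * s) • u := by rw [hls, eq_sub_iff_add_eq]; exact hyx.symm
    rw [rayMap, h2, hx']
    module
  refine ⟨y + s • u, ⟨⟨?_, ?_⟩, ?_⟩, hray⟩
  · exact hs0.trans_eq h1.symm
  · exact h1.trans_lt hsR
  · dsimp only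
    rw [h1, hray, hls, hxy]

variable [MeasurableSpace X] [BorelSpace X]

theorem measurableSet_longRay (hΩ : IsLipschitzExteriorBallFamily Ω R M) (l : ℝ) :
    MeasurableSet (longRay Ω R l) := by
  set U := collar (fun t => closure (Ω t)) (R / 2) with hU
  have hUo : IsOpen U := hΩ.isOpen_collar _
  have hG := (hΩ.continuousOn_rayMap l).prodMk continuousOn_snd
  have hd := (continuous_infDist_of_infDist_le hΩ.infDist_compl_le).comp_continuousOn hG
  have hδ := hΩ.closure_family.continuous_infDist
  have h1 := (((hδ.const_mul (l - 1)).continuousOn (s := U)).sub hd).isOpen_inter_preimage hUo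
    (isOpen_Ioi (a := (0 : ℝ)))
  have h2 : longRay Ω R l = U \ (U ∩ (fun p : X × ℝ => (l - 1) * infDist p.1 (closure (Ω p.2))
      - infDist (rayMap (closure (Ω p.2)) l p.1) (Ω p.2)ᶜ) ⁻¹' Ioi 0) := by
    ext p
    constructor
    · exact fun h => ⟨h.1, fun h' => (sub_pos.1 h'.2).not_ge h.2⟩
    · exact fun h => ⟨h.1, not_lt.1 fun h' => h.2 ⟨h.1, sub_pos.2 h'⟩⟩
  rw [h2]
  exact hUo.measurableSet.diff h1.measurableSet

/-- A property of almost every point of the exterior collar holds, for almost every interior point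
of depth less than `(l - 1) R / 2`, at a point of the collar whose ray realizes the distance up to
that interior point. In each time slice this is because Lipschitz maps preserve null sets. -/
theorem ae_exists_rayMap_eq (hΩ : IsLipschitzExteriorBallFamily Ω R M) (μ : Measure X)
    [μ.IsAddHaarMeasure] {A : Set (X × ℝ)} {l : ℝ} (hl : 1 < l)
    (hA : ∀ᵐ p ∂(μ.prod volume), p ∈ longRay Ω R l → p ∈ A) :
    ∀ᵐ p ∂(μ.prod volume), p.1 ∈ Ω p.2 → infDist p.1 (Ω p.2)ᶜ < (l - 1) * (R / 2) →
      ∃ z, (z, p.2) ∈ A ∧ (z, p.2) ∈ longRay Ω R l ∧ rayMap (closure (Ω p.2)) l z = p.1 := by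
  have : ProperSpace X := FiniteDimensional.proper ℝ X
  set U := longRay Ω R l with hU
  have hUm : MeasurableSet U := hΩ.measurableSet_longRay l
  set N := toMeasurable (μ.prod volume) {p | ¬ (p ∈ U → p ∈ A)} with hN
  have hN0 : (μ.prod volume) N = 0 := by rw [hN, measure_toMeasurable]; exact hA
  obtain ⟨C, hCc, hCsub, hC0⟩ := exists_compact_seq_measure_diff_eq_zero (μ.prod volume)
    (hUm.diff (measurableSet_toMeasurable (μ.prod volume) {p | ¬ (p ∈ U → p ∈ A)}))
  have hCA : ∀ i, C i ⊆ A := by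
    intro i p hp
    have h1 := hCsub i hp
    by_contra hpA
    exact h1.2 (subset_toMeasurable _ _ (fun h => hpA (h h1.1)))
  have hnull : (μ.prod volume) (U \ ⋃ i, C i) = 0 := by
    refine measure_mono_null (t := N ∪ (U \ N) \ ⋃ i, C i) ?_ (measure_union_null hN0 hC0)
    intro p hp
    by_cases h : p ∈ N
    · exact Or.inl h
    · exact Or.inr ⟨⟨hp.1, h⟩, hp.2⟩
  set G : X × ℝ → X × ℝ := fun p => (rayMap (closure (Ω p.2)) l p.1, p.2) with hG
  have hGc : ContinuousOn G (collar (fun t => closure (Ω t)) (R / 2)) :=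
    (hΩ.continuousOn_rayMap l).prodMk continuousOn_snd
  have hGC : MeasurableSet (⋃ i, G '' C i) :=
    MeasurableSet.iUnion fun i =>
      ((hCc i).image_of_continuousOn (hGc.mono fun p hp => (hCsub i hp).1.1)).measurableSet
  -- the interior points which are not reached from the compact sets
  have hbad : (μ.prod volume) ({p : X × ℝ | p.1 ∈ Ω p.2 ∧
      infDist p.1 (Ω p.2)ᶜ < (l - 1) * (R / 2)} \ ⋃ i, G '' C i) = 0 := by
    refine prod_null_of_time_slices ((hΩ.isOpen_depth_lt _).measurableSet.diff hGC) ?_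
    filter_upwards [time_slices_null hnull] with t ht
    obtain ⟨L, hL⟩ := hΩ.lipschitzOnWith_rayMap l t
    refine measure_mono_null ?_ ((hL.mono (s := {x | (x, t) ∈ U \ ⋃ i, C i})
      (fun x hx => hx.1.1.2.le)).addHaar_image_null μ ht)
    rintro x ⟨⟨hx1, hx2⟩, hx3⟩
    obtain ⟨z, hz, hzx⟩ := hΩ.exists_rayMap_eq hl hx1 hx2
    refine ⟨z, ⟨hz, fun hzC => hx3 ?_⟩, hzx⟩
    obtain ⟨i, hi⟩ := mem_iUnion.1 hzC
    exact mem_iUnion.2 ⟨i, (z, t), hi, by simp only [hG, hzx]⟩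
  filter_upwards [compl_mem_ae_iff.2 hbad] with p hp h1 h2
  have h3 : p ∈ ⋃ i, G '' C i := by
    by_contra h3
    exact hp ⟨⟨h1, h2⟩, h3⟩
  obtain ⟨i, ⟨x, t⟩, hi, rfl⟩ := mem_iUnion.1 h3
  exact ⟨x, hCA i hi, (hCsub i hi).1, rfl⟩

/-- For all but countably many `l`, the rays which realize the distance up to `rayMap _ l x` do so
beyond this point, for almost every `x` in the collar: the sets of exceptional points for distinct
values of `l` are disjoint. -/
theorem countable_not_ae_longRay (hΩ : IsLipschitzExteriorBallFamily Ω R M) (μ : Measure X)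
    [μ.IsAddHaarMeasure] :
    {l : ℝ | ¬ ∀ᵐ p ∂(μ.prod volume), p ∈ longRay Ω R l →
      ∃ l' > l, p ∈ longRay Ω R l'}.Countable := by
  have hanti : ∀ {l l' : ℝ}, l ≤ l' → longRay Ω R l' ⊆ longRay Ω R l := by
    rintro l l' hll p ⟨hp, h⟩
    refine ⟨hp, ?_⟩
    have h1 := infDist_le_infDist_add_dist (s := (Ω p.2)ᶜ)
      (x := rayMap (closure (Ω p.2)) l' p.1) (y := rayMap (closure (Ω p.2)) l p.1)
    have h2 := (metricProj_spec (K := closure (Ω p.2)) isClosed_closure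
      (hΩ.closure_family.nonempty p.2) p.1).2
    rw [rayMap, rayMap, dist_add_left, dist_eq_norm, ← sub_smul, norm_smul,
      Real.norm_of_nonneg (by linarith), ← dist_eq_norm, dist_comm _ p.1, h2, ← rayMap,
      ← rayMap] at h1
    linarith
  set S : ℝ → Set (X × ℝ) := fun l => longRay Ω R l \ ⋃ k : ℕ, longRay Ω R (l + 1 / ((k : ℝ) + 1))
    with hS
  have hSm : ∀ l, MeasurableSet (S l) := fun l =>
    (hΩ.measurableSet_longRay l).diff (MeasurableSet.iUnion fun k => hΩ.measurableSet_longRay _)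
  have hlt : ∀ {l l' : ℝ}, l < l' → Disjoint (S l) (S l') := by
    intro l l' hll
    rw [Set.disjoint_left]
    intro p hp hp'
    obtain ⟨k, hk⟩ := exists_nat_one_div_lt (sub_pos.2 hll)
    exact hp.2 (mem_iUnion.2 ⟨k, hanti (by linarith) hp'.1⟩)
  have hdisj : Pairwise (Function.onFun Disjoint S) := by
    intro l l' hll
    rcases hll.lt_or_gt with h | h
    · exact hlt h
    · exact (hlt h).symm
  refine (Measure.countable_meas_pos_of_disjoint_iUnion (μ := μ.prod volume) hSm hdisj).mono ?_
  intro l hl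
  rw [mem_ofPred_eq, pos_iff_ne_zero]
  intro h0
  refine hl ?_
  filter_upwards [compl_mem_ae_iff.2 h0] with p hp hpl
  have h1 : p ∈ ⋃ k : ℕ, longRay Ω R (l + 1 / ((k : ℝ) + 1)) := by
    by_contra h1
    exact hp ⟨hpl, h1⟩
  obtain ⟨k, hk⟩ := mem_iUnion.1 h1
  exact ⟨_, lt_add_of_pos_right l (by positivity), hk⟩

/-- Almost every interior point lies in the relative interior of a distance ray, and has behind
the lower end of this ray a point of the exterior collar with a property which holds almost
everywhere in the collar. -/
theorem ae_exists_longRay (hΩ : IsLipschitzExteriorBallFamily Ω R M) (μ : Measure X)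
    [μ.IsAddHaarMeasure] {A : Set (X × ℝ)}
    (hA : ∀ᵐ p ∂(μ.prod volume), p ∈ collar (fun t => closure (Ω t)) (R / 2) → p ∈ A) :
    ∀ᵐ p ∂(μ.prod volume), p.1 ∈ Ω p.2 → ∃ z l l', (z, p.2) ∈ A ∧ 1 < l ∧ l < l' ∧
      (z, p.2) ∈ longRay Ω R l' ∧ rayMap (closure (Ω p.2)) l z = p.1 := by
  have hR := hΩ.closure_family.pos
  have hl : ∀ j : ℕ, ∃ l : ℝ, (j : ℝ) + 1 < l ∧
      ∀ᵐ p ∂(μ.prod volume), p ∈ longRay Ω R l → ∃ l' > l, p ∈ longRay Ω R l' := by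
    intro j
    by_contra hcon
    have hcount := (hΩ.countable_not_ae_longRay μ).mono
      (show Ioi ((j : ℝ) + 1) ⊆ _ from fun l hl h => hcon ⟨l, hl, h⟩)
    have h0 := hcount.measure_zero volume
    rw [Real.volume_Ioi] at h0
    exact ENNReal.top_ne_zero h0
  choose l hl1 hl2 using hl
  have hl0 : ∀ j, 1 < l j := fun j => by
    have : (0 : ℝ) ≤ j := Nat.cast_nonneg j
    linarith [hl1 j]
  have key : ∀ j, ∀ᵐ p ∂(μ.prod volume), p.1 ∈ Ω p.2 →
      infDist p.1 (Ω p.2)ᶜ < (l j - 1) * (R / 2) →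
      ∃ z, (z, p.2) ∈ A ∩ {p | ∃ l' > l j, p ∈ longRay Ω R l'} ∧ (z, p.2) ∈ longRay Ω R (l j) ∧
        rayMap (closure (Ω p.2)) (l j) z = p.1 := by
    intro j
    refine hΩ.ae_exists_rayMap_eq μ (hl0 j) ?_
    filter_upwards [hA, hl2 j] with p h1 h2 hp
    exact ⟨h1 hp.1, h2 hp⟩
  filter_upwards [ae_all_iff.2 key] with p hp hpΩ
  obtain ⟨j, hj⟩ := exists_nat_gt (infDist p.1 (Ω p.2)ᶜ / (R / 2))
  rw [div_lt_iff₀ (by positivity)] at hj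
  obtain ⟨z, ⟨hzA, l', hl', hz'⟩, -, hz⟩ := hp j hpΩ (hj.trans_le (by
    gcongr; linarith [hl1 j]))
  exact ⟨z, l j, l', hzA, hl0 j, hl', hz', hz⟩

end IsLipschitzExteriorBallFamily

end Transfer

/-! ### The boundary near a point touched from both sides -/

section LocalGraph

variable {X : Type*} [NormedAddCommGroup X] [InnerProductSpace ℝ X]

/-- The point `y` is touched at time `t₀` by an exterior ball of radius `s` about `y - s e` and by
an interior ball of radius `D` about `y + D e`. -/
structure IsTouched (Ω : ℝ → Set X) (R : ℝ) (t₀ : ℝ) (y e : X) (s D : ℝ) : Prop where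
  s_pos : 0 < s
  s_lt : s < R / 2
  D_pos : 0 < D
  norm_eq : ‖e‖ = 1
  mem_closure : y ∈ closure (Ω t₀)
  infDist_eq : infDist (y - s • e) (closure (Ω t₀)) = s
  le_infDist : D ≤ infDist (y + D • e) (Ω t₀)ᶜ

variable {Ω : ℝ → Set X} {R M t₀ s D : ℝ} {y e : X}

theorem norm_add_smul_sq (he : ‖e‖ = 1) {x' : X} (hx' : ⟪x', e⟫ = 0) (r : ℝ) :
    ‖x' + r • e‖ ^ 2 = ‖x'‖ ^ 2 + r ^ 2 := by
  rw [norm_add_sq_real, real_inner_smul_right, hx', norm_smul, he, Real.norm_eq_abs, mul_one,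
    sq_abs]; ring

/-- A point at height `r`, `|r| ≤ a`, over `x'` which is farther than `a - c` from the point at
height `-a` is not much below height `0`. -/
theorem neg_mul_le_of_dist (he : ‖e‖ = 1) {x' : X} (hx' : ⟪x', e⟫ = 0) {r a c : ℝ} (ha : 0 < a)
    (hc : 0 ≤ c) (hr : |r| ≤ a) (h : a - c ≤ ‖x' + (r + a) • e‖) :
    -(r * a) ≤ 2 * a * c + ‖x'‖ ^ 2 := by
  obtain ⟨h1, h2⟩ := abs_le.1 hr
  rcases le_or_gt 0 r with h0 | h0
  · have : 0 ≤ r * a := by positivity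
    have : 0 ≤ 2 * a * c + ‖x'‖ ^ 2 := by positivity
    linarith
  rcases lt_or_ge a c with h3 | h3
  · nlinarith [sq_nonneg ‖x'‖]
  · have h4 : (a - c) ^ 2 ≤ ‖x' + (r + a) • e‖ ^ 2 := by
      gcongr
    rw [norm_add_smul_sq he hx'] at h4
    nlinarith [sq_nonneg c]

namespace IsTouched

theorem neg_mul_le (hT : IsTouched Ω R t₀ y e s D) (hΩ : IsLipschitzExteriorBallFamily Ω R M)
    {x' : X} (hx' : ⟪x', e⟫ = 0) {r t : ℝ} (hr : |r| ≤ s)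
    (hw : y + (x' + r • e) ∈ closure (Ω t)) :
    -(r * s) ≤ 2 * s * (M * |t - t₀|) + ‖x'‖ ^ 2 := by
  refine neg_mul_le_of_dist hT.norm_eq hx' hT.s_pos
    (mul_nonneg hΩ.closure_family.nonneg (abs_nonneg _)) hr ?_
  have h1 := hΩ.closure_family.infDist_le (y - s • e) t₀ t
  have h2 : infDist (y - s • e) (closure (Ω t)) ≤ dist (y - s • e) (y + (x' + r • e)) :=
    infDist_le_dist_of_mem hw
  rw [hT.infDist_eq, abs_sub_comm] at h1
  rw [dist_comm, dist_eq_norm] at h2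
  have h3 : y + (x' + r • e) - (y - s • e) = x' + (r + s) • e := by module
  rw [h3] at h2
  linarith

theorem mul_le (hT : IsTouched Ω R t₀ y e s D) (hΩ : IsLipschitzExteriorBallFamily Ω R M)
    {x' : X} (hx' : ⟪x', e⟫ = 0) {r t : ℝ} (hr : |r| ≤ D) (hw : y + (x' + r • e) ∉ Ω t) :
    r * D ≤ 2 * D * (M * |t - t₀|) + ‖x'‖ ^ 2 := by
  have key := neg_mul_le_of_dist (e := -e) (x' := x') (r := -r) (a := D) (c := M * |t - t₀|)
    (by rw [norm_neg, hT.norm_eq]) (by rw [inner_neg_right, hx', neg_zero]) hT.D_pos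
    (mul_nonneg hΩ.closure_family.nonneg (abs_nonneg _)) (by rwa [abs_neg]) ?_
  · linarith
  have h1 := hΩ.infDist_compl_le (y + D • e) t₀ t
  have h2 : infDist (y + D • e) (Ω t)ᶜ ≤ dist (y + D • e) (y + (x' + r • e)) :=
    infDist_le_dist_of_mem (show y + (x' + r • e) ∈ (Ω t)ᶜ from hw)
  rw [abs_sub_comm] at h1
  rw [dist_comm, dist_eq_norm] at h2
  have h3 : y + (x' + r • e) - (y + D • e) = x' + (-r + D) • -e := by module
  rw [h3] at h2
  linarith [hT.le_infDist]

/-- Boundary points near `y` have height `O(θ)` and unit exterior normals with distance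
`O(θ ^ (1/2))` to `-e`, where `θ = |x'|² + |t - t₀|`. -/
theorem exists_bound [FiniteDimensional ℝ X] (hT : IsTouched Ω R t₀ y e s D)
    (hΩ : IsLipschitzExteriorBallFamily Ω R M) :
    ∃ C : ℝ, 0 ≤ C ∧ ∀ (t r : ℝ) (x' : X), ⟪x', e⟫ = 0 → |r| ≤ s → |r| ≤ D / 2 →
      M * |t - t₀| < D → y + (x' + r • e) ∈ frontier (Ω t) →
      |r| ≤ C * (‖x'‖ ^ 2 + |t - t₀|) ∧ ∃ ν : X, ‖ν‖ = 1 ∧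
        (∀ b ∈ closure (Ω t), R ≤ dist (y + (x' + r • e) + R • ν) b) ∧
        ‖ν + e‖ ^ 2 ≤ C * (‖x'‖ ^ 2 + |t - t₀|) := by
  have hR := hΩ.closure_family.pos
  have hM := hΩ.closure_family.nonneg
  have hs := hT.s_pos
  have hD := hT.D_pos
  set C₁ := 2 * M + 1 / s + 1 / D with hC₁
  have hC₁0 : 0 ≤ C₁ := by positivity
  set C₂ := 4 / (R * D) * (1 + (M + C₁) * (2 * R + 4 * D) + 4 * R / D) with hC₂
  have hC₂0 : 0 ≤ C₂ := by positivity
  refine ⟨C₁ + C₂, by positivity, fun t r x' hx' hrs hrD hMt hw => ?_⟩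
  set θ := ‖x'‖ ^ 2 + |t - t₀| with hθ
  have hτ0 := abs_nonneg (t - t₀)
  have hx0 := sq_nonneg ‖x'‖
  have hθ0 : 0 ≤ θ := by positivity
  have hwK : y + (x' + r • e) ∈ closure (Ω t) := frontier_subset_closure hw
  have hwΩ : y + (x' + r • e) ∉ Ω t := fun h => hw.2 ((hΩ.isOpen t).interior_eq.symm ▸ h)
  have hr : |r| ≤ C₁ * θ := by
    have h1 := hT.neg_mul_le hΩ hx' hrs hwK
    have h2 := hT.mul_le hΩ hx' (by linarith) hwΩ
    have e1 : -r ≤ 2 * (M * |t - t₀|) + 1 / s * ‖x'‖ ^ 2 := by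
      rw [← mul_le_mul_iff_of_pos_right hs]
      calc -r * s = -(r * s) := by ring
        _ ≤ _ := h1
        _ = _ := by field_simp
    have e2 : r ≤ 2 * (M * |t - t₀|) + 1 / D * ‖x'‖ ^ 2 := by
      rw [← mul_le_mul_iff_of_pos_right hD]
      calc r * D ≤ _ := h2
        _ = _ := by field_simp
    have e3 : C₁ * θ = 2 * (M * |t - t₀|) + 1 / s * ‖x'‖ ^ 2 + 1 / D * ‖x'‖ ^ 2
        + (2 * (M * ‖x'‖ ^ 2) + 1 / s * |t - t₀| + 1 / D * |t - t₀|) := by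
      rw [hC₁, hθ]; ring
    have e4 : 0 ≤ 1 / s * ‖x'‖ ^ 2 := by positivity
    have e5 : 0 ≤ 1 / D * ‖x'‖ ^ 2 := by positivity
    have e6 : 0 ≤ 2 * (M * ‖x'‖ ^ 2) + 1 / s * |t - t₀| + 1 / D * |t - t₀| := by positivity
    rw [abs_le]
    constructor <;> linarith
  refine ⟨hr.trans (by gcongr; linarith), ?_⟩
  obtain ⟨ν, hν, hb⟩ := hΩ.exists_normal t _ hw
  refine ⟨ν, hν, hb, ?_⟩
  set N := ‖ν + e‖ with hN
  have hN0 : 0 ≤ N := norm_nonneg _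
  have hN2 : N ^ 2 = 2 + 2 * ⟪ν, e⟫ := by
    rw [hN, norm_add_sq_real, hν, hT.norm_eq]; ring
  -- the interior ball about `y + D e` and the exterior ball at the boundary point are disjoint
  have hdist : R + D - M * |t - t₀| ≤ ‖x' + (r - D) • e + R • ν‖ := by
    have h1 := hΩ.infDist_compl_le (y + D • e) t₀ t
    rw [abs_sub_comm] at h1
    have hmem : y + D • e ∈ Ω t := hΩ.mem_iff.2 (by linarith [hT.le_infDist])
    have h2 := signedBoundaryDist_le hR (hΩ.isOpen t) ⟨_, hmem⟩ hb (y + D • e)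
    rw [signedBoundaryDist, if_pos hmem, infDist_frontier_eq_infDist_compl hmem (hΩ.ne_univ t),
      dist_comm, dist_eq_norm] at h2
    have h3 : y + (x' + r • e) + R • ν - (y + D • e) = x' + (r - D) • e + R • ν := by module
    rw [h3] at h2
    linarith [hT.le_infDist]
  have hsq : (R + D - M * |t - t₀|) ^ 2 ≤ ‖x' + (r - D) • e + R • ν‖ ^ 2 := by
    gcongr; linarith
  have hinner : ⟪x', ν⟫ ≤ ‖x'‖ * N := by
    have : ⟪x', ν⟫ = ⟪x', ν + e⟫ := by rw [inner_add_right, hx', add_zero]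
    rw [this]
    exact real_inner_le_norm _ _
  rw [norm_add_sq_real, norm_add_smul_sq hT.norm_eq hx', norm_smul, hν, Real.norm_of_nonneg hR.le,
    real_inner_smul_right, inner_add_left, real_inner_smul_left, real_inner_comm ν e] at hsq
  have hν' : ⟪ν, e⟫ = N ^ 2 / 2 - 1 := by linarith
  rw [hν'] at hsq
  set τ := |t - t₀|
  obtain ⟨hr1, hr2⟩ := abs_le.1 hr
  obtain ⟨hr3, hr4⟩ := abs_le.1 hrD
  have h1 : R * (D - r) * N ^ 2 ≤ ‖x'‖ ^ 2 + 2 * R * (‖x'‖ * N)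
      + (M * τ - r) * (2 * R + 2 * D - r - M * τ) := by
    have := mul_le_mul_of_nonneg_left hinner (show 0 ≤ 2 * R by positivity)
    nlinarith
  have h2 : R * (D / 2) * N ^ 2 ≤ R * (D - r) * N ^ 2 := by gcongr; linarith
  have hMτ : 0 ≤ M * τ := by positivity
  have h3 : (M * τ - r) * (2 * R + 2 * D - r - M * τ) ≤ (M + C₁) * θ * (2 * R + 4 * D) := by
    have e1 : M * τ - r ≤ (M + C₁) * θ := by
      have : M * τ ≤ M * θ := by gcongr; linarith
      linarith
    have e2 : 0 ≤ 2 * R + 2 * D - r - M * τ := by linarith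
    calc (M * τ - r) * (2 * R + 2 * D - r - M * τ)
        ≤ (M + C₁) * θ * (2 * R + 2 * D - r - M * τ) := by gcongr
      _ ≤ _ := by gcongr; linarith
  have h4 : 2 * R * (‖x'‖ * N) ≤ R * D / 4 * N ^ 2 + 4 * R / D * θ := by
    have e1 : 0 ≤ R * D / 4 * (N - 4 / D * ‖x'‖) ^ 2 := by positivity
    have e2 : R * D / 4 * (N - 4 / D * ‖x'‖) ^ 2
        = R * D / 4 * N ^ 2 + 4 * R / D * ‖x'‖ ^ 2 - 2 * R * (‖x'‖ * N) := by
      field_simp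
      ring
    have e3 : 4 * R / D * ‖x'‖ ^ 2 ≤ 4 * R / D * θ := by gcongr; linarith
    linarith
  have h5 : R * D / 4 * N ^ 2 ≤ (1 + (M + C₁) * (2 * R + 4 * D) + 4 * R / D) * θ := by
    have : ‖x'‖ ^ 2 ≤ θ := by linarith
    linarith
  have h6 : N ^ 2 ≤ C₂ * θ := by
    calc N ^ 2 = 4 / (R * D) * (R * D / 4 * N ^ 2) := by field_simp
      _ ≤ 4 / (R * D) * ((1 + (M + C₁) * (2 * R + 4 * D) + 4 * R / D) * θ) := by gcongr
      _ = C₂ * θ := by rw [hC₂]; ring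
  exact h6.trans (by gcongr; linarith)

end IsTouched

/-- An open set `O` of reals which contains `η`, but not `-η`, and which lies, near each of its
boundary points in `(-η, η)`, above this point, is an upper half line within `[-η, η]`. -/
theorem exists_mem_iff_lt {O : Set ℝ} {η : ℝ} (hO : IsOpen O) (hη : 0 < η) (h1 : η ∈ O)
    (h2 : -η ∉ O)
    (h3 : ∀ r, |r| < η → r ∈ closure O → r ∉ O → ∃ᶠ r' in 𝓝[<] r, r' ∉ O) :
    ∃ ψ, |ψ| ≤ η ∧ ψ ∈ closure O ∧ ψ ∉ O ∧ ∀ r, |r| ≤ η → (r ∈ O ↔ ψ < r) := by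
  have hup : ∀ a b, -η ≤ a → a ≤ b → b ≤ η → a ∈ O → b ∈ O := by
    intro a b ha hab hb haO
    by_contra hbO
    set T := Icc a b ∩ Oᶜ with hT
    have hTc : IsClosed T := isClosed_Icc.inter hO.isClosed_compl
    have hTne : T.Nonempty := ⟨b, right_mem_Icc.2 hab, hbO⟩
    have hTb : BddBelow T := ⟨a, fun r hr => hr.1.1⟩
    have hc := hTc.csInf_mem hTne hTb
    set c := sInf T
    have hac : a < c := lt_of_le_of_ne hc.1.1 fun h => hc.2 (h ▸ haO)
    have hcη : c < η := lt_of_le_of_ne (hc.1.2.trans hb) fun h => hc.2 (h ▸ h1)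
    have hbelow : ∀ r ∈ Ioo a c, r ∈ O := by
      intro r hr
      by_contra hrO
      exact absurd (csInf_le hTb ⟨⟨hr.1.le, hr.2.le.trans hc.1.2⟩, hrO⟩) (not_le.2 hr.2)
    have hcl : c ∈ closure O := by
      have : c ∈ closure (Ioo a c) := by
        rw [closure_Ioo hac.ne]; exact right_mem_Icc.2 hac.le
      exact closure_mono hbelow this
    obtain ⟨r', hr', hr''⟩ := ((h3 c (abs_lt.2 ⟨by linarith, hcη⟩) hcl hc.2).and_eventually
      (Ioo_mem_nhdsLT hac)).exists
    exact hr' (hbelow r' hr'')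
  set S := O ∩ Icc (-η) η with hS
  have hSne : S.Nonempty := ⟨η, h1, ⟨by linarith, le_rfl⟩⟩
  have hSb : BddBelow S := ⟨-η, fun r hr => hr.2.1⟩
  have hψη : sInf S ≤ η := csInf_le hSb ⟨h1, ⟨by linarith, le_rfl⟩⟩
  have hψη' : -η ≤ sInf S := le_csInf hSne fun r hr => hr.2.1
  have hcl : sInf S ∈ closure O := closure_mono inter_subset_left (csInf_mem_closure hSne hSb)
  set ψ := sInf S with hψ
  have hψO : ψ ∉ O := by
    intro h
    have hlt : -η < ψ := lt_of_le_of_ne hψη' fun h' => h2 (h' ▸ h)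
    have hev : ∀ᶠ r' in 𝓝[<] ψ, r' ∈ O := nhdsWithin_le_nhds (hO.mem_nhds h)
    obtain ⟨r', hr', hr''⟩ := (hev.and (Ioo_mem_nhdsLT hlt)).exists
    exact absurd (csInf_le hSb ⟨hr', ⟨hr''.1.le, hr''.2.le.trans hψη⟩⟩) (not_le.2 hr''.2)
  refine ⟨ψ, abs_le.2 ⟨hψη', hψη⟩, hcl, hψO, fun r hr => ⟨fun hrO => ?_, fun hlt => ?_⟩⟩
  · exact lt_of_le_of_ne (csInf_le hSb ⟨hrO, abs_le.1 hr⟩) fun h => hψO (h ▸ hrO)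
  · obtain ⟨a, haS, har⟩ := exists_lt_of_csInf_lt hSne hlt
    exact hup a r haS.2.1 har.le (abs_le.1 hr).2 haS.1

end LocalGraph

section LocalGraph

variable {X : Type*} [NormedAddCommGroup X] [InnerProductSpace ℝ X]
variable {Ω : ℝ → Set X} {R M t₀ s D : ℝ} {y e : X}

namespace IsTouched

/-- Near `y` and `t₀` the sets of the family are the regions above graphs over `e⊥`. -/
theorem exists_graph [FiniteDimensional ℝ X] (hT : IsTouched Ω R t₀ y e s D)
    (hΩ : IsLipschitzExteriorBallFamily Ω R M) :
    ∃ η ρ : ℝ, 0 < η ∧ 0 < ρ ∧ ∃ Ψ : X → ℝ → ℝ, ∀ x' t, ⟪x', e⟫ = 0 →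
      ‖x'‖ ^ 2 + |t - t₀| < ρ → |Ψ x' t| ≤ s ∧ |Ψ x' t| ≤ D / 2 ∧ M * |t - t₀| < D ∧
      y + (x' + Ψ x' t • e) ∈ frontier (Ω t) ∧
      ∀ r, |r| ≤ η → (y + (x' + r • e) ∈ Ω t ↔ Ψ x' t < r) := by
  have hR := hΩ.closure_family.pos
  have hM := hΩ.closure_family.nonneg
  have hs := hT.s_pos
  have hD := hT.D_pos
  obtain ⟨C, hC, hbound⟩ := hT.exists_bound hΩ
  set η := min s (D / 2) with hη
  have hη0 : 0 < η := lt_min hs (by positivity)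
  have hηs : η ≤ s := min_le_left _ _
  have hηD : η ≤ D / 2 := min_le_right _ _
  set ρ := min (min (1 / (C + 1)) (D / (M + 1)))
    (min (η * D / (2 * D * M + 1)) (η * s / (2 * s * M + 1))) with hρ
  have hρ0 : 0 < ρ := by positivity
  have key : ∀ x' t, ⟪x', e⟫ = 0 → ‖x'‖ ^ 2 + |t - t₀| < ρ → ∃ ψ : ℝ, |ψ| ≤ s ∧ |ψ| ≤ D / 2 ∧
      M * |t - t₀| < D ∧ y + (x' + ψ • e) ∈ frontier (Ω t) ∧
      ∀ r, |r| ≤ η → (y + (x' + r • e) ∈ Ω t ↔ ψ < r) := by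
    intro x' t hx' hθ
    set θ := ‖x'‖ ^ 2 + |t - t₀| with hθdef
    have hτ0 := abs_nonneg (t - t₀)
    have hx0 := sq_nonneg ‖x'‖
    have h1 : θ < 1 / (C + 1) := hθ.trans_le ((min_le_left _ _).trans (min_le_left _ _))
    have h2 : θ < D / (M + 1) := hθ.trans_le ((min_le_left _ _).trans (min_le_right _ _))
    have h3 : θ < η * D / (2 * D * M + 1) :=
      hθ.trans_le ((min_le_right _ _).trans (min_le_left _ _))
    have h4 : θ < η * s / (2 * s * M + 1) :=
      hθ.trans_le ((min_le_right _ _).trans (min_le_right _ _))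
    rw [lt_div_iff₀ (by positivity)] at h1 h2 h3 h4
    have hθ0 : 0 ≤ θ := by positivity
    have hMt : M * |t - t₀| < D := by nlinarith
    set P : ℝ → X := fun r => y + (x' + r • e) with hP
    have hPc : Continuous P := by fun_prop
    obtain ⟨ψ, hψ1, hψ2, hψ3, hψ4⟩ := exists_mem_iff_lt (O := P ⁻¹' Ω t) (η := η)
      ((hΩ.isOpen t).preimage hPc) hη0 (by
        by_contra hn
        have := hT.mul_le hΩ hx' (r := η) (t := t) (by rw [abs_of_pos hη0]; linarith) hn
        nlinarith [mul_nonneg (mul_nonneg hD.le hM) hx0]) (by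
        intro hn
        have := hT.neg_mul_le hΩ hx' (r := -η) (t := t)
          (by rw [abs_neg, abs_of_pos hη0]; linarith) (subset_closure hn)
        nlinarith [mul_nonneg (mul_nonneg hs.le hM) hx0]) (by
        intro r hr hrc hrO
        have hw : P r ∈ frontier (Ω t) := by
          rw [frontier, (hΩ.isOpen t).interior_eq]
          exact ⟨hPc.closure_preimage_subset _ hrc, hrO⟩
        obtain ⟨-, ν, hν, hb, hN⟩ := hbound t r x' hx' (by linarith) (by linarith) hMt hw
        have hνe : ⟪ν, e⟫ < 0 := by
          rw [norm_add_sq_real, hν, hT.norm_eq] at hN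
          nlinarith
        refine Eventually.frequently ?_
        filter_upwards [Ioo_mem_nhdsLT (show r + 2 * R * ⟪ν, e⟫ < r by nlinarith)] with r' hr' hmem
        have hd := hb _ (subset_closure hmem)
        rw [dist_eq_norm] at hd
        have e1 : y + (x' + r • e) + R • ν - P r' = R • ν + (r - r') • e := by
          simp only [hP]; module
        rw [e1] at hd
        have e2 : R ^ 2 ≤ ‖R • ν + (r - r') • e‖ ^ 2 := by gcongr
        rw [norm_add_sq_real, norm_smul, norm_smul, hν, hT.norm_eq, real_inner_smul_left,
          real_inner_smul_right, Real.norm_of_nonneg hR.le, Real.norm_eq_abs, mul_one, mul_one,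
          sq_abs] at e2
        have e3 : 0 < r - r' := by linarith [hr'.2]
        have e4 : r - r' < -(2 * R * ⟪ν, e⟫) := by linarith [hr'.1]
        nlinarith)
    refine ⟨ψ, by linarith, by linarith, hMt, ?_, hψ4⟩
    rw [frontier, (hΩ.isOpen t).interior_eq]
    exact ⟨hPc.closure_preimage_subset _ hψ2, hψ3⟩
  classical
  -- outside the parabolic neighbourhood the value of the graph function is irrelevant
  refine ⟨η, ρ, hη0, hρ0, fun x' t =>
    if h : ⟪x', e⟫ = 0 ∧ ‖x'‖ ^ 2 + |t - t₀| < ρ then (key x' t h.1 h.2).choose else 0,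
    fun x' t hx' hθ => ?_⟩
  have hθ' : ⟪x', e⟫ = 0 ∧ ‖x'‖ ^ 2 + |t - t₀| < ρ := ⟨hx', hθ⟩
  simp only [dif_pos hθ']
  exact (key x' t hx' hθ).choose_spec

section Expansion

variable {v : ℝ} {A : X →L[ℝ] X}

theorem dist_eq (hT : IsTouched Ω R t₀ y e s D) :
    dist (y - s • e) y = infDist (y - s • e) (closure (Ω t₀)) := by
  rw [hT.infDist_eq, dist_self_sub_left, norm_smul, hT.norm_eq, Real.norm_of_nonneg hT.s_pos.le,
    mul_one]

/-- The affine function of the potential indexed by a boundary point, relative to that of `y`. -/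
theorem inner_expansion (he : ‖e‖ = 1) {x' : X} (hx' : ⟪x', e⟫ = 0) (h : X) (r : ℝ) :
    ⟪y - s • e + h, y + (x' + r • e)⟫ - ‖y + (x' + r • e)‖ ^ 2 / 2
      = ⟪y - s • e, y⟫ - ‖y‖ ^ 2 / 2 + ⟪h, y⟫ + (-(s * r) + ⟪h, x' + r • e⟫
        - (‖x'‖ ^ 2 + r ^ 2) / 2) := by
  have h1 : ⟪e, x' + r • e⟫ = r := by
    rw [inner_add_right, real_inner_comm, hx', real_inner_smul_right, real_inner_self_eq_norm_sq,
      he]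
    ring
  rw [norm_add_sq_real, norm_add_smul_sq he hx', inner_add_left, inner_add_right,
    inner_add_right h, inner_sub_left _ _ (x' + r • e), real_inner_smul_left, h1]
  ring

/-- The expansion of the potential for increments `h` of parabolic size, whose squares are
comparable with `|x'|² + |t - t₀|`. -/
theorem remainder_le (hT : IsTouched Ω R t₀ y e s D)
    (hexp : HasParabolicExpansionAt (fun q => distPotential (closure (Ω q.2)) q.1) y
      (y - s • e, t₀) v A) {B ε : ℝ} (hB : 0 ≤ B) (hε : 0 < ε) :
    ∃ ρ > 0, ∀ (t : ℝ) (x' h : X), ‖x'‖ ^ 2 + |t - t₀| < ρ →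
      ‖h‖ ^ 2 ≤ B * (‖x'‖ ^ 2 + |t - t₀|) →
      |distPotential (closure (Ω t)) (y - s • e + h) - (⟪y - s • e, y⟫ - ‖y‖ ^ 2 / 2)
        - v * (t - t₀) - ⟪h, y⟫ - ⟪h, A h⟫ / 2| ≤ ε * (‖x'‖ ^ 2 + |t - t₀|) := by
  have h1 := hexp.def (show 0 < ε / (B + 1) by positivity)
  obtain ⟨ρ, hρ, hball⟩ := Metric.eventually_nhds_iff.1 h1
  refine ⟨min ρ (ρ ^ 2 / (B + 1)), by positivity, fun t x' h hθ hh => ?_⟩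
  set θ := ‖x'‖ ^ 2 + |t - t₀| with hθdef
  have hτ0 := abs_nonneg (t - t₀)
  have hx0 := sq_nonneg ‖x'‖
  have hθ0 : 0 ≤ θ := by positivity
  have h2 : θ < ρ := hθ.trans_le (min_le_left _ _)
  have h3 : θ < ρ ^ 2 / (B + 1) := hθ.trans_le (min_le_right _ _)
  rw [lt_div_iff₀ (by positivity)] at h3
  have h4 : ‖h‖ < ρ := by
    refine (pow_lt_pow_iff_left₀ (norm_nonneg _) hρ.le two_ne_zero).1 ?_
    linarith
  have h5 := @hball (y - s • e + h, t) (by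
    rw [Prod.dist_eq, max_lt_iff, dist_self_add_left, Real.dist_eq]
    exact ⟨h4, by linarith⟩)
  dsimp only at h5
  rw [add_sub_cancel_left, Real.norm_eq_abs, Real.norm_of_nonneg (by positivity),
    distPotential_eq hT.dist_eq] at h5
  refine h5.trans ?_
  calc ε / (B + 1) * (‖h‖ ^ 2 + |t - t₀|) ≤ ε / (B + 1) * ((B + 1) * θ) := by
        gcongr
        linarith
    _ = ε * θ := by field_simp

/-- Boundary points lie in the closure, so the potential bounds their height from below. -/
theorem lower_expansion (hT : IsTouched Ω R t₀ y e s D)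
    (hexp : HasParabolicExpansionAt (fun q => distPotential (closure (Ω q.2)) q.1) y
      (y - s • e, t₀) v A) {B ε : ℝ} (hB : 0 ≤ B) (hε : 0 < ε) :
    ∃ ρ > 0, ∀ (t r : ℝ) (x' h : X), ⟪x', e⟫ = 0 → ‖x'‖ ^ 2 + |t - t₀| < ρ →
      ‖h‖ ^ 2 ≤ B * (‖x'‖ ^ 2 + |t - t₀|) → y + (x' + r • e) ∈ closure (Ω t) →
      -(s * r) + ⟪h, x' + r • e⟫ - (‖x'‖ ^ 2 + r ^ 2) / 2
        ≤ v * (t - t₀) + ⟪h, A h⟫ / 2 + ε * (‖x'‖ ^ 2 + |t - t₀|) := by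
  obtain ⟨ρ, hρ, hrem⟩ := hT.remainder_le hexp hB hε
  refine ⟨ρ, hρ, fun t r x' h hx' hθ hh hw => ?_⟩
  have h1 := (abs_le.1 (hrem t x' h hθ hh)).2
  have h2 := le_distPotential hw (y - s • e + h)
  rw [inner_expansion hT.norm_eq hx'] at h2
  linarith

/-- The height of a boundary point is given by the potential at the point at distance `s` from it
on the exterior normal. -/
theorem upper_expansion [FiniteDimensional ℝ X] (hT : IsTouched Ω R t₀ y e s D)
    (hΩ : IsLipschitzExteriorBallFamily Ω R M)
    (hexp : HasParabolicExpansionAt (fun q => distPotential (closure (Ω q.2)) q.1) y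
      (y - s • e, t₀) v A) :
    ∃ B : ℝ, 0 ≤ B ∧ ∀ ε > 0, ∃ ρ > 0, ∀ (t r : ℝ) (x' : X), ⟪x', e⟫ = 0 →
      ‖x'‖ ^ 2 + |t - t₀| < ρ → |r| ≤ s → |r| ≤ D / 2 → M * |t - t₀| < D →
      y + (x' + r • e) ∈ frontier (Ω t) → |r| ≤ B * (‖x'‖ ^ 2 + |t - t₀|) ∧
      ∃ h : X, ‖h‖ ^ 2 ≤ B * (‖x'‖ ^ 2 + |t - t₀|) ∧
        v * (t - t₀) + ⟪h, A h⟫ / 2 ≤ -(s * r) + ⟪h, x' + r • e⟫ - (‖x'‖ ^ 2 + r ^ 2) / 2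
          + ε * (‖x'‖ ^ 2 + |t - t₀|) := by
  have hs := hT.s_pos
  obtain ⟨C, hC, hbound⟩ := hT.exists_bound hΩ
  set B := 2 + 2 * s * C + 2 * s ^ 2 * C + C with hB
  have hB0 : 0 ≤ B := by positivity
  refine ⟨B, hB0, fun ε hε => ?_⟩
  obtain ⟨ρ, hρ, hrem⟩ := hT.remainder_le hexp hB0 hε
  refine ⟨ρ, hρ, fun t r x' hx' hθ hrs hrD hMt hw => ?_⟩
  obtain ⟨hr, ν, hν, hb, hN⟩ := hbound t r x' hx' hrs hrD hMt hw
  set θ := ‖x'‖ ^ 2 + |t - t₀| with hθdef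
  have hτ0 := abs_nonneg (t - t₀)
  have hx0 := sq_nonneg ‖x'‖
  have hθ0 : 0 ≤ θ := by positivity
  have hCB : C ≤ B := by
    have : 0 ≤ 2 + 2 * s * C + 2 * s ^ 2 * C := by positivity
    linarith
  have hh2 : ‖(x' + r • e) + s • (ν + e)‖ ^ 2 ≤ B * θ := by
    have h1 : ‖(x' + r • e) + s • (ν + e)‖ ^ 2
        ≤ 2 * (‖x' + r • e‖ ^ 2 + ‖s • (ν + e)‖ ^ 2) := by
      have h2 : ‖(x' + r • e) + s • (ν + e)‖ ^ 2 ≤ (‖x' + r • e‖ + ‖s • (ν + e)‖) ^ 2 := by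
        gcongr
        exact norm_add_le _ _
      exact h2.trans add_sq_le
    rw [norm_add_smul_sq hT.norm_eq hx', norm_smul, mul_pow, Real.norm_of_nonneg hs.le] at h1
    have h2 : r ^ 2 ≤ s * (C * θ) := by
      rw [← sq_abs, sq]
      exact mul_le_mul hrs hr (abs_nonneg _) hs.le
    have h3 : s ^ 2 * ‖ν + e‖ ^ 2 ≤ s ^ 2 * (C * θ) := by gcongr
    have h4 : 0 ≤ C * θ := by positivity
    rw [hB]
    linarith
  refine ⟨hr.trans (by gcongr), (x' + r • e) + s • (ν + e), hh2, ?_⟩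
  set h := (x' + r • e) + s • (ν + e) with hh
  have hz : y - s • e + h = y + (x' + r • e) + s • ν := by rw [hh]; module
  have hwK : y + (x' + r • e) ∈ closure (Ω t) := frontier_subset_closure hw
  have hdist : dist (y - s • e + h) (y + (x' + r • e)) = s := by
    rw [hz, dist_self_add_left, norm_smul, hν, Real.norm_of_nonneg hs.le, mul_one]
  have hnear : dist (y - s • e + h) (y + (x' + r • e))
      = infDist (y - s • e + h) (closure (Ω t)) := by
    refine le_antisymm ?_ (infDist_le_dist_of_mem hwK)
    rw [Metric.le_infDist ⟨_, hwK⟩]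
    intro b hb'
    have h1 := hb b hb'
    have h2 : dist (y + (x' + r • e) + R • ν) (y - s • e + h) = R - s := by
      rw [hz, dist_add_left, dist_eq_norm, ← sub_smul, norm_smul, hν, mul_one,
        Real.norm_of_nonneg (by linarith [hT.s_lt])]
    linarith [dist_triangle (y + (x' + r • e) + R • ν) (y - s • e + h) b]
  have h1 := (abs_le.1 (hrem t x' h hθ hh2)).1
  rw [distPotential_eq hnear, inner_expansion hT.norm_eq hx'] at h1
  linarith

theorem tendsto_second_difference (hT : IsTouched Ω R t₀ y e s D)
    (hexp : HasParabolicExpansionAt (fun q => distPotential (closure (Ω q.2)) q.1) y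
      (y - s • e, t₀) v A) (h : X) :
    Tendsto (fun ε : ℝ => (distPotential (closure (Ω t₀)) (y - s • e + ε • h)
      - (⟪y - s • e, y⟫ - ‖y‖ ^ 2 / 2) - ε * ⟪h, y⟫) / ε ^ 2) (𝓝[>] 0) (𝓝 (⟪h, A h⟫ / 2)) := by
  have ht : Tendsto (fun ε : ℝ => (y - s • e + ε • h, t₀)) (𝓝[>] 0) (𝓝 (y - s • e, t₀)) := by
    have hc : Continuous fun ε : ℝ => (y - s • e + ε • h, t₀) := by fun_prop
    simpa using (hc.tendsto 0).mono_left nhdsWithin_le_nhds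
  have h1 := hexp.comp_tendsto ht
  have h2 : (fun ε : ℝ => distPotential (closure (Ω t₀)) (y - s • e + ε • h)
      - (⟪y - s • e, y⟫ - ‖y‖ ^ 2 / 2) - ε * ⟪h, y⟫ - ε ^ 2 * (⟪h, A h⟫ / 2))
      =o[𝓝[>] 0] fun ε : ℝ => ε ^ 2 := by
    have h3 : (fun ε : ℝ => ‖ε • h‖ ^ 2) =O[𝓝[>] 0] fun ε : ℝ => ε ^ 2 := by
      refine IsBigO.of_bound (‖h‖ ^ 2) (Eventually.of_forall fun ε => ?_)
      rw [norm_smul, mul_pow, norm_mul, norm_pow, norm_norm, norm_pow, norm_pow, norm_norm]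
      exact le_of_eq (by ring)
    refine (h1.congr ?_ ?_).trans_isBigO h3
    · intro ε
      simp only [Function.comp_apply, sub_self, mul_zero, sub_zero, add_sub_cancel_left, map_smul,
        real_inner_smul_left, real_inner_smul_right]
      rw [distPotential_eq hT.dist_eq]
      ring
    · intro ε
      simp
  have h3 := h2.tendsto_div_nhds_zero
  have h4 := h3.add_const (⟪h, A h⟫ / 2)
  rw [zero_add] at h4
  refine h4.congr' ?_
  filter_upwards [self_mem_nhdsWithin] with ε (hε : 0 < ε)
  field_simp
  ring

/-- The quadratic form of the expansion is nonnegative because the potential lies above its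
tangent plane. -/
theorem inner_nonneg (hT : IsTouched Ω R t₀ y e s D)
    (hexp : HasParabolicExpansionAt (fun q => distPotential (closure (Ω q.2)) q.1) y
      (y - s • e, t₀) v A) (h : X) : 0 ≤ ⟪h, A h⟫ := by
  have h1 := ge_of_tendsto' (hT.tendsto_second_difference hexp h) (b := 0) fun ε => by
    have := distPotential_add_inner_le hT.mem_closure hT.dist_eq (y - s • e + ε • h)
    rw [distPotential_eq hT.dist_eq, add_sub_cancel_left, real_inner_smul_left] at this
    exact div_nonneg (by linarith) (sq_nonneg _)
  linarith

/-- The potential is affine on the segment from `y - s e` to `y`, where `y` is the nearest point. -/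
theorem inner_eq_zero (hT : IsTouched Ω R t₀ y e s D)
    (hexp : HasParabolicExpansionAt (fun q => distPotential (closure (Ω q.2)) q.1) y
      (y - s • e, t₀) v A) : ⟪e, A e⟫ = 0 := by
  have hs := hT.s_pos
  have h1 : Tendsto (fun _ : ℝ => (0 : ℝ)) (𝓝[>] 0) (𝓝 (⟪e, A e⟫ / 2)) := by
    refine (hT.tendsto_second_difference hexp e).congr' ?_
    filter_upwards [Ioo_mem_nhdsGT hs] with ε hε
    have e1 : dist (y - s • e + ε • e) y = s - ε := by
      have : y - s • e + ε • e = y - (s - ε) • e := by module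
      rw [this, dist_self_sub_left, norm_smul, hT.norm_eq, mul_one,
        Real.norm_of_nonneg (by linarith [hε.2])]
    have e2 : dist (y - s • e + ε • e) y = infDist (y - s • e + ε • e) (closure (Ω t₀)) := by
      refine le_antisymm ?_ (infDist_le_dist_of_mem hT.mem_closure)
      have := infDist_le_infDist_add_dist (s := closure (Ω t₀)) (x := y - s • e)
        (y := y - s • e + ε • e)
      rw [hT.infDist_eq, dist_self_add_right, norm_smul, hT.norm_eq, mul_one,
        Real.norm_of_nonneg hε.1.le] at this
      linarith
    rw [distPotential_eq e2, inner_add_left, real_inner_smul_left]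
    simp
  have := tendsto_nhds_unique h1 tendsto_const_nhds
  linarith

/-- The interior ball makes the quadratic form positive on the tangent space. -/
theorem inner_pos [FiniteDimensional ℝ X] (hT : IsTouched Ω R t₀ y e s D)
    (hexp : HasParabolicExpansionAt (fun q => distPotential (closure (Ω q.2)) q.1) y
      (y - s • e, t₀) v A) {h : X} (hhe : ⟪h, e⟫ = 0) (hh : h ≠ 0) : 0 < ⟪h, A h⟫ := by
  have hs := hT.s_pos
  have hD := hT.D_pos
  set β := 1 / (2 * (s / D + 1)) with hβ
  have hβ0 : 0 < β := by positivity
  have hball : closedBall (y + D • e) D ⊆ closure (Ω t₀) := by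
    rw [← closure_ball _ hD.ne']
    refine closure_mono fun b hb => ?_
    by_contra hn
    have := infDist_le_dist_of_mem (show b ∈ (Ω t₀)ᶜ from hn) (x := y + D • e)
    rw [mem_ball, dist_comm] at hb
    linarith [hT.le_infDist]
  have h1 : ∀ᶠ ε : ℝ in 𝓝[>] 0, β / 2 * ‖h‖ ^ 2 ≤
      (distPotential (closure (Ω t₀)) (y - s • e + ε • h)
      - (⟪y - s • e, y⟫ - ‖y‖ ^ 2 / 2) - ε * ⟪h, y⟫) / ε ^ 2 := by
    have hsmall : ∀ᶠ ε : ℝ in 𝓝[>] 0, β * (ε * ‖h‖) < D := by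
      have hc : Continuous fun ε : ℝ => β * (ε * ‖h‖) := by fun_prop
      have ht : Tendsto (fun ε : ℝ => β * (ε * ‖h‖)) (𝓝[>] 0) (𝓝 0) := by
        simpa using (hc.tendsto 0).mono_left nhdsWithin_le_nhds
      exact ht.eventually (gt_mem_nhds hD)
    filter_upwards [hsmall, self_mem_nhdsWithin] with ε hε (hε0 : 0 < ε)
    -- the point of the ball over `β ε h`
    set γ := (β * (ε * ‖h‖)) ^ 2 / D with hγ
    have hx' : ⟪(β * ε) • h, e⟫ = 0 := by rw [real_inner_smul_left, hhe, mul_zero]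
    have hnorm : ‖(β * ε) • h‖ = β * (ε * ‖h‖) := by
      rw [norm_smul, Real.norm_of_nonneg (by positivity), mul_assoc]
    have hγ0 : 0 ≤ γ := by positivity
    have hγD : γ * D = (β * (ε * ‖h‖)) ^ 2 := div_mul_cancel₀ _ hD.ne'
    have hγ2 : γ ^ 2 ≤ (β * (ε * ‖h‖)) ^ 2 := by
      have hq0 : 0 ≤ β * (ε * ‖h‖) := by positivity
      have : γ ≤ β * (ε * ‖h‖) := by
        rw [hγ, div_le_iff₀ hD, sq]; gcongr
      gcongr
    have hk : y + ((β * ε) • h + γ • e) ∈ closure (Ω t₀) := by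
      apply hball
      rw [mem_closedBall, dist_eq_norm]
      have e1 : y + ((β * ε) • h + γ • e) - (y + D • e) = (β * ε) • h + (γ - D) • e := by module
      rw [e1]
      refine (pow_le_pow_iff_left₀ (norm_nonneg _) hD.le two_ne_zero).1 ?_
      rw [norm_add_smul_sq hT.norm_eq hx', hnorm]
      nlinarith
    have h2 := le_distPotential hk (y - s • e + ε • h)
    rw [inner_expansion hT.norm_eq hx', hnorm, inner_add_right, real_inner_smul_right _ e,
      real_inner_smul_left h e, hhe, real_inner_smul_left h ((β * ε) • h), real_inner_smul_right,
      real_inner_self_eq_norm_sq, real_inner_smul_left] at h2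
    rw [le_div_iff₀ (by positivity)]
    have h3 : s * γ = s / D * (β * (ε * ‖h‖)) ^ 2 := by rw [hγ]; ring
    have h4 : (s / D + 1) * (β * (ε * ‖h‖)) ^ 2 = β / 2 * (ε * ‖h‖) ^ 2 := by
      rw [hβ]; field_simp
    have h5 : β / 2 * ‖h‖ ^ 2 * ε ^ 2 = β / 2 * (ε * ‖h‖) ^ 2 := by ring
    have h6 : ε * (β * ε * ‖h‖ ^ 2) = β * (ε * ‖h‖) ^ 2 := by ring
    linarith
  have h2 := ge_of_tendsto (hT.tendsto_second_difference hexp h) h1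
  have h3 : 0 < β / 2 * ‖h‖ ^ 2 := by
    have := norm_pos_iff.2 hh
    positivity
  linarith

end Expansion

end IsTouched

end LocalGraph

/-! ### Principal coordinates -/

section Diagonalization

variable {X : Type*} [NormedAddCommGroup X] [InnerProductSpace ℝ X] [FiniteDimensional ℝ X]

/-- A nonnegative quadratic form which vanishes at the unit vector `e` and is positive on `e⊥` is
diagonal in an orthonormal basis whose last vector is `e`. The operator `A` need not be
symmetric. -/
theorem exists_orthonormalBasis_diagonal {m : ℕ} (hm : Module.finrank ℝ X = m + 1) {e : X}
    (he : ‖e‖ = 1) {A : X →L[ℝ] X} (hA : ∀ h, 0 ≤ ⟪h, A h⟫) (hAe : ⟪e, A e⟫ = 0)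
    (hpos : ∀ h, ⟪h, e⟫ = 0 → h ≠ 0 → 0 < ⟪h, A h⟫) :
    ∃ (b : OrthonormalBasis (Fin (m + 1)) ℝ X) (α : Fin m → ℝ), b (Fin.last m) = e ∧
      (∀ i, 0 < α i) ∧ ∀ h, ⟪h, A h⟫ = ∑ i, α i * b.repr h i.castSucc ^ 2 := by
  set S : X →ₗ[ℝ] X :=
    (((1 / 2 : ℝ) • (A + ContinuousLinearMap.adjoint A) : X →L[ℝ] X) : X →ₗ[ℝ] X) with hS
  have hSapp : ∀ x, S x = (1 / 2 : ℝ) • (A x + ContinuousLinearMap.adjoint A x) := fun x => rfl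
  have hsymm : S.IsSymmetric := by
    intro x y
    rw [hSapp, hSapp, real_inner_smul_left, real_inner_smul_right, inner_add_left,
      inner_add_right, ContinuousLinearMap.adjoint_inner_left,
      ContinuousLinearMap.adjoint_inner_right]
    ring
  have hquad : ∀ x, ⟪x, S x⟫ = ⟪x, A x⟫ := by
    intro x
    rw [hSapp, real_inner_smul_right, inner_add_right, ContinuousLinearMap.adjoint_inner_right,
      real_inner_comm x (A x)]
    ring
  -- a nonnegative form is minimal where it vanishes
  have hSe : S e = 0 := by
    by_contra hne
    have h0 : 0 < ‖S e‖ ^ 2 := by positivity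
    have h1 : ∀ c : ℝ, 0 ≤ ⟪S e, A (S e)⟫ + 2 * c * ‖S e‖ ^ 2 := by
      intro c
      have h2 := hA (S e + c • e)
      rw [← hquad, map_add, map_smul, inner_add_left, inner_add_right, inner_add_right,
        real_inner_smul_right, real_inner_smul_left, real_inner_smul_left, real_inner_smul_right,
        hquad e, hAe, ← hsymm e (S e), real_inner_self_eq_norm_sq, hquad] at h2
      linarith
    have h3 := h1 (-(⟪S e, A (S e)⟫ + 1) / (2 * ‖S e‖ ^ 2))
    have h4 : 2 * (-(⟪S e, A (S e)⟫ + 1) / (2 * ‖S e‖ ^ 2)) * ‖S e‖ ^ 2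
        = -(⟪S e, A (S e)⟫ + 1) := by field_simp
    linarith
  set T := (ℝ ∙ e)ᗮ with hT
  have hTmem : ∀ x : X, x ∈ T ↔ ⟪x, e⟫ = 0 := fun x =>
    Submodule.mem_orthogonal_singleton_iff_inner_left
  have hTS : ∀ x ∈ T, S x ∈ T := by
    intro x _
    rw [hTmem, hsymm x e, hSe, inner_zero_right]
  have hfin : Module.finrank ℝ T = m := by
    have : Fact (Module.finrank ℝ X = m + 1) := ⟨hm⟩
    exact Submodule.finrank_orthogonal_span_singleton (norm_ne_zero_iff.1 (by rw [he]; norm_num))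
  have hST := hsymm.restrict_invariant hTS
  set w := hST.eigenvectorBasis hfin with hw
  have hwS : ∀ i, S (w i) = hST.eigenvalues hfin i • (w i : X) := by
    intro i
    have := congrArg Subtype.val (hST.apply_eigenvectorBasis hfin i)
    exact this
  set u : Fin (m + 1) → X := Fin.snoc (fun i => (w i : X)) e with hu
  have huc : ∀ i : Fin m, u i.castSucc = w i := fun i => by simp [hu]
  have hul : u (Fin.last m) = e := by simp [hu]
  have hwe : ∀ i, ⟪(w i : X), e⟫ = 0 := fun i => (hTmem _).1 (w i).2
  have hwn : ∀ i, ‖(w i : X)‖ = 1 := fun i => w.norm_eq_one i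
  have horth : Orthonormal ℝ u := by
    refine ⟨fun i => ?_, fun i j hij => ?_⟩
    · refine Fin.lastCases ?_ (fun i => ?_) i
      · rw [hul, he]
      · rw [huc, hwn]
    · revert hij
      refine Fin.lastCases ?_ (fun i => ?_) i <;> refine Fin.lastCases ?_ (fun j => ?_) j
      · exact fun h => absurd rfl h
      · intro _
        rw [hul, huc, real_inner_comm, hwe]
      · intro _
        rw [hul, huc, hwe]
      · intro h
        rw [huc, huc]
        exact w.inner_eq_zero fun hij => h (by rw [hij])
  obtain ⟨b, hb⟩ := Orthonormal.exists_orthonormalBasis_extension_of_card_eq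
    (by rw [hm, Fintype.card_fin]) (v := u) (s := univ) (horth.comp _ Subtype.val_injective)
  have hb' : ∀ i, b i = u i := fun i => hb i (mem_univ i)
  refine ⟨b, hST.eigenvalues hfin, by rw [hb', hul], fun i => ?_, fun h => ?_⟩
  · have h1 := hpos (w i) (hwe i) (norm_ne_zero_iff.1 (by rw [hwn]; norm_num))
    rw [← hquad, hwS, real_inner_smul_right, real_inner_self_eq_norm_sq, hwn] at h1
    linarith
  · have h1 : S h = ∑ i, b.repr h i • S (b i) := by
      conv_lhs => rw [← b.sum_repr h]
      simp only [map_sum, map_smul]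
    rw [← hquad, h1, inner_sum, Fin.sum_univ_castSucc, hb', hul, hSe, smul_zero, inner_zero_right,
      add_zero]
    refine Finset.sum_congr rfl fun i _ => ?_
    rw [hb', huc, hwS, ← huc, ← hb', real_inner_smul_right, real_inner_smul_right,
      b.repr_apply_apply, real_inner_comm]
    ring

end Diagonalization

section Graph

variable {m : ℕ} {Ω : ℝ → Set (EuclideanSpace ℝ (Fin (m + 1)))} {R M t₀ s D v : ℝ}
  {y e : EuclideanSpace ℝ (Fin (m + 1))}
  {A : EuclideanSpace ℝ (Fin (m + 1)) →L[ℝ] EuclideanSpace ℝ (Fin (m + 1))}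

/-- The point of the hyperplane orthogonal to the last vector of `b` with coordinates `ξ`. -/
def tangentVector (b : OrthonormalBasis (Fin (m + 1)) ℝ (EuclideanSpace ℝ (Fin (m + 1))))
    (ξ : EuclideanSpace ℝ (Fin m)) : EuclideanSpace ℝ (Fin (m + 1)) :=
  ∑ i, ξ i • b (Fin.castSucc i)

section TangentVector

variable (b : OrthonormalBasis (Fin (m + 1)) ℝ (EuclideanSpace ℝ (Fin (m + 1))))

theorem inner_tangentVector_last (ξ : EuclideanSpace ℝ (Fin m)) :
    ⟪tangentVector b ξ, b (Fin.last m)⟫ = 0 := by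
  rw [tangentVector, sum_inner]
  refine Finset.sum_eq_zero fun i _ => ?_
  rw [real_inner_smul_left, b.inner_eq_zero (Fin.castSucc_lt_last i).ne, mul_zero]

theorem repr_tangentVector (ξ : EuclideanSpace ℝ (Fin m)) (i : Fin m) :
    b.repr (tangentVector b ξ) i.castSucc = ξ i := by
  rw [b.repr_apply_apply, tangentVector, inner_sum, Finset.sum_eq_single i]
  · rw [real_inner_smul_right, real_inner_self_eq_norm_sq, b.norm_eq_one]; ring
  · intro j _ hj
    rw [real_inner_smul_right, b.inner_eq_zero, mul_zero]
    exact fun h => hj (Fin.castSucc_injective _ h).symm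
  · exact fun h => absurd (Finset.mem_univ i) h

theorem inner_tangentVector (h : EuclideanSpace ℝ (Fin (m + 1))) (ξ : EuclideanSpace ℝ (Fin m)) :
    ⟪h, tangentVector b ξ⟫ = ∑ i, b.repr h i.castSucc * ξ i := by
  rw [tangentVector, inner_sum]
  refine Finset.sum_congr rfl fun i _ => ?_
  rw [real_inner_smul_right, real_inner_comm, ← b.repr_apply_apply, mul_comm]

theorem norm_tangentVector_sq (ξ : EuclideanSpace ℝ (Fin m)) :
    ‖tangentVector b ξ‖ ^ 2 = ‖ξ‖ ^ 2 := by
  rw [← real_inner_self_eq_norm_sq, inner_tangentVector, EuclideanSpace.norm_sq_eq]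
  refine Finset.sum_congr rfl fun i _ => ?_
  rw [repr_tangentVector, Real.norm_eq_abs, sq_abs, sq]

theorem tangentVector_add (x : EuclideanSpace ℝ (Fin (m + 1))) :
    tangentVector b (WithLp.toLp 2 fun i => b.repr x i.castSucc)
      + b.repr x (Fin.last m) • b (Fin.last m) = x := by
  conv_rhs => rw [← b.sum_repr x]
  rw [Fin.sum_univ_castSucc, tangentVector]

end TangentVector

/-- A boundary point which is touched from both sides, and behind which the potential of the
closures has a parabolic expansion, is a point of (2,1) differentiability. The two bounds for the
graph agree to leading order because `h ↦ h ξ - α h² / 2` is maximal at `h = ξ / α`. -/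
theorem IsTouched.isTwoOneDifferentiableAt (hT : IsTouched Ω R t₀ y e s D)
    (hΩ : IsLipschitzExteriorBallFamily Ω R M)
    (hexp : HasParabolicExpansionAt (fun q => distPotential (closure (Ω q.2)) q.1) y
      (y - s • e, t₀) v A) {E : Set (EuclideanSpace ℝ (Fin (m + 1)) × ℝ)}
    (hE : ∀ᶠ t in 𝓝 t₀, ∀ x, (x, t) ∈ E ↔ x ∈ Ω t) : IsTwoOneDifferentiableAt E y t₀ := by
  have hs := hT.s_pos
  obtain ⟨b, α, hbe, hα, hq⟩ := exists_orthonormalBasis_diagonal finrank_euclideanSpace_fin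
    hT.norm_eq (hT.inner_nonneg hexp) (hT.inner_eq_zero hexp) fun h => hT.inner_pos hexp
  obtain ⟨η, ρ₀, hη, hρ₀, Ψ, hΨ⟩ := hT.exists_graph hΩ
  obtain ⟨δ₀, hδ₀, hE⟩ := Metric.eventually_nhds_iff.1 hE
  have hξe : ∀ ξ, ⟪tangentVector b ξ, e⟫ = 0 := fun ξ => by
    rw [← hbe]; exact inner_tangentVector_last b ξ
  refine ⟨b, fun ξ t => Ψ (tangentVector b ξ) t, min (min 1 (ρ₀ / 2)) (min η δ₀), -v / s,
    fun i => ((α i)⁻¹ - 1) / (2 * s), by positivity, fun x t hxt => ?_, ?_⟩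
  · set δ := min (min 1 (ρ₀ / 2)) (min η δ₀) with hδ
    have hδ0 : 0 < δ := by positivity
    have hδ1 : δ ≤ 1 := (min_le_left _ _).trans (min_le_left _ _)
    have hδ2 : δ ≤ ρ₀ / 2 := (min_le_left _ _).trans (min_le_right _ _)
    have hδ3 : δ ≤ η := (min_le_right _ _).trans (min_le_left _ _)
    have hδ4 : δ ≤ δ₀ := (min_le_right _ _).trans (min_le_right _ _)
    set ξ : EuclideanSpace ℝ (Fin m) := WithLp.toLp 2 fun i => b.repr (x - y) i.castSucc with hξ
    set r := b.repr (x - y) (Fin.last m) with hr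
    have h1 : tangentVector b ξ + r • e = x - y := by
      rw [← hbe]; exact tangentVector_add b (x - y)
    have h2 : ‖tangentVector b ξ‖ ^ 2 + r ^ 2 = dist x y ^ 2 := by
      rw [dist_eq_norm, ← h1, norm_add_smul_sq hT.norm_eq (hξe ξ)]
    have h3 : |t - t₀| < δ := abs_lt_of_sq_lt_sq (by nlinarith [sq_nonneg (dist x y)]) hδ0.le
    have h4 : |r| < δ := abs_lt_of_sq_lt_sq
      (by nlinarith [sq_nonneg ‖tangentVector b ξ‖, sq_nonneg (t - t₀)]) hδ0.le
    have h5 : ‖tangentVector b ξ‖ ^ 2 + |t - t₀| < ρ₀ := by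
      nlinarith [sq_nonneg r, sq_nonneg (t - t₀)]
    have h6 := (hΨ _ t (hξe ξ) h5).2.2.2.2 r (by linarith)
    rw [h1, add_sub_cancel] at h6
    rw [hE (by rw [Real.dist_eq]; linarith) x, h6]
  · rw [isLittleO_iff]
    intro c hc
    set ε := c * s / 2 with hε
    have hε0 : 0 < ε := by positivity
    set a : ℝ := ∑ i, ((α i)⁻¹) ^ 2 with ha
    have ha0 : 0 ≤ a := by positivity
    obtain ⟨B, hB, hup⟩ := hT.upper_expansion hΩ hexp
    obtain ⟨ρ₁, hρ₁, hup⟩ := hup ε hε0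
    obtain ⟨ρ₂, hρ₂, hlow⟩ := hT.lower_expansion hexp ha0 hε0
    have hsmall : ∀ ρ > 0, ∀ᶠ p : EuclideanSpace ℝ (Fin m) × ℝ in 𝓝 (0, t₀),
        ‖p.1‖ ^ 2 + |p.2 - t₀| < ρ := by
      intro ρ hρ
      have hcont : Continuous fun p : EuclideanSpace ℝ (Fin m) × ℝ => ‖p.1‖ ^ 2 + |p.2 - t₀| := by
        fun_prop
      have := hcont.tendsto ((0 : EuclideanSpace ℝ (Fin m)), t₀)
      exact this.eventually (gt_mem_nhds (by simpa using hρ))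
    filter_upwards [hsmall ρ₀ hρ₀, hsmall ρ₁ hρ₁, hsmall ρ₂ hρ₂,
      hsmall (ε / (B ^ 2 + 1)) (by positivity), hsmall (ε ^ 2 / (B ^ 3 + 1)) (by positivity)]
      with p h0 h1 h2 h3 h4
    obtain ⟨ξ, t⟩ := p
    dsimp only at h0 h1 h2 h3 h4 ⊢
    set x' := tangentVector b ξ with hx'
    have hnorm : ‖x'‖ ^ 2 = ‖ξ‖ ^ 2 := norm_tangentVector_sq b ξ
    set θ := ‖ξ‖ ^ 2 + |t - t₀| with hθ
    have hθ0 : 0 ≤ θ := by positivity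
    have hθ' : ‖x'‖ ^ 2 + |t - t₀| = θ := by rw [hnorm]
    rw [lt_div_iff₀ (by positivity)] at h3 h4
    obtain ⟨hrs, hrD, hMt, hfr, -⟩ := hΨ x' t (hξe ξ) (hθ'.trans_lt h0)
    set r := Ψ x' t with hr
    have hξ2 : ‖ξ‖ ^ 2 = ∑ i, ξ i ^ 2 := by
      rw [EuclideanSpace.norm_sq_eq]
      simp only [Real.norm_eq_abs, sq_abs]
    have hinner : ∀ h, ⟪h, x' + r • e⟫ = ∑ i, b.repr h i.castSucc * ξ i + r * ⟪h, e⟫ := by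
      intro h
      rw [inner_add_right, inner_tangentVector, real_inner_smul_right]
    obtain ⟨hrB, h, hhB, hh⟩ := hup t r x' (hξe ξ) (hθ'.trans_lt h1) hrs hrD hMt hfr
    rw [hθ', hinner, hq, hnorm] at hh
    rw [hθ'] at hrB hhB
    -- the increment `ξ / α` is the one for which the lower bound matches the upper bound
    set k : EuclideanSpace ℝ (Fin m) := WithLp.toLp 2 fun i => (α i)⁻¹ * ξ i with hk
    have hkB : ‖tangentVector b k‖ ^ 2 ≤ a * (‖x'‖ ^ 2 + |t - t₀|) := by
      rw [norm_tangentVector_sq, hθ', EuclideanSpace.norm_sq_eq, ha, Finset.sum_mul]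
      refine Finset.sum_le_sum fun i _ => ?_
      have h5 : ξ i ^ 2 ≤ θ := by
        have : ξ i ^ 2 ≤ ∑ i, ξ i ^ 2 :=
          Finset.single_le_sum (f := fun i => ξ i ^ 2) (fun i _ => sq_nonneg _) (Finset.mem_univ i)
        linarith [abs_nonneg (t - t₀)]
      rw [Real.norm_eq_abs, sq_abs]
      simp only [hk, mul_pow]
      gcongr
    have hl := hlow t r x' (tangentVector b k) (hξe ξ) (hθ'.trans_lt h2) hkB
      (frontier_subset_closure hfr)
    rw [hθ', hinner, hq, hnorm, hξe] at hl
    simp only [repr_tangentVector] at hl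
    have e1 : ∑ i, k i * ξ i = ∑ i, (α i)⁻¹ * ξ i ^ 2 :=
      Finset.sum_congr rfl fun i _ => by simp only [hk]; ring
    have e2 : ∑ i, α i * k i ^ 2 = ∑ i, (α i)⁻¹ * ξ i ^ 2 :=
      Finset.sum_congr rfl fun i _ => by
        have := (hα i).ne'
        simp only [hk]; field_simp
    rw [e1, e2] at hl
    have e3 : ∑ i, b.repr h i.castSucc * ξ i - (∑ i, α i * b.repr h i.castSucc ^ 2) / 2
        ≤ (∑ i, (α i)⁻¹ * ξ i ^ 2) / 2 := by
      rw [Finset.sum_div, Finset.sum_div, ← Finset.sum_sub_distrib]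
      refine Finset.sum_le_sum fun i _ => ?_
      have h5 := hα i
      have h6 : (α i)⁻¹ * ξ i ^ 2 / 2 - (b.repr h i.castSucc * ξ i
          - α i * b.repr h i.castSucc ^ 2 / 2)
          = (α i)⁻¹ * (ξ i - α i * b.repr h i.castSucc) ^ 2 / 2 := by
        field_simp; ring
      have h7 : 0 ≤ (α i)⁻¹ * (ξ i - α i * b.repr h i.castSucc) ^ 2 / 2 := by positivity
      linarith
    have e4 : ∑ i, ((α i)⁻¹ - 1) / (2 * s) * ξ i ^ 2
        = ((∑ i, (α i)⁻¹ * ξ i ^ 2) - ‖ξ‖ ^ 2) / (2 * s) := by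
      rw [hξ2, ← Finset.sum_sub_distrib, Finset.sum_div]
      exact Finset.sum_congr rfl fun i _ => by ring
    have hr2 : r ^ 2 ≤ ε * θ := by
      have h5 : |r| ^ 2 ≤ (B * θ) ^ 2 := by gcongr
      have h6 : (B * θ) ^ 2 = B ^ 2 * θ * θ := by ring
      have h7 : B ^ 2 * θ * θ ≤ ε * θ := by
        gcongr
        linarith
      linarith [sq_abs r]
    have hrh : r * ⟪h, e⟫ ≤ ε * θ := by
      have h5 : B * ‖h‖ ≤ ε := by
        refine (pow_le_pow_iff_left₀ (by positivity) hε0.le two_ne_zero).1 ?_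
        have h6 : B ^ 2 * ‖h‖ ^ 2 ≤ B ^ 2 * (B * θ) := by gcongr
        linarith
      calc r * ⟪h, e⟫ ≤ |r| * |⟪h, e⟫| := by rw [← abs_mul]; exact le_abs_self _
        _ ≤ (B * θ) * ‖h‖ := by
          gcongr
          have := abs_real_inner_le_norm h e
          rwa [hT.norm_eq, mul_one] at this
        _ = B * ‖h‖ * θ := by ring
        _ ≤ ε * θ := by gcongr
    rw [e4, Real.norm_eq_abs, Real.norm_of_nonneg hθ0]
    have e5 : r - (-v / s * (t - t₀) + ((∑ i, (α i)⁻¹ * ξ i ^ 2) - ‖ξ‖ ^ 2) / (2 * s))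
        = (s * r + v * (t - t₀) - ((∑ i, (α i)⁻¹ * ξ i ^ 2) - ‖ξ‖ ^ 2) / 2) / s := by
      field_simp; ring
    rw [e5, abs_div, abs_of_pos hs, div_le_iff₀ hs]
    have e6 : c * θ * s = 2 * (ε * θ) := by rw [hε]; ring
    rw [e6, abs_le]
    have h8 := sq_nonneg r
    have h9 : 0 ≤ ε * θ := by positivity
    constructor <;> linarith

end Graph

/-! ### Localization in time and conclusion -/

section LongRay

variable {X : Type*} [NormedAddCommGroup X] [InnerProductSpace ℝ X] [FiniteDimensional ℝ X]

/-- A ray which realizes the distance to the complement beyond its point in the boundary exhibits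
this point as touched from both sides. -/
theorem IsLipschitzExteriorBallFamily.exists_isTouched {Ω : ℝ → Set X} {R M : ℝ}
    (hΩ : IsLipschitzExteriorBallFamily Ω R M) {z : X} {t l : ℝ} (hl : 1 < l)
    (hz : (z, t) ∈ longRay Ω R l) :
    ∃ e s, IsTouched Ω R t (metricProj (closure (Ω t)) z) e s ((l - 1) * s) ∧
      metricProj (closure (Ω t)) z - s • e = z ∧ metricProj (closure (Ω t)) z ∉ Ω t ∧
      ∀ k, rayMap (closure (Ω t)) k z = metricProj (closure (Ω t)) z + ((k - 1) * s) • e := by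
  obtain ⟨⟨hs, hsR⟩, hlong⟩ := hz
  dsimp only at hs hsR hlong
  set y := metricProj (closure (Ω t)) z with hy
  set s := infDist z (closure (Ω t)) with hs'
  obtain ⟨hyK, hyz⟩ := metricProj_spec isClosed_closure (hΩ.closure_family.nonempty t) z
  rw [← hy] at hyK hyz
  set e : X := s⁻¹ • (y - z) with he
  have hse : s • e = y - z := by rw [he, smul_smul, mul_inv_cancel₀ hs.ne', one_smul]
  have hyse : y - s • e = z := by rw [hse]; abel
  have he1 : ‖e‖ = 1 := by
    rw [he, norm_smul, norm_inv, Real.norm_of_nonneg hs.le, ← dist_eq_norm, dist_comm, hyz,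
      inv_mul_cancel₀ hs.ne']
  have hray : ∀ k, rayMap (closure (Ω t)) k z = y + ((k - 1) * s) • e := by
    intro k
    rw [rayMap, ← hy, mul_smul, hse]
    module
  refine ⟨e, s, ⟨hs, hsR, by nlinarith, he1, hyK, by rw [hyse], ?_⟩, hyse, fun hyΩ => ?_, hray⟩
  · rwa [← hray]
  · have hc : Continuous fun ε : ℝ => y - ε • e := by fun_prop
    have hlim : Tendsto (fun ε : ℝ => y - ε • e) (𝓝[>] 0) (𝓝 y) := by
      simpa using (hc.tendsto 0).mono_left nhdsWithin_le_nhds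
    obtain ⟨ε, hεΩ, hε⟩ := ((hlim.eventually ((hΩ.isOpen t).mem_nhds hyΩ)).and
      (Ioo_mem_nhdsGT hs)).exists
    have h1 : s ≤ dist z (y - ε • e) := infDist_le_dist_of_mem (subset_closure hεΩ)
    have h2 : z - (y - ε • e) = (ε - s) • e := by rw [← hyse]; module
    rw [dist_eq_norm, h2, norm_smul, he1, mul_one, Real.norm_eq_abs, abs_sub_comm,
      abs_of_pos (by linarith [hε.2])] at h1
    linarith [hε.1]

end LongRay

section Family

theorem infDist_le_of_diff_subset_thickening {X : Type*} [PseudoMetricSpace X] {U V B : Set X}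
    {c : ℝ} (hc : 0 ≤ c) (hB : B ⊆ closure U) (hV : V.Nonempty) (h : V \ U ⊆ thickening c B)
    (x : X) : infDist x U ≤ infDist x V + c := by
  rw [← sub_le_iff_le_add, le_infDist hV]
  intro w hw
  by_cases hwU : w ∈ U
  · linarith [infDist_le_dist_of_mem hwU (x := x)]
  · obtain ⟨q, hq, hwq⟩ := mem_thickening_iff.1 (h ⟨hw, hwU⟩)
    have h1 : infDist x U ≤ dist x q := by
      rw [← infDist_closure]
      exact infDist_le_dist_of_mem (hB hq)
    linarith [dist_triangle x w q]

variable {X : Type*} [NormedAddCommGroup X] [InnerProductSpace ℝ X] [FiniteDimensional ℝ X]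
  [Nontrivial X]

/-- A family which is Lipschitz on a compact interval extends to all times, with the values at the
end points. -/
theorem isLipschitzExteriorBallFamily_projIcc {Ω : ℝ → Set X} {a b M r : ℝ} (hab : a ≤ b)
    (hr : 0 < r) (hM : 0 ≤ M) (hopen : ∀ t ∈ Icc a b, IsOpen (Ω t))
    (hbdd : ∀ t ∈ Icc a b, Bornology.IsBounded (Ω t))
    (hreg : ∀ t ∈ Icc a b, interior (closure (Ω t)) = Ω t)
    (hcurv : ∀ t ∈ Icc a b, LowerCurvatureBound (Ω t) r)
    (hlip : ∀ t₁ ∈ Icc a b, ∀ t₂ ∈ Icc a b, (Ω t₁ \ Ω t₂) ∪ (Ω t₂ \ Ω t₁) ⊆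
      thickening (M * |t₁ - t₂|) (frontier (Ω t₁)) ∩
        thickening (M * |t₁ - t₂|) (frontier (Ω t₂))) :
    IsLipschitzExteriorBallFamily (fun t => Ω (projIcc a b hab t)) (2 * r) M := by
  have hle : ∀ s t : ℝ, M * |(projIcc a b hab s : ℝ) - projIcc a b hab t| ≤ M * |s - t| :=
    fun s t =>
      mul_le_mul_of_nonneg_left (abs_projIcc_sub_projIcc hab) hM
  have huniv : ∀ t ∈ Icc a b, Ω t ≠ univ := fun t ht h =>
    NormedSpace.unbounded_univ ℝ X (h ▸ hbdd t ht)
  refine ⟨⟨by positivity, hM, fun t => isClosed_closure,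
    fun t => ((hcurv _ (Subtype.prop _)).nonempty hr).closure,
    fun t => (hcurv _ (Subtype.prop _)).hasReach hr, fun x s t => ?_⟩,
    fun t => hopen _ (Subtype.prop _), fun t => hbdd _ (Subtype.prop _),
    fun t => huniv _ (Subtype.prop _), fun x s t => ?_,
    fun t w hw => (hcurv _ (Subtype.prop _)).exists_exterior_normal hr (hreg _ (Subtype.prop _)) hw⟩
  · rw [infDist_closure, infDist_closure]
    refine (infDist_le_of_diff_subset_thickening (mul_nonneg hM (abs_nonneg _))
      frontier_subset_closure ((hcurv _ (Subtype.prop _)).nonempty hr) ?_ x).trans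
      (add_le_add_right (hle s t) _)
    exact fun w hw => (hlip _ (Subtype.prop _) _ (Subtype.prop _) (Or.inr hw)).1
  · refine (infDist_le_of_diff_subset_thickening (mul_nonneg hM (abs_nonneg _))
      (B := frontier (Ω (projIcc a b hab s))) ?_
      (nonempty_compl.2 (huniv _ (projIcc a b hab t).2)) ?_ x).trans (add_le_add_right (hle s t) _)
    · rw [← frontier_compl]
      exact frontier_subset_closure
    · rintro w ⟨hw1, hw2⟩
      exact (hlip _ (Subtype.prop _) _ (Subtype.prop _)
        (Or.inl ⟨not_notMem.1 hw2, hw1⟩)).1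

end Family

section Conclusion

variable {m : ℕ} {Ω : ℝ → Set (EuclideanSpace ℝ (Fin (m + 1)))}

/-- Almost every point of the space-time set lies on a distance ray from a point of (2,1)
differentiability, for a family defined for all times. The set `E` is only required to agree with
the family near the time of the point. -/
theorem IsLipschitzExteriorBallFamily.ae_isTwoOneDifferentiableAt {R M : ℝ}
    (hΩ : IsLipschitzExteriorBallFamily Ω R M)
    (E : Set (EuclideanSpace ℝ (Fin (m + 1)) × ℝ)) :
    ∀ᵐ p : EuclideanSpace ℝ (Fin (m + 1)) × ℝ, p.1 ∈ Ω p.2 →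
      (∀ᶠ t in 𝓝 p.2, ∀ x, (x, t) ∈ E ↔ x ∈ Ω t) →
      ∃ y z, IsDistanceRay (Ω p.2) y z ∧ p.1 ∈ openSegment ℝ y z ∧
        y ∈ frontier (Ω p.2) ∧ IsTwoOneDifferentiableAt E y p.2 := by
  have h1 := hΩ.closure_family.ae_hasParabolicExpansionAt volume
  have h2 := hΩ.ae_exists_longRay volume (A := {p | ∃ v A, HasParabolicExpansionAt
    (fun q => distPotential (closure (Ω q.2)) q.1) (metricProj (closure (Ω p.2)) p.1) p v A})
    (by filter_upwards [h1] with p hp hpc using hp hpc.2)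
  rw [Measure.volume_eq_prod]
  filter_upwards [h2] with p hp hpΩ hE
  obtain ⟨z, l, l', ⟨v, A, hexp⟩, hl, hll, hz, hzp⟩ := hp hpΩ
  obtain ⟨e, s, hT, hyz, hy, hray⟩ := hΩ.exists_isTouched (hl.trans hll) hz
  have hfr : metricProj (closure (Ω p.2)) z ∈ frontier (Ω p.2) := by
    rw [frontier, (hΩ.isOpen p.2).interior_eq]
    exact ⟨hT.mem_closure, hy⟩
  have hs := hT.s_pos
  obtain ⟨q, hq, hpq⟩ := exists_isDistanceRay (hΩ.isBounded p.2) hfr hy hT.norm_eq hT.le_infDist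
    (mul_pos (sub_pos.2 hl) hs) (by gcongr)
  rw [← hray, hzp] at hpq
  refine ⟨_, q, hq, hpq, hfr, hT.isTwoOneDifferentiableAt hΩ (v := v) (A := A) ?_ hE⟩
  rwa [hyz]

end Conclusion

end

theorem proposition4p1 (r₀ : ℝ) (hr₀ : 0 < r₀) :
    ∃ C : ℝ, ∀ (m : ℕ) (J : Set ℝ) (Ω : ℝ → Set (EuclideanSpace ℝ (Fin (m + 1)))),
      J.OrdConnected →
      (∀ t ∈ J, IsOpen (Ω t)) →
      (∀ t ∈ J, Bornology.IsBounded (Ω t)) →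
      (∀ t ∈ J, interior (closure (Ω t)) = Ω t) →
      IsLocallyLipschitzFamily J Ω →
      (∀ t ∈ J, LowerCurvatureBound (Ω t) r₀) →
      (∀ᵐ p : EuclideanSpace ℝ (Fin (m + 1)) × ℝ, p ∈ spaceTime J Ω →
        ∃ y z, IsDistanceRay (Ω p.2) y z ∧ p.1 ∈ openSegment ℝ y z ∧
          y ∈ frontier (Ω p.2) ∧ IsTwoOneDifferentiableAt (spaceTime J Ω) y p.2) ∧
      (∀ t ∈ J, ConcaveOnNonconvex {x | (x, t) ∈ spaceTimeNhd J Ω r₀}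
        fun x => signedBoundaryDist (Ω t) x - C * ‖x‖ ^ 2) := by
  refine ⟨(2 * r₀)⁻¹, fun m J Ω hJ hopen hbdd hreg hlip hcurv => ⟨?_, fun t ht => ?_⟩⟩
  · -- it suffices to treat intervals with rational end points on which the family is Lipschitz
    have hrat : ∀ c : ℚ × ℚ, ∀ᵐ p : EuclideanSpace ℝ (Fin (m + 1)) × ℝ,
        Icc (c.1 : ℝ) c.2 ⊆ J →
        (∃ M > 0, ∀ t₁ ∈ Icc (c.1 : ℝ) c.2, ∀ t₂ ∈ Icc (c.1 : ℝ) c.2,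
          (Ω t₁ \ Ω t₂) ∪ (Ω t₂ \ Ω t₁) ⊆
            Metric.thickening (M * |t₁ - t₂|) (frontier (Ω t₁)) ∩
              Metric.thickening (M * |t₁ - t₂|) (frontier (Ω t₂))) →
        p.2 ∈ Ioo (c.1 : ℝ) c.2 → p.1 ∈ Ω p.2 →
        ∃ y z, IsDistanceRay (Ω p.2) y z ∧ p.1 ∈ openSegment ℝ y z ∧
          y ∈ frontier (Ω p.2) ∧ IsTwoOneDifferentiableAt (spaceTime J Ω) y p.2 := by
      rintro ⟨a, b⟩
      dsimp only
      by_cases hsub : Icc (a : ℝ) b ⊆ J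
      swap
      · exact Eventually.of_forall fun p h => absurd h hsub
      by_cases hM : ∃ M > 0, ∀ t₁ ∈ Icc (a : ℝ) b, ∀ t₂ ∈ Icc (a : ℝ) b,
          (Ω t₁ \ Ω t₂) ∪ (Ω t₂ \ Ω t₁) ⊆
            Metric.thickening (M * |t₁ - t₂|) (frontier (Ω t₁)) ∩
              Metric.thickening (M * |t₁ - t₂|) (frontier (Ω t₂))
      swap
      · exact Eventually.of_forall fun p _ h => absurd h hM
      by_cases hab : (a : ℝ) < b
      swap
      · exact Eventually.of_forall fun p _ _ h => absurd (h.1.trans h.2) hab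
      obtain ⟨M, hM0, hM⟩ := hM
      have hfam := isLipschitzExteriorBallFamily_projIcc hab.le hr₀ hM0.le
        (fun t ht => hopen t (hsub ht)) (fun t ht => hbdd t (hsub ht))
        (fun t ht => hreg t (hsub ht)) (fun t ht => hcurv t (hsub ht)) hM
      have hproj : ∀ t ∈ Icc (a : ℝ) b, (projIcc (a : ℝ) b hab.le t : ℝ) = t := fun t ht => by
        rw [projIcc_of_mem hab.le ht]
      filter_upwards [hfam.ae_isTwoOneDifferentiableAt (spaceTime J Ω)] with p hp _ _ hpt hpΩ
      rw [hproj p.2 (Ioo_subset_Icc_self hpt)] at hp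
      refine hp hpΩ ?_
      filter_upwards [Ioo_mem_nhds hpt.1 hpt.2] with t ht x
      rw [hproj t (Ioo_subset_Icc_self ht)]
      exact ⟨fun h => h.2, fun h => ⟨hsub (Ioo_subset_Icc_self ht), h⟩⟩
    have hfr : ∀ᵐ p : EuclideanSpace ℝ (Fin (m + 1)) × ℝ, p.2 ∉ frontier J := by
      have h0 : ∀ᵐ t : ℝ, t ∉ frontier J :=
        measure_eq_zero_iff_ae_notMem.1 (hJ.convex.addHaar_frontier volume)
      rw [Measure.volume_eq_prod]
      exact Measure.quasiMeasurePreserving_snd.ae h0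
    filter_upwards [ae_all_iff.2 hrat, hfr] with p hp hpfr hpE
    obtain ⟨hpJ, hpΩ⟩ := hpE
    have hint : p.2 ∈ interior J := by
      by_contra h
      exact hpfr ⟨subset_closure hpJ, h⟩
    obtain ⟨ε, hε, M, hM0, hM⟩ := hlip p.2 hpJ
    obtain ⟨δ, hδ, hball⟩ := Metric.isOpen_iff.1 isOpen_interior p.2 hint
    obtain ⟨a, ha1, ha2⟩ := exists_rat_btwn (show p.2 - min ε δ < p.2 by simp [hε, hδ])
    obtain ⟨b, hb1, hb2⟩ := exists_rat_btwn (show p.2 < p.2 + min ε δ by simp [hε, hδ])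
    have hmem : ∀ t ∈ Icc (a : ℝ) b, dist t p.2 < min ε δ := fun t ht => by
      rw [Real.dist_eq, abs_lt]
      constructor <;> linarith [ht.1, ht.2]
    have hJt : ∀ t ∈ Icc (a : ℝ) b, t ∈ J := fun t ht =>
      interior_subset (hball ((hmem t ht).trans_le (min_le_right _ _)))
    have hεt : ∀ t ∈ Icc (a : ℝ) b, t ∈ J ∩ Metric.ball p.2 ε := fun t ht =>
      ⟨hJt t ht, (hmem t ht).trans_le (min_le_left _ _)⟩
    exact hp (a, b) hJt ⟨M, hM0, fun t₁ h₁ t₂ h₂ => hM t₁ (hεt t₁ h₁) t₂ (hεt t₂ h₂)⟩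
      ⟨ha2, hb1⟩ hpΩ
  · have hset : {x | (x, t) ∈ spaceTimeNhd J Ω r₀} = Metric.thickening r₀ (Ω t) := by
      ext x
      exact ⟨fun h => h.2, fun h => ⟨ht, h⟩⟩
    rw [hset]
    exact (hcurv t ht).concaveOnNonconvex hr₀ (hreg t ht) fun h =>
      NormedSpace.unbounded_univ ℝ (EuclideanSpace ℝ (Fin (m + 1))) (h ▸ hbdd t ht)
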